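/- Let $n\ge 1$ and let $T$ be a polyhedral tiling of $\mathbb R^n$: a locally finite face-to-face tiling by (not necessarily convex) polyhedra which, with their faces of all dimensions, form a regular CW-structure of $\mathbb R^n$ (every closed $d$-face is polyhedral, spans a $d$-dimensional affine subspace and is a closed topological $d$-ball). Let $T^{(d)}$ be the union of the faces of dimension $\le d$, and let $P=T^{(0)}$ be the vertex set. For $Q\subset\mathbb R^n$ write $B_r[Q-x]$ for the intersection of $Q-x$ with the open ball $B(0,r)$; $B_r[T-x]$ denotes the family of all $B_r[T^{(d)}-x]$. Assume that $T$ has finite local complexity (tile diameters are bounded, and for each $r$ there are only finitely many patches $B_r[T-x]$, $x\in P$) and that $T$ is locally derivable from $P$ (for each $d$ there is $R>0$ such that $B_R[P-x]=B_R[P-y]$ implies $x\in T^{(d)}\Leftrightarrow y\in T^{(d)}$). *Equivariant forms.* A function $f$ on $\mathbb R^n$ is $P$-equivariant with range $R$ if $B_R[P-x]=B_R[P-y]$ implies $f(x)=f(y)$, and strongly $P$-equivariant if it is so for some $R$. A smooth function $\mathbb R^n\to\mathbb R^n$ is weakly $P$-equivariant if for all $l\in\mathbb N$, $\epsilon>0$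 there is a smooth strongly $P$-equivariant function which, together with all derivatives of order $\le l$, is uniformly $\epsilon$-close to it. Let $Z^1_{s-P}$ be the space of smooth closed strongly $P$-equivariant $\mathbb R^n$-valued $1$-forms, $B^1_{s-P}$ (resp. $B^1_{w-P}$) the space of differentials of smooth strongly (resp. weakly) $P$-equivariant functions $\mathbb R^n\to\mathbb R^n$, and $H^1_{s-P}=Z^1_{s-P}/B^1_{s-P}$. *Cohomology of the hull.* Let $\Omega_P$ be the closure of $\{P-x : x\in\mathbb R^n\}$ in the space of closed subsets of $\mathbb R^n$ with the metric $$D(Q,Q')=\inf\{\epsilon>0 : d_H(B_{1/\epsilon}[Q]\cup\partial B(0,1/\epsilon),\,B_{1/\epsilon}[Q']\cup\partial B(0,1/\epsilon))\le\epsilon\},$$ $d_H$ being the Hausdorff distance. The $k$-neighbourhood of a tile $t$ is $\{t\}$ for $k=0$, and for $k\ge1$ the set of tiles meeting its $(k-1)$-neighbourhood. The Anderson–Putnam–Gähler complex $\Gamma^k$ is the CW-complex obtained from the tiles labelled with their $k$-neighbourhoods, taken up to translation, by identifying faces that agree in $T$. Let $\pi_k:T\to\Gamma^k$ be the projection and $I_k:H^1(\Gamma^k,\mathbb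 R^n)\to\check H^1(\Omega_P,\mathbb R^n)$ the canonical map from cellular to Čech cohomology (pull-back along $\Omega_P\to\Gamma^k$). *Negligible classes.* A class in $H^1(\Gamma^k,\mathbb R^n)$ represented by a cellular cocycle $f$ is asymptotically negligible if for every $\epsilon>0$ there is $r_\epsilon$ such that $|f(\gamma)|<\epsilon$ for the image $\gamma$ in $\Gamma^k$ of every edge path of $T$ between vertices $x_1,x_2$ for which $B_r[T-x_1]=B_r[T-x_2]$ for some $r>r_\epsilon$. A class $\eta\in\check H^1(\Omega_P,\mathbb R^n)$ is asymptotically negligible if it is the image under some $I_k$ of an asymptotically negligible class. **Theorem.** There is a linear isomorphism $\Theta:H^1_{s-P}\to\check H^1(\Omega_P,\mathbb R^n)$ with $\Theta[d\varphi]=I_k[J(d\varphi)]$ whenever $d\varphi$ is $P$-equivariant with range $r$ and $k$ is so large that the $r$-neighbourhood of every tile is covered by its $k$-neighbourhood; here $J(d\varphi)$ is the well-defined cellular cocycle of $\Gamma^k$ with value $\varphi(b)-\varphi(a)$ on the image under $\pi_k$ of an oriented edge of $T$ from $a$ to $b$. For every $\eta\in\check H^1(\Omega_P,\mathbb R^n)$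 the following are equivalent: 1. $\eta$ is asymptotically negligible; 2. $\Theta^{-1}(\eta)$ belongs to $(B^1_{w-P}\cap Z^1_{s-P})/B^1_{s-P}$; 3. $\Theta^{-1}(\eta)=[d\varphi]$ for some weakly $P$-equivariant smooth function $\varphi$ whose differential is strongly $P$-equivariant. -/

import Mathlib

open scoped ContDiff

noncomputable section

/-- Euclidean `n`-space. -/
abbrev EucSp (n : ℕ) : Type := EuclideanSpace ℝ (Fin n)

/-! ### First Čech cohomology

Open covers indexed by the points of the space (an open neighbourhood `U x` of every point `x`)
are cofinal among all open covers, and the refinement maps between them can be taken to be the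
identity on indices.  The direct limit, over open covers, of the simplicial `H¹` of the nerve
is therefore the quotient of the functions `X → X → A` that are cocycles on the nerve of some such
cover by those that are coboundaries on the nerve of some such cover. -/

section Cech

variable (X : Type) [TopologicalSpace X] (A : Type) [AddCommGroup A] [Module ℝ A]

/-- An open cover of `X` indexed by the points of `X`, with `x ∈ U x`. -/
def IsPointedCover {X : Type} [TopologicalSpace X] (U : X → Set X) : Prop :=
  ∀ x, IsOpen (U x) ∧ x ∈ U x

theorem IsPointedCover.inter {X : Type} [TopologicalSpace X] {U V : X → Set X}
    (hU : IsPointedCover U) (hV : IsPointedCover V) : IsPointedCover (fun x => U x ∩ V x) :=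
  fun x => ⟨(hU x).1.inter (hV x).1, (hU x).2, (hV x).2⟩

/-- Functions that are `A`-valued simplicial `1`-cocycles on the nerve of some open cover. -/
def cechCocycles : Submodule ℝ (X → X → A) where
  carrier := {g | ∃ U : X → Set X, IsPointedCover U ∧
    ∀ x y z, (U x ∩ U y ∩ U z).Nonempty → g x y + g y z = g x z}
  zero_mem' := ⟨fun _ => Set.univ, fun _ => ⟨isOpen_univ, trivial⟩, fun _ _ _ _ => by simp⟩
  add_mem' := by
    rintro g g' ⟨U, hU, h⟩ ⟨V, hV, h'⟩
    refine ⟨_, hU.inter hV, fun x y z ⟨w, ⟨⟨hx, hx'⟩, ⟨hy, hy'⟩⟩, ⟨hz, hz'⟩⟩ => ?_⟩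
    have e := h x y z ⟨w, ⟨hx, hy⟩, hz⟩
    have e' := h' x y z ⟨w, ⟨hx', hy'⟩, hz'⟩
    simp only [Pi.add_apply]
    rw [← e, ← e']
    abel
  smul_mem' := by
    rintro c g ⟨U, hU, h⟩
    refine ⟨U, hU, fun x y z hw => ?_⟩
    simp only [Pi.smul_apply]
    rw [← smul_add, h x y z hw]

/-- Functions that are simplicial coboundaries on the nerve of some open cover. -/
def cechCoboundaries : Submodule ℝ (X → X → A) where
  carrier := {g | ∃ U : X → Set X, IsPointedCover U ∧
    ∃ b : X → A, ∀ x y, (U x ∩ U y).Nonempty → g x y = b y - b x}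
  zero_mem' := ⟨fun _ => Set.univ, fun _ => ⟨isOpen_univ, trivial⟩, 0, fun _ _ _ => by simp⟩
  add_mem' := by
    rintro g g' ⟨U, hU, b, h⟩ ⟨V, hV, b', h'⟩
    refine ⟨_, hU.inter hV, b + b', fun x y ⟨w, ⟨hx, hx'⟩, ⟨hy, hy'⟩⟩ => ?_⟩
    simp only [Pi.add_apply]
    rw [h x y ⟨w, hx, hy⟩, h' x y ⟨w, hx', hy'⟩]
    abel
  smul_mem' := by
    rintro c g ⟨U, hU, b, h⟩
    refine ⟨U, hU, c • b, fun x y hw => ?_⟩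
    simp only [Pi.smul_apply]
    rw [h x y hw, smul_sub]

/-- The first Čech cohomology of `X` with coefficients in (the discrete group) `A`. -/
abbrev CechH1 : Type :=
  cechCocycles X A ⧸ (cechCoboundaries X A).submoduleOf (cechCocycles X A)

end Cech

/-! ### Patches, hulls, local derivability -/

section Patterns

variable {n : ℕ}

/-- The translate `P - x`. -/
def shiftSet (P : Set (EucSp n)) (x : EucSp n) : Set (EucSp n) := {q | q + x ∈ P}

/-- The `r`-patch `B_r[P] = B(0,r) ∩ P` of `P` around `0`. -/
def patch (r : ℝ) (P : Set (EucSp n)) : Set (EucSp n) := Metric.ball 0 r ∩ P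

/-- The pattern distance: the infimum of the `ε > 0` such that the Hausdorff distance of
`B_{1/ε}[P] ∪ ∂B(0,1/ε)` and `B_{1/ε}[Q] ∪ ∂B(0,1/ε)` is at most `ε`. -/
def patternDist (P Q : Set (EucSp n)) : ENNReal :=
  ⨅ (ε : ℝ) (_ : 0 < ε ∧
    Metric.hausdorffEDist (patch (1 / ε) P ∪ Metric.sphere 0 (1 / ε))
      (patch (1 / ε) Q ∪ Metric.sphere 0 (1 / ε)) ≤ ENNReal.ofReal ε), ENNReal.ofReal ε

/-- The continuous hull of `P`: the closure of the translation orbit of `P` in the space of closed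
subsets for the pattern distance. -/
def Hull (P : Set (EucSp n)) : Type :=
  {Q : Set (EucSp n) // IsClosed Q ∧
    ∀ ε : ENNReal, 0 < ε → ∃ x : EucSp n, patternDist Q (shiftSet P x) < ε}

/-- The topology of the hull: the one given by the pattern distance. -/
instance (P : Set (EucSp n)) : TopologicalSpace (Hull P) where
  IsOpen U := ∀ Q ∈ U, ∃ ε : ENNReal, 0 < ε ∧ ∀ Q' : Hull P, patternDist Q.1 Q'.1 < ε → Q' ∈ U
  isOpen_univ := fun _ _ => ⟨1, one_pos, fun _ _ => trivial⟩
  isOpen_inter := fun U V hU hV Q hQ => by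
    obtain ⟨a, ha, h⟩ := hU Q hQ.1
    obtain ⟨b, hb, h'⟩ := hV Q hQ.2
    exact ⟨min a b, lt_min ha hb, fun Q' hQ' =>
      ⟨h Q' (hQ'.trans_le (min_le_left _ _)), h' Q' (hQ'.trans_le (min_le_right _ _))⟩⟩
  isOpen_sUnion := fun S hS Q ⟨U, hU, hQ⟩ => by
    obtain ⟨a, ha, h⟩ := hS U hU Q hQ
    exact ⟨a, ha, fun Q' hQ' => ⟨U, hU, h Q' hQ'⟩⟩

/-- `Q` is locally derivable from `P`. -/
def LocallyDerivable (P Q : Set (EucSp n)) : Prop :=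
  ∃ R : ℝ, 0 < R ∧ ∀ x y : EucSp n,
    patch R (shiftSet P x) = patch R (shiftSet P y) → (x ∈ Q ↔ y ∈ Q)

/-! ### Pattern equivariant functions and forms -/

/-- `f` is `P`-equivariant with range `R`. -/
def EquivariantRange {Y : Type} (P : Set (EucSp n)) (R : ℝ) (f : EucSp n → Y) : Prop :=
  ∀ x y : EucSp n, patch R (shiftSet P x) = patch R (shiftSet P y) → f x = f y

/-- `f` is strongly `P`-equivariant. -/
def StronglyEquivariant {Y : Type} (P : Set (EucSp n)) (f : EucSp n → Y) : Prop :=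
  ∃ R : ℝ, EquivariantRange P R f

theorem StronglyEquivariant.map₂ {Y₁ Y₂ Y : Type} {P : Set (EucSp n)} {f₁ : EucSp n → Y₁}
    {f₂ : EucSp n → Y₂} (h₁ : StronglyEquivariant P f₁) (h₂ : StronglyEquivariant P f₂)
    (F : Y₁ → Y₂ → Y) : StronglyEquivariant P (fun x => F (f₁ x) (f₂ x)) := by
  obtain ⟨R₁, h₁⟩ := h₁
  obtain ⟨R₂, h₂⟩ := h₂
  have key : ∀ {r R : ℝ}, r ≤ R → ∀ Q Q' : Set (EucSp n), patch R Q = patch R Q' →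
      patch r Q = patch r Q' := by
    intro r R hrR Q Q' h
    have aux : ∀ S : Set (EucSp n), patch r S = Metric.ball 0 r ∩ patch R S := by
      intro S
      rw [patch, patch, ← Set.inter_assoc,
        Set.inter_eq_left.2 (Metric.ball_subset_ball (x := (0 : EucSp n)) hrR)]
    rw [aux, aux, h]
  refine ⟨max R₁ R₂, fun x y h => ?_⟩
  show F (f₁ x) (f₂ x) = F (f₁ y) (f₂ y)
  rw [h₁ x y (key (le_max_left _ _) _ _ h), h₂ x y (key (le_max_right _ _) _ _ h)]

/-- A smooth function is weakly `P`-equivariant if it lies in the closure of the smooth strongly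
`P`-equivariant functions for the topology of uniform convergence of all derivatives (the topology
given by all the seminorms `s_l`). -/
def WeaklyEquivariant (P : Set (EucSp n)) (f : EucSp n → EucSp n) : Prop :=
  ContDiff ℝ ∞ f ∧ ∀ (l : ℕ) (ε : ℝ), 0 < ε → ∃ f' : EucSp n → EucSp n,
    ContDiff ℝ ∞ f' ∧ StronglyEquivariant P f' ∧
      ∀ j ≤ l, ∀ x, ‖iteratedFDeriv ℝ j (fun y => f y - f' y) x‖ < ε

/-- `ℝⁿ`-valued `1`-forms on `ℝⁿ` (no regularity). -/
abbrev OneForm (n : ℕ) : Type := EucSp n → (EucSp n →L[ℝ] EucSp n)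

/-- The additive group structure of a space of forms, recorded for instance search. -/
instance oneFormSubmoduleAddCommGroup (A : Submodule ℝ (OneForm n)) : AddCommGroup A :=
  Submodule.addCommGroup A

/-- The closed smooth strongly `P`-equivariant `ℝⁿ`-valued `1`-forms. -/
def closedStrong (P : Set (EucSp n)) : Submodule ℝ (OneForm n) where
  carrier := {α | ContDiff ℝ ∞ α ∧ StronglyEquivariant P α ∧
    ∀ x v w, fderiv ℝ α x v w = fderiv ℝ α x w v}
  zero_mem' := by
    refine ⟨contDiff_const, ⟨0, fun _ _ _ => rfl⟩, fun x v w => ?_⟩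
    rw [show (0 : OneForm n) = fun _ => 0 from rfl]
    simp
  add_mem' := by
    rintro α β ⟨h1, h2, h3⟩ ⟨k1, k2, k3⟩
    refine ⟨h1.add k1, h2.map₂ k2 (· + ·), fun x v w => ?_⟩
    rw [fderiv_add (h1.differentiable (by simp)).differentiableAt
      (k1.differentiable (by simp)).differentiableAt]
    simp [h3 x v w, k3 x v w]
  smul_mem' := by
    rintro c α ⟨h1, h2, h3⟩
    refine ⟨h1.const_smul c, h2.map₂ h2 (fun a _ => c • a), fun x v w => ?_⟩
    rw [fderiv_const_smul (h1.differentiable (by simp)).differentiableAt]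
    simp [h3 x v w]

/-- The differentials of smooth strongly `P`-equivariant functions. -/
def exactStrong (P : Set (EucSp n)) : Submodule ℝ (OneForm n) where
  carrier := {α | ∃ φ : EucSp n → EucSp n,
    ContDiff ℝ ∞ φ ∧ StronglyEquivariant P φ ∧ ∀ x, fderiv ℝ φ x = α x}
  zero_mem' := ⟨fun _ => 0, contDiff_const, ⟨0, fun _ _ _ => rfl⟩, fun x => by simp⟩
  add_mem' := by
    rintro α β ⟨φ, h1, h2, h3⟩ ⟨ψ, k1, k2, k3⟩
    refine ⟨φ + ψ, h1.add k1, h2.map₂ k2 (· + ·), fun x => ?_⟩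
    rw [fderiv_add (h1.differentiable (by simp)).differentiableAt
      (k1.differentiable (by simp)).differentiableAt, h3, k3]
    rfl
  smul_mem' := by
    rintro c α ⟨φ, h1, h2, h3⟩
    refine ⟨c • φ, h1.const_smul c, h2.map₂ h2 (fun a _ => c • a), fun x => ?_⟩
    rw [fderiv_const_smul (h1.differentiable (by simp)).differentiableAt, h3]
    rfl

/-- The differentials of smooth weakly `P`-equivariant functions. -/
def exactWeak (P : Set (EucSp n)) : Submodule ℝ (OneForm n) where
  carrier := {α | ∃ φ : EucSp n → EucSp n, WeaklyEquivariant P φ ∧ ∀ x, fderiv ℝ φ x = α x}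
  zero_mem' := ⟨fun _ => 0, ⟨contDiff_const, fun l ε hε => ⟨fun _ => 0, contDiff_const,
    ⟨0, fun _ _ _ => rfl⟩, fun j _ x => by
      have : (fun _ : EucSp n => (0 : EucSp n) - 0) = 0 := by ext; simp
      rw [this, iteratedFDeriv_zero]; simpa using hε⟩⟩, fun x => by simp⟩
  add_mem' := by
    rintro α β ⟨φ, ⟨h1, h2⟩, h3⟩ ⟨ψ, ⟨k1, k2⟩, k3⟩
    refine ⟨φ + ψ, ⟨h1.add k1, fun l ε hε => ?_⟩, fun x => ?_⟩
    · obtain ⟨f, f1, f2, f3⟩ := h2 l (ε / 2) (half_pos hε)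
      obtain ⟨g, g1, g2, g3⟩ := k2 l (ε / 2) (half_pos hε)
      refine ⟨f + g, f1.add g1, f2.map₂ g2 (· + ·), fun j hj x => ?_⟩
      have e : (fun y => (φ + ψ) y - (f + g) y)
          = (fun y => φ y - f y) + (fun y => ψ y - g y) := by
        ext y; simp; ring
      have hj' : (j : WithTop ℕ∞) ≤ ∞ := by exact_mod_cast le_top
      rw [e, iteratedFDeriv_add_apply ((h1.sub f1).of_le hj').contDiffAt
        ((k1.sub g1).of_le hj').contDiffAt]
      calc _ ≤ _ := norm_add_le _ _
        _ < ε / 2 + ε / 2 := add_lt_add (f3 j hj x) (g3 j hj x)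
        _ = ε := add_halves ε
    · rw [fderiv_add (h1.differentiable (by simp)).differentiableAt
        (k1.differentiable (by simp)).differentiableAt, h3, k3]
      rfl
  smul_mem' := by
    rintro c α ⟨φ, ⟨h1, h2⟩, h3⟩
    refine ⟨c • φ, ⟨h1.const_smul c, fun l ε hε => ?_⟩, fun x => ?_⟩
    · have hc : 0 < |c| + 1 := by positivity
      obtain ⟨f, f1, f2, f3⟩ := h2 l (ε / (|c| + 1)) (div_pos hε hc)
      refine ⟨c • f, f1.const_smul c, f2.map₂ f2 (fun a _ => c • a), fun j hj x => ?_⟩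
      have e : (fun y => (c • φ) y - (c • f) y) = c • (fun y => φ y - f y) := by
        ext y; simp; ring
      have hj' : (j : WithTop ℕ∞) ≤ ∞ := by exact_mod_cast le_top
      rw [e, iteratedFDeriv_const_smul_apply ((h1.sub f1).of_le hj').contDiffAt, norm_smul,
        Real.norm_eq_abs]
      calc |c| * _ ≤ (|c| + 1) * _ :=
            mul_le_mul_of_nonneg_right (by linarith) (norm_nonneg _)
        _ < (|c| + 1) * (ε / (|c| + 1)) := mul_lt_mul_of_pos_left (f3 j hj x) hc
        _ = ε := by field_simp
    · rw [fderiv_const_smul (h1.differentiable (by simp)).differentiableAt, h3]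
      rfl

/-- The first strongly `P`-equivariant cohomology with values in `ℝⁿ`. -/
abbrev StrongH1 (P : Set (EucSp n)) : Type :=
  closedStrong P ⧸ (exactStrong P).submoduleOf (closedStrong P)

/-- The subspace of `StrongH1 P` formed by the classes of the closed strongly `P`-equivariant forms
that are differentials of weakly `P`-equivariant functions, i.e. the quotient of
`exactWeak P ⊓ closedStrong P` by `exactStrong P`. -/
def weaklyExactClasses (P : Set (EucSp n)) : Submodule ℝ (StrongH1 P) :=
  ((exactWeak P).submoduleOf (closedStrong P)).map
    ((exactStrong P).submoduleOf (closedStrong P)).mkQ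

end Patterns

/-! ### Polyhedral tilings -/

/-- A `d`-dimensional polyhedral cell: a finite union of convex polytopes that spans a
`d`-dimensional affine subspace and is, together with its relative boundary, homeomorphic to the
closed `d`-ball with its boundary sphere. -/
structure IsPolyhedralCell {n : ℕ} (d : ℕ) (c : Set (EucSp n)) : Prop where
  polyhedral : ∃ F : Finset (Finset (EucSp n)),
    c = ⋃ s ∈ F, convexHull ℝ (s : Set (EucSp n))
  dim : Module.finrank ℝ (affineSpan ℝ c).direction = d
  ball : ∃ h : c ≃ₜ Metric.closedBall (0 : EucSp d) 1, ∀ x : c,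
    (x : EucSp n) ∈ intrinsicFrontier ℝ c ↔ (h x : EucSp d) ∈ Metric.sphere (0 : EucSp d) 1

/-- A polyhedral (face to face) tiling of `ℝⁿ` with its faces of all dimensions: `cell d` is the set
of the closed `d`-dimensional faces, and the tiles are the elements of `cell n`.  The tiles need not
be convex.  The field `faceToFace` expresses that tiles, and more generally faces, meet in unions of
common faces. -/
structure PolyhedralTiling (n : ℕ) where
  cell : ℕ → Set (Set (EucSp n))
  isCell : ∀ d, ∀ c ∈ cell d, IsPolyhedralCell d c
  boundary : ∀ d, ∀ c ∈ cell (d + 1),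
    intrinsicFrontier ℝ c = ⋃₀ {b | b ∈ cell d ∧ b ⊆ intrinsicFrontier ℝ c}
  faceToFace : ∀ d d', ∀ c ∈ cell d, ∀ c' ∈ cell d',
    (intrinsicInterior ℝ c ∩ intrinsicInterior ℝ c').Nonempty → c = c'
  covers : ⋃₀ cell n = Set.univ
  locallyFinite : ∀ r : ℝ, {c | ∃ d, c ∈ cell d ∧ (c ∩ Metric.ball 0 r).Nonempty}.Finite

namespace PolyhedralTiling

variable {n : ℕ} (T : PolyhedralTiling n)

/-- The (point set of the) `d`-skeleton of `T`. -/
def skeleton (d : ℕ) : Set (EucSp n) := ⋃ j ≤ d, ⋃₀ T.cell j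

/-- The vertex set of `T`. -/
def vertexSet : Set (EucSp n) := T.skeleton 0

/-- The `r`-patch `B_r[T - x]`.  A tiling is regarded as a subset of `ℝⁿ` through the boundary
points of its tiles (the `(n-1)`-skeleton); as the tiles carry a face structure, the faces of
lower dimension are recorded as well. -/
def tilingPatch (r : ℝ) (x : EucSp n) : ℕ → Set (EucSp n) :=
  fun d => patch r (shiftSet (T.skeleton d) x)

/-- Finite local complexity with respect to translations: the sizes of the tiles are bounded, and
for every `r` there are only finitely many `r`-patches around vertices. -/
def FiniteLocalComplexity : Prop :=
  (∃ D : ℝ, ∀ t ∈ T.cell n, Metric.diam t ≤ D) ∧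
    ∀ r : ℝ, {p | ∃ x ∈ T.vertexSet, p = T.tilingPatch r x}.Finite

/-- `T` is locally derivable from its vertex set. -/
def DerivableFromVertices : Prop := ∀ d, LocallyDerivable T.vertexSet (T.skeleton d)

/-! ### The Anderson-Putnam-Gähler complexes -/

/-- The `k`-neighbourhood of a tile `t`, as a set of tiles. -/
def collar : ℕ → Set (EucSp n) → Set (Set (EucSp n))
  | 0, t => {t}
  | k + 1, t => {s | s ∈ T.cell n ∧ ∃ s' ∈ collar k t, (s ∩ s').Nonempty}

/-- The `d`-dimensional faces of the tiles of the `k`-neighbourhood of `t`. -/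
def collarCells (k : ℕ) (t : Set (EucSp n)) (d : ℕ) : Set (Set (EucSp n)) :=
  {c | c ∈ T.cell d ∧ ∃ s ∈ T.collar k t, c ⊆ s}

/-- The translate by `v` of the tile `t` is a tile `t'`, and the translation by `v` carries the
`k`-neighbourhood of `t` to that of `t'`: the `k`-collared tiles `t` and `t'` represent the same
`k`-collared prototile. -/
def CollarCongruent (k : ℕ) (v : EucSp n) (t t' : Set (EucSp n)) : Prop :=
  t ∈ T.cell n ∧ t' ∈ T.cell n ∧ (fun x => x + v) '' t = t' ∧
    ∀ d, (Set.image (fun x => x + v)) '' T.collarCells k t d = T.collarCells k t' d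

/-- The graph of vertices and edges of `T`; its darts are the oriented edges of `T`. -/
def graph : SimpleGraph (EucSp n) where
  Adj a b := a ≠ b ∧ segment ℝ a b ∈ T.cell 1
  symm := ⟨fun a b h => ⟨h.1.symm, by rw [segment_symm]; exact h.2⟩⟩
  loopless := ⟨fun a h => h.1 rfl⟩

/-- The identification of oriented edges of `T` that generates the equivalence relation whose classes
are the oriented edges of `Γ^k`: corresponding edges of tiles with the same `k`-collared prototile
are identified.  An edge shared by several tiles of `T` is one edge here, so the gluing of
prototiles along faces that agree in `T` is built in. -/
def edgeRel (k : ℕ) (e e' : T.graph.Dart) : Prop :=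
  ∃ v t t', T.CollarCongruent k v t t' ∧ segment ℝ e.fst e.snd ⊆ t ∧
    e'.fst = e.fst + v ∧ e'.snd = e.snd + v

/-- The oriented `1`-cells of the complex `Γ^k`. -/
def APGEdge (k : ℕ) : Type := Quot (T.edgeRel k)

/-- The map `π_k` from the oriented edges of `T` to those of `Γ^k`. -/
def toAPG (k : ℕ) (e : T.graph.Dart) : T.APGEdge k := Quot.mk _ e

/-- The value of a cochain of `Γ^k` on the image in `Γ^k` of an edge path of `T`. -/
def evalPath {k : ℕ} (f : T.APGEdge k → EucSp n) {a b : EucSp n} (p : T.graph.Walk a b) :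
    EucSp n :=
  (p.darts.map (fun e => f (T.toAPG k e))).sum

/-- `f` is an `ℝⁿ`-valued cellular `1`-cocycle of `Γ^k`: it changes sign under reversal of
orientation and vanishes on the boundary of every `2`-cell.  Every `2`-cell of `Γ^k` is the image
of some `2`-cell `w` of `T`, and as `w` is a polygonal disc, `f` vanishes on its boundary cycle if
and only if it vanishes on all closed edge paths running in `w`. -/
def IsCocycle (k : ℕ) (f : T.APGEdge k → EucSp n) : Prop :=
  (∀ e : T.graph.Dart, f (T.toAPG k e.symm) = -f (T.toAPG k e)) ∧
    ∀ w ∈ T.cell 2, ∀ (a : EucSp n) (p : T.graph.Walk a a),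
      (∀ e ∈ p.darts, segment ℝ e.fst e.snd ⊆ w) → T.evalPath f p = 0

/-- `f` represents an asymptotically negligible element of the first cohomology of `Γ^k`: for every
`ε` there is `r_ε` such that `f` is smaller than `ε` on the loops of `Γ^k` defined by edge paths of
`T` between vertices `x₁`, `x₂` forming a recurrence of size larger than `r_ε`.  The size of the
recurrence is the supremum (possibly infinite) of the `r` with `B_r[T - x₁] = B_r[T - x₂]`. -/
def IsNegligibleCocycle (k : ℕ) (f : T.APGEdge k → EucSp n) : Prop :=
  ∀ ε : ℝ, 0 < ε → ∃ rε : ℝ, ∀ x₁ ∈ T.vertexSet, ∀ x₂ ∈ T.vertexSet,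
    (∃ r : ℝ, rε < r ∧ T.tilingPatch r x₁ = T.tilingPatch r x₂) →
      ∀ p : T.graph.Walk x₁ x₂, ‖T.evalPath f p‖ < ε

/-- `η` is the image of the class of the cocycle `f` under the canonical map
`I_k : H¹(Γ^k) → Ȟ¹(Ω)`, the pull-back along `Ω → Γ^k`.  Explicitly: every `ω` in the hull of the
vertex set gets a marker `m ω ∈ ω` and a neighbourhood `U ω`.  A translate `P - y` in `U ω` has the
corresponding marker `v - y` near `m ω`, with `v` a vertex of `T`.  On `U ω ∩ U ω'` the Čech
cocycle is the value of `f` on an edge path from the marker of `ω` to the marker of `ω'`. (The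
translates of `P` are dense in the hull, so it suffices to evaluate there.) -/
def IsCechImage (k : ℕ) (f : T.APGEdge k → EucSp n)
    (η : CechH1 (Hull T.vertexSet) (EucSp n)) : Prop :=
  ∃ g : cechCocycles (Hull T.vertexSet) (EucSp n),
    Submodule.Quotient.mk g = η ∧
    ∃ (U : Hull T.vertexSet → Set (Hull T.vertexSet)) (m : Hull T.vertexSet → EucSp n)
      (δ : Hull T.vertexSet → ℝ), IsPointedCover U ∧ (∀ x, m x ∈ x.1 ∧ 0 < δ x) ∧
      ∀ (x x' ξ : Hull T.vertexSet) (y v v' : EucSp n),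
        ξ.1 = shiftSet T.vertexSet y → ξ ∈ U x → ξ ∈ U x' →
        v ∈ T.vertexSet → v' ∈ T.vertexSet →
        dist (v - y) (m x) < δ x → dist (v' - y) (m x') < δ x' →
        ∀ p : T.graph.Walk v v', g.1 x x' = T.evalPath f p

/-- The asymptotically negligible elements of `Ȟ¹(Ω)`: the images under the maps `I_k` of the
asymptotically negligible elements of `H¹(Γ^k)`. -/
def AsymptoticallyNegligible (η : CechH1 (Hull T.vertexSet) (EucSp n)) : Prop :=
  ∃ (k : ℕ) (f : T.APGEdge k → EucSp n),
    T.IsCocycle k f ∧ T.IsNegligibleCocycle k f ∧ T.IsCechImage k f η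

/-- `k` is large compared to `r`: the open `r`-neighbourhood of every tile is contained in (the union
of the tiles of) its `k`-neighbourhood. -/
def LargeComparedTo (k : ℕ) (r : ℝ) : Prop :=
  ∀ t ∈ T.cell n, Metric.thickening r t ⊆ ⋃₀ T.collar k t

/-- `Θ[dφ] = I_k[J(dφ)]`, where `J(dφ)` is the cocycle on `Γ^k` whose value on the image of an
oriented edge of `T` is the difference of the values of `φ` at its end points, whenever `dφ` is
equivariant with range `r` for the vertex set and `k` is large compared to `r`. -/
def IsTheta (Θ : StrongH1 T.vertexSet ≃ₗ[ℝ] CechH1 (Hull T.vertexSet) (EucSp n)) : Prop :=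
  ∀ (α : closedStrong T.vertexSet) (φ : EucSp n → EucSp n), ContDiff ℝ ∞ φ →
    (∀ x, fderiv ℝ φ x = α.1 x) → ∀ (r : ℝ) (k : ℕ), EquivariantRange T.vertexSet r α.1 →
    T.LargeComparedTo k r → ∃ f : T.APGEdge k → EucSp n, T.IsCocycle k f ∧
      (∀ e : T.graph.Dart, f (T.toAPG k e) = φ e.snd - φ e.fst) ∧
      T.IsCechImage k f (Θ (Submodule.Quotient.mk α))

end PolyhedralTiling

end

/-!
Both cohomologies are isomorphic to the space of functions `F` on `ℝⁿ` whose increments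
`F (y + s) - F y` are determined by the pattern around `y` (`IncrementRange`), modulo the strongly
equivariant functions.

* A closed strongly equivariant form has a potential, and by integration along segments a smooth
  function is such a potential if and only if it has equivariant increments
  (`fderiv_mem_closedStrong_iff`). The form is exact if and only if the potential is strongly
  equivariant (`mem_exactStrong_iff`).
* Finite local complexity and relative density (`DeloneFLC`) make the hull compact, and a
  neighbourhood of a point of the hull is described by a patch up to a small translation. A function
  with equivariant increments has a Čech class: a translate of the pattern near `x` has exactly one
  vertex near a marker chosen in `x`, and the cocycle is the increment of `F` between the vertices
  that correspond to two markers (`exists_markerRel`).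
  Conversely, a Čech cocycle evaluated along the orbit is a cocycle for pairs of close points of
  `ℝⁿ`, hence is given by the increments of a function (`exists_cechRel`, by way of a Lebesgue number
  argument, `exists_lebesgue`). The class is trivial if and only if the function is strongly
  equivariant. The relation between functions and cocycles (`CechRel`) therefore induces the
  isomorphism `Θ` (`DeloneFLC.exists_equiv`).

A function on the vertices with equivariant increments can be smoothed by averaging with weights that
depend on the pattern. This preserves the class, and turns a uniform limit of strongly equivariant
functions on the vertices into a weakly equivariant function (`VertexIncrementRange.exists_smooth`).

A cellular cocycle of `Γ^k` whose class maps to the Čech cohomology vanishes on closed edge paths of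
the tiling, because the value at a pair of equal indices of a Čech cocycle is zero; it is therefore
given by the increments of a function `F` on the vertices. These increments are equivariant since
edge paths can be translated between equal patches (`LocalityRadius.exists_walk_translate`), which
rests on the fact that the relative interiors of the faces are the connected components of the
strata of the skeleta, and so are locally derivable like the skeleta. The cocycle is negligible
exactly if `F` is almost the same at vertices with the same large patch, that is, if `F` is a uniform
limit of strongly equivariant functions on the vertices. Together with the smoothing this gives the
equivalence of negligibility and weak exactness.
-/

/-! ### Patches of point patterns -/

section Patches

open Metric Filter Topology

variable {n : ℕ}

theorem mem_shiftSet {P : Set (EucSp n)} {x q : EucSp n} : q ∈ shiftSet P x ↔ q + x ∈ P := Iff.rfl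

theorem shiftSet_shiftSet (P : Set (EucSp n)) (x y : EucSp n) :
    shiftSet (shiftSet P x) y = shiftSet P (x + y) := by
  ext q
  simp only [mem_shiftSet, add_assoc, add_comm x y]

theorem shiftSet_zero (P : Set (EucSp n)) : shiftSet P 0 = P := by
  ext q
  simp [mem_shiftSet]

theorem patch_eq_iff {r : ℝ} {P Q : Set (EucSp n)} :
    patch r P = patch r Q ↔ ∀ q, ‖q‖ < r → (q ∈ P ↔ q ∈ Q) := by
  simp only [patch, Set.ext_iff, Set.mem_inter_iff, mem_ball_zero_iff]
  exact forall_congr' fun q => by tauto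

theorem patch_mono {r R : ℝ} (h : r ≤ R) {P Q : Set (EucSp n)} (hPQ : patch R P = patch R Q) :
    patch r P = patch r Q :=
  patch_eq_iff.2 fun q hq => patch_eq_iff.1 hPQ q (hq.trans_le h)

/-- Agreement of patches around the origin gives agreement of the smaller patches around nearby
points. -/
theorem patch_shiftSet {r R : ℝ} {P Q : Set (EucSp n)} (hPQ : patch R P = patch R Q)
    {s : EucSp n} (h : r + ‖s‖ ≤ R) : patch r (shiftSet P s) = patch r (shiftSet Q s) :=
  patch_eq_iff.2 fun q hq => patch_eq_iff.1 hPQ (q + s) (by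
    have := norm_add_le q s
    linarith)

theorem patch_shiftSet_add {r R : ℝ} {P : Set (EucSp n)} {y y' s : EucSp n}
    (hPQ : patch R (shiftSet P y) = patch R (shiftSet P y')) (h : r + ‖s‖ ≤ R) :
    patch r (shiftSet P (y + s)) = patch r (shiftSet P (y' + s)) := by
  have := patch_shiftSet hPQ h
  rwa [shiftSet_shiftSet, shiftSet_shiftSet] at this

/-- Points of `P` near `y` can be transported to points of `P` near `y'` if the patches agree. -/
theorem mem_of_patch_eq {R : ℝ} {P : Set (EucSp n)} {y y' s : EucSp n}
    (h : patch R (shiftSet P y) = patch R (shiftSet P y')) (hs : ‖s‖ < R) (hy : y + s ∈ P) :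
    y' + s ∈ P := by
  have := (patch_eq_iff.1 h s hs).1 (by rwa [mem_shiftSet, add_comm])
  rwa [mem_shiftSet, add_comm] at this

/-! ### Delone sets of finite local complexity -/

/-- A relatively dense set `P` with finite local complexity, the latter in the form that `P - P` is
locally finite. -/
structure DeloneFLC (P : Set (EucSp n)) : Prop where
  dense : ∃ ρ : ℝ, 0 < ρ ∧ ∀ y, ∃ v ∈ P, dist v y < ρ
  diffs : ∀ R : ℝ, {q : EucSp n | ‖q‖ < R ∧ ∃ v ∈ P, q + v ∈ P}.Finite

/-- A finite set of points of a normed space is uniformly separated. -/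
theorem Set.Finite.exists_separation {E : Type*} [NormedAddCommGroup E] {S : Set E}
    (hS : S.Finite) : ∃ η : ℝ, 0 < η ∧ ∀ p ∈ S, ∀ q ∈ S, dist p q < η → p = q := by
  have key : ∀ p ∈ S, ∀ᶠ η : ℝ in 𝓝[>] 0, ∀ q ∈ S, dist p q < η → p = q := by
    intro p _
    refine (eventually_all_finite hS).2 fun q _ => ?_
    by_cases hpq : p = q
    · exact Eventually.of_forall fun _ _ => hpq
    · filter_upwards [Ioo_mem_nhdsGT (dist_pos.2 hpq)] with η hη h
      exact absurd h (not_lt.2 hη.2.le)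
  obtain ⟨η, hη, h0⟩ := (((eventually_all_finite hS).2 key).and self_mem_nhdsWithin).exists
  exact ⟨η, h0, hη⟩

namespace DeloneFLC

variable {P : Set (EucSp n)} (hP : DeloneFLC P)
include hP

theorem exists_separation :
    ∃ σ : ℝ, 0 < σ ∧ ∀ v ∈ P, ∀ w ∈ P, dist v w < σ → v = w := by
  obtain ⟨η, h0, hη⟩ := (hP.diffs 1).exists_separation
  refine ⟨min η 1, lt_min h0 one_pos, fun v hv w hw h => ?_⟩
  have h1 : v - w = 0 := by
    refine hη _ ⟨?_, w, hw, by simpa using hv⟩ 0 ⟨by simp, w, hw, by simpa using hw⟩ ?_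
    · rw [← dist_eq_norm]; exact h.trans_le (min_le_right _ _)
    · rw [dist_zero_right, ← dist_eq_norm]; exact h.trans_le (min_le_left _ _)
  exact sub_eq_zero.1 h1

theorem finite_inter_ball (y : EucSp n) (r : ℝ) : {v | v ∈ P ∧ dist v y < r}.Finite := by
  obtain ⟨ρ, hρ, hd⟩ := hP.dense
  obtain ⟨w, hw, hwy⟩ := hd y
  refine ((hP.diffs (r + ρ)).image (fun q => q + w)).subset ?_
  rintro v ⟨hv, hvy⟩
  refine ⟨v - w, ⟨?_, w, hw, by simpa using hv⟩, by simp⟩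
  rw [← dist_eq_norm]
  have := dist_triangle_right v w y
  linarith

/-- There are only finitely many patches of a given radius around the points of `P`. -/
theorem finite_patches (R : ℝ) : {p | ∃ v ∈ P, p = patch R (shiftSet P v)}.Finite := by
  refine (hP.diffs R).finite_subsets.subset ?_
  rintro p ⟨v, hv, rfl⟩ q ⟨hq, hq'⟩
  exact ⟨by simpa using hq, v, hv, hq'⟩

theorem isClosed_shiftSet (y : EucSp n) : IsClosed (shiftSet P y) := by
  obtain ⟨σ, h0, hσ⟩ := hP.exists_separation
  refine isClosed_of_pairwise_le_dist h0 fun p hp q hq hpq => ?_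
  by_contra! h
  exact hpq (add_right_cancel (hσ _ hp _ hq (by simpa using h)))

/-- Compactness of the hull, at the level of patches: along an ultrafilter, the translates of `P`
converge to a limit pattern. -/
theorem exists_limit (y : ℕ → EucSp n) (𝓤 : Ultrafilter ℕ) :
    ∃ Q : Set (EucSp n), IsClosed Q ∧ ∀ R δ : ℝ, 0 < δ → ∀ᶠ N in (𝓤 : Filter ℕ),
      ∃ t : EucSp n, ‖t‖ < δ ∧ patch R Q = patch R (shiftSet P (y N + t)) := by
  obtain ⟨ρ, hρ, hd⟩ := hP.dense
  choose v hv hvy using fun N => hd (y N)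
  -- the limit of the translates centred at points of `P` is reached on every ball
  set Q₀ : Set (EucSp n) := {q | ∀ᶠ N in (𝓤 : Filter ℕ), q + v N ∈ P} with hQ₀
  have hev : ∀ R : ℝ, ∀ᶠ N in (𝓤 : Filter ℕ), patch R Q₀ = patch R (shiftSet P (v N)) := by
    intro R
    obtain ⟨p, -, hp⟩ : ∃ p ∈ {p | ∃ w ∈ P, p = patch R (shiftSet P w)},
        ∀ᶠ N in (𝓤 : Filter ℕ), patch R (shiftSet P (v N)) = p := by
      have := (Ultrafilter.eventually_exists_mem_iff (f := 𝓤) (hP.finite_patches R)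
        (P := fun p N => patch R (shiftSet P (v N)) = p)).1
        (Eventually.of_forall fun N => ⟨_, ⟨v N, hv N, rfl⟩, rfl⟩)
      exact this
    have hQp : patch R Q₀ = p := by
      ext q
      constructor
      · rintro ⟨hq, hq'⟩
        obtain ⟨N, hN, hN'⟩ := (hp.and hq').exists
        rw [← hN]
        exact ⟨hq, hN'⟩
      · intro hq
        obtain ⟨N, hN⟩ := hp.exists
        refine ⟨(hN ▸ hq : q ∈ patch R (shiftSet P (v N))).1, hp.mono fun M hM => ?_⟩
        exact (hM ▸ hq : q ∈ patch R (shiftSet P (v M))).2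
    filter_upwards [hp] with N hN
    rw [hQp, hN]
  obtain ⟨s, -, hs⟩ := (isCompact_closedBall (0 : EucSp n) ρ).ultrafilter_le_nhds
    (𝓤.map fun N => y N - v N) (by
      rw [Ultrafilter.coe_map, le_principal_iff, mem_map]
      refine Filter.univ_mem' fun N => ?_
      simp only [Set.mem_preimage, mem_closedBall_zero_iff]
      rw [← dist_eq_norm, dist_comm]
      exact (hvy N).le)
  have hs : Tendsto (fun N => y N - v N) (𝓤 : Filter ℕ) (𝓝 s) := hs
  have hclosed : IsClosed Q₀ := by
    refine isClosed_of_closure_subset fun q hq => ?_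
    obtain ⟨N, hN⟩ := (hev (‖q‖ + 1)).exists
    have hq1 : q ∈ ball (0 : EucSp n) (‖q‖ + 1) := by simp
    have : q ∈ closure (shiftSet P (v N)) := by
      refine closure_mono ?_ ((isOpen_ball.inter_closure : _ ⊆ closure _) ⟨hq1, hq⟩)
      change patch _ _ ⊆ _
      rw [hN]
      exact Set.inter_subset_right
    rw [(hP.isClosed_shiftSet _).closure_eq] at this
    have h2 : q ∈ patch (‖q‖ + 1) (shiftSet P (v N)) := ⟨hq1, this⟩
    rw [← hN] at h2
    exact h2.2
  refine ⟨shiftSet Q₀ s, hclosed.preimage (continuous_id.add continuous_const), fun R δ hδ => ?_⟩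
  filter_upwards [hev (R + ‖s‖), hs.eventually (ball_mem_nhds s hδ)] with N h1 h2
  refine ⟨v N - y N + s, ?_, ?_⟩
  · rwa [show v N - y N + s = -((y N - v N) - s) by abel, norm_neg, ← dist_eq_norm]
  · have := patch_shiftSet h1 (le_refl (R + ‖s‖))
    rw [this, shiftSet_shiftSet]
    congr 2
    abel

end DeloneFLC

end Patches

/-! ### The topology of the hull -/

section HullTopology

open Metric Filter Topology

variable {n : ℕ}

theorem patternDist_comm (P Q : Set (EucSp n)) : patternDist P Q = patternDist Q P := by
  simp only [patternDist, hausdorffEDist_comm]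

theorem patternDist_le {P Q : Set (EucSp n)} {ε : ℝ} (hε : 0 < ε)
    (h : hausdorffEDist (patch (1 / ε) P ∪ sphere 0 (1 / ε))
      (patch (1 / ε) Q ∪ sphere 0 (1 / ε)) ≤ ENNReal.ofReal ε) :
    patternDist P Q ≤ ENNReal.ofReal ε :=
  iInf₂_le ε ⟨hε, h⟩

/-- Patterns at small pattern distance are close to each other on a large ball. -/
theorem exists_dist_lt_of_patternDist_lt {P Q : Set (EucSp n)} {ε : ℝ}
    (h : patternDist P Q < ENNReal.ofReal ε) {q : EucSp n} (hq : q ∈ P)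
    (hqε : ‖q‖ < 1 / ε - 2 * ε) : ∃ q' ∈ Q, dist q q' < 2 * ε := by
  simp only [patternDist, iInf_lt_iff] at h
  obtain ⟨ε', ⟨h0, h1⟩, h2⟩ := h
  have hlt : ε' < ε := (ENNReal.ofReal_lt_ofReal_iff_of_nonneg h0.le).1 h2
  have hinv : 1 / ε < 1 / ε' := one_div_lt_one_div_of_lt h0 hlt
  have hq1 : q ∈ patch (1 / ε') P ∪ sphere 0 (1 / ε') :=
    Or.inl ⟨by rw [mem_ball_zero_iff]; linarith, hq⟩
  obtain ⟨q', hq', hd⟩ := exists_edist_lt_of_hausdorffEDist_lt (r := ENNReal.ofReal (2 * ε')) hq1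
    (h1.trans_lt ((ENNReal.ofReal_lt_ofReal_iff (by linarith)).2 (by linarith)))
  rw [edist_dist, ENNReal.ofReal_lt_ofReal_iff (by linarith)] at hd
  rcases hq' with hq' | hq'
  · exact ⟨q', hq'.2, by linarith⟩
  · exfalso
    rw [mem_sphere_zero_iff_norm] at hq'
    have : ‖q'‖ ≤ ‖q‖ + dist q q' := by
      rw [dist_comm, dist_eq_norm]
      simpa using norm_add_le q (q' - q)
    linarith

/-- Patterns that agree on a large ball up to a small translation have small distance. -/
theorem exists_patternDist_lt (hn : 0 < n) {ε : ENNReal} (hε : 0 < ε) :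
    ∃ R δ : ℝ, 0 < δ ∧ ∀ (Q Q' : Set (EucSp n)) (t : EucSp n), ‖t‖ < δ →
      patch R Q = patch R (shiftSet Q' t) → patternDist Q Q' < ε := by
  obtain ⟨e, he0, heε⟩ : ∃ e : ℝ, 0 < e ∧ ENNReal.ofReal e < ε := by
    obtain ⟨e, he, he'⟩ := ENNReal.lt_iff_exists_real_btwn.1 hε
    exact ⟨e, ENNReal.ofReal_pos.1 he'.1, he'.2⟩
  have : Nontrivial (EucSp n) := by
    have : Nonempty (Fin n) := ⟨⟨0, hn⟩⟩
    infer_instance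
  have hinv : 0 < 1 / e := by positivity
  -- a point of one pattern within the ball is moved by at most `δ` to a point of the other one
  -- or, near the boundary, to a point of the sphere
  have key : ∀ (Q Q' : Set (EucSp n)) (t : EucSp n), ‖t‖ < min e (1 / e) →
      (∀ q, ‖q‖ < 1 / e → q ∈ Q → q + t ∈ Q') →
      ∀ q ∈ patch (1 / e) Q ∪ sphere 0 (1 / e),
        ∃ q' ∈ patch (1 / e) Q' ∪ sphere 0 (1 / e), edist q q' ≤ ENNReal.ofReal e := by
    intro Q Q' t ht h q hq
    have ht1 := ht.trans_le (min_le_left _ _)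
    have ht2 := ht.trans_le (min_le_right _ _)
    rcases hq with ⟨hq, hqQ⟩ | hq
    · rw [mem_ball_zero_iff] at hq
      by_cases hqt : ‖q + t‖ < 1 / e
      · refine ⟨q + t, Or.inl ⟨by simpa using hqt, h q hq hqQ⟩, ?_⟩
        rw [edist_dist]
        exact ENNReal.ofReal_le_ofReal (by simpa using ht1.le)
      · have hge : 1 / e ≤ ‖q‖ + ‖t‖ := (not_lt.1 hqt).trans (norm_add_le q t)
        have hq0 : 0 < ‖q‖ := by linarith
        refine ⟨(1 / e / ‖q‖) • q, Or.inr ?_, ?_⟩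
        · rw [mem_sphere_zero_iff_norm, norm_smul, Real.norm_of_nonneg (by positivity)]
          field_simp
        · rw [edist_dist]
          refine ENNReal.ofReal_le_ofReal ?_
          have : q - (1 / e / ‖q‖) • q = (1 - 1 / e / ‖q‖) • q := by rw [sub_smul, one_smul]
          rw [dist_eq_norm, this, norm_smul, Real.norm_eq_abs, ← abs_of_pos hq0, ← abs_mul,
            abs_of_pos hq0, sub_mul, div_mul_cancel₀ _ hq0.ne', abs_le]
          constructor <;> linarith
    · exact ⟨q, Or.inr hq, by simp⟩
  refine ⟨1 / e + min e (1 / e), min e (1 / e), lt_min he0 hinv, fun Q Q' t ht h => ?_⟩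
  refine lt_of_le_of_lt (patternDist_le he0 (hausdorffEDist_le_of_mem_edist ?_ ?_)) heε
  · refine key Q Q' t ht fun q hq hqQ => ?_
    exact (patch_eq_iff.1 h q (hq.trans_le (by simp [he0.le]))).1 hqQ
  · refine key Q' Q (-t) (by rwa [norm_neg]) fun q hq hqQ => ?_
    refine (patch_eq_iff.1 h _ ?_).2 (by rwa [mem_shiftSet, neg_add_cancel_right])
    have := norm_add_le q (-t)
    rw [norm_neg] at this
    linarith

theorem patternDist_self_lt (P : Set (EucSp n)) {ε : ENNReal} (hε : 0 < ε) :
    patternDist P P < ε := by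
  obtain ⟨e, he, he'⟩ := ENNReal.lt_iff_exists_real_btwn.1 hε
  exact (patternDist_le (ENNReal.ofReal_pos.1 he'.1) (by simp)).trans_lt he'.2

/-- The patterns in the hull that agree with `Q` on a ball of radius `R` after a translation by less
than `δ`. -/
def hullNhd {P : Set (EucSp n)} (Q : Hull P) (R δ : ℝ) : Set (Hull P) :=
  {ζ | ∃ t : EucSp n, ‖t‖ < δ ∧ patch R Q.1 = patch R (shiftSet ζ.1 t)}

theorem mem_hullNhd_self {P : Set (EucSp n)} (Q : Hull P) (R : ℝ) {δ : ℝ} (hδ : 0 < δ) :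
    Q ∈ hullNhd Q R δ := ⟨0, by simpa using hδ, by rw [shiftSet_zero]⟩

theorem hullNhd_mono {P : Set (EucSp n)} (Q : Hull P) {R R' δ δ' : ℝ} (hR : R' ≤ R)
    (hδ : δ ≤ δ') : hullNhd Q R δ ⊆ hullNhd Q R' δ' :=
  fun _ ⟨t, ht, h⟩ => ⟨t, ht.trans_le hδ, patch_mono hR h⟩

theorem exists_hullNhd_subset (hn : 0 < n) {P : Set (EucSp n)} {U : Set (Hull P)} (hU : IsOpen U)
    {Q : Hull P} (hQ : Q ∈ U) : ∃ R δ : ℝ, 0 < δ ∧ hullNhd Q R δ ⊆ U := by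
  obtain ⟨ε, hε, h⟩ := hU Q hQ
  obtain ⟨R, δ, hδ, h'⟩ := exists_patternDist_lt hn hε
  exact ⟨R, δ, hδ, fun ζ ⟨t, ht, he⟩ => h ζ (h' _ _ t ht he)⟩

namespace DeloneFLC

variable {P : Set (EucSp n)} (hP : DeloneFLC P)

/-- The point `P - y` of the hull. -/
def orb (y : EucSp n) : Hull P :=
  ⟨shiftSet P y, hP.isClosed_shiftSet y, fun _ hε => ⟨y, patternDist_self_lt _ hε⟩⟩

theorem orb_val (y : EucSp n) : (hP.orb y).1 = shiftSet P y := rfl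

theorem eq_orb {ξ : Hull P} {y : EucSp n} (h : ξ.1 = shiftSet P y) : ξ = hP.orb y := Subtype.ext h

include hP in
/-- Every patch of a pattern of the hull is a patch of `P`. -/
theorem exists_patch_eq (Q : Hull P) (R : ℝ) :
    ∃ y, patch R Q.1 = patch R (shiftSet P y) := by
  have hpos : ∀ N : ℕ, (0 : ℝ) < 1 / (N + 1) := fun N => by positivity
  choose y hy using fun N : ℕ => Q.2.2 (ENNReal.ofReal (1 / (N + 1 : ℝ)))
    (ENNReal.ofReal_pos.2 (hpos N))
  obtain ⟨Q', hQ'c, hQ'⟩ := hP.exists_limit y (hyperfilter ℕ)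
  have hev : ∀ r η : ℝ, 0 < η → ∀ᶠ N : ℕ in (hyperfilter ℕ : Filter ℕ),
      r < 1 / (1 / (N + 1 : ℝ)) - 2 * (1 / (N + 1)) ∧ 2 * (1 / (N + 1 : ℝ)) < η := by
    intro r η hη
    refine Filter.Eventually.filter_mono Nat.hyperfilter_le_atTop ?_
    have h1 : ∀ᶠ N : ℕ in atTop, r + 2 < (N : ℝ) :=
      tendsto_natCast_atTop_atTop.eventually_gt_atTop _
    have h2 : ∀ᶠ N : ℕ in atTop, (1 / ((N : ℝ) + 1)) < η / 2 :=
      tendsto_one_div_add_atTop_nhds_zero_nat.eventually_lt_const (by positivity)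
    filter_upwards [h1, h2] with N h1 h2
    refine ⟨?_, by linarith⟩
    have : (1 : ℝ) / (N + 1) ≤ 1 := by
      rw [div_le_one (by positivity)]
      linarith [(Nat.cast_nonneg N : (0 : ℝ) ≤ N)]
    rw [one_div_one_div]
    linarith
  have heq : Q.1 = Q' := by
    apply Set.Subset.antisymm
    · intro q hq
      rw [← hQ'c.closure_eq, Metric.mem_closure_iff]
      intro η hη
      obtain ⟨N, ⟨h1, h2⟩, t, ht, hpt⟩ :=
        ((hev ‖q‖ (η / 2) (by positivity)).and (hQ' (‖q‖ + η) (η / 2) (by positivity))).exists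
      obtain ⟨q', hq', hd⟩ := exists_dist_lt_of_patternDist_lt (hy N) hq h1
      have hdist : dist q (q' - t) < η := by
        calc dist q (q' - t) ≤ dist q q' + dist q' (q' - t) := dist_triangle _ _ _
          _ < η / 2 + η / 2 := add_lt_add (hd.trans h2) (by simpa [dist_eq_norm] using ht)
          _ = η := add_halves η
      refine ⟨q' - t, (patch_eq_iff.1 hpt _ ?_).2 ?_, hdist⟩
      · rw [dist_comm, dist_eq_norm] at hdist
        have := norm_add_le q (q' - t - q)
        rw [add_sub_cancel] at this
        linarith
      · rw [mem_shiftSet] at hq' ⊢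
        convert hq' using 1
        abel
    · intro q hq
      rw [← Q.2.1.closure_eq, Metric.mem_closure_iff]
      intro η hη
      obtain ⟨N, ⟨h1, h2⟩, t, ht, hpt⟩ :=
        ((hev (‖q‖ + η) (η / 2) (by positivity)).and (hQ' (‖q‖ + 1) (η / 2) (by positivity))).exists
      have hqt : q + t ∈ shiftSet P (y N) := by
        have := (patch_eq_iff.1 hpt q (by linarith)).1 hq
        rw [mem_shiftSet] at this ⊢
        convert this using 1
        abel
      have hy' := hy N
      rw [patternDist_comm] at hy'
      obtain ⟨q', hq', hd⟩ := exists_dist_lt_of_patternDist_lt hy' hqt (by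
        have := norm_add_le q t
        linarith)
      refine ⟨q', hq', ?_⟩
      calc dist q q' ≤ dist q (q + t) + dist (q + t) q' := dist_triangle _ _ _
        _ < η / 2 + η / 2 := add_lt_add (by simpa [dist_eq_norm] using ht) (hd.trans h2)
        _ = η := add_halves η
  obtain ⟨N, t, -, h⟩ := (hQ' R 1 one_pos).exists
  exact ⟨_, heq ▸ h⟩

include hP in
/-- By finite local complexity, close patterns of the hull agree on a large ball up to a small
translation. -/
theorem exists_patch_eq_of_patternDist_lt {R δ : ℝ} (hδ : 0 < δ) :
    ∃ ε : ℝ, 0 < ε ∧ ∀ Q Q' : Hull P, patternDist Q.1 Q'.1 < ENNReal.ofReal ε →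
      ∃ t : EucSp n, ‖t‖ < δ ∧ patch R Q.1 = patch R (shiftSet Q'.1 t) := by
  wlog hR : 0 ≤ R generalizing R
  · obtain ⟨ε, hε, h⟩ := this (R := 0) le_rfl
    refine ⟨ε, hε, fun Q Q' hQ => ?_⟩
    obtain ⟨t, ht, h⟩ := h Q Q' hQ
    exact ⟨t, ht, patch_mono (not_le.1 hR).le h⟩
  obtain ⟨ρ, hρ, hd⟩ := hP.dense
  set R₁ := R + ρ + 2 with hR₁
  obtain ⟨η, hη, hsep⟩ := (hP.diffs R₁).exists_separation
  obtain ⟨ε, hε, hε1, hε2, hε3⟩ : ∃ ε : ℝ, 0 < ε ∧ ε ≤ η / 5 ∧ ε ≤ δ / 3 ∧ ε ≤ 1 / (R₁ + 4) :=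
    ⟨min (min (η / 5) (δ / 3)) (1 / (R₁ + 4)), by positivity,
      (min_le_left _ _).trans (min_le_left _ _), (min_le_left _ _).trans (min_le_right _ _),
      min_le_right _ _⟩
  have hε4 : ε ≤ 1 / 4 := hε3.trans (one_div_le_one_div_of_le (by norm_num) (by linarith))
  have hbig : R₁ < 1 / ε - 2 * ε := by
    have : R₁ + 4 ≤ 1 / ε := by
      rw [le_one_div (by positivity) hε]
      exact hε3
    linarith
  refine ⟨ε, hε, fun Q Q' hQ => ?_⟩
  have hQ' : patternDist Q'.1 Q.1 < ENNReal.ofReal ε := by rwa [patternDist_comm]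
  obtain ⟨y, hy⟩ := hP.exists_patch_eq Q R₁
  obtain ⟨y', hy'⟩ := hP.exists_patch_eq Q' R₁
  obtain ⟨v, hv, hvy⟩ := hd y
  rw [dist_eq_norm] at hvy
  have hvQ : v - y ∈ Q.1 :=
    (patch_eq_iff.1 hy (v - y) (by linarith)).2 (by rwa [mem_shiftSet, sub_add_cancel])
  obtain ⟨w, hwQ', hw⟩ := exists_dist_lt_of_patternDist_lt hQ hvQ (by linarith)
  have hwn : ‖w‖ < ρ + 2 * ε := by
    have := norm_add_le (v - y) (w - (v - y))
    rw [dist_comm, dist_eq_norm] at hw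
    rw [add_sub_cancel] at this
    linarith
  have hwP : w + y' ∈ P := (patch_eq_iff.1 hy' w (by linarith)).1 hwQ'
  -- the differences to the reference points `v - y` and `w` lie in a finite set
  have hS : ∀ q ∈ Q.1, ‖q‖ < R + 1 → q - (v - y) ∈ {q : EucSp n | ‖q‖ < R₁ ∧ ∃ v ∈ P, q + v ∈ P} := by
    intro q hq hqn
    refine ⟨?_, v, hv, ?_⟩
    · have := norm_sub_le q (v - y)
      linarith
    · have : q + y ∈ P := (patch_eq_iff.1 hy q (by linarith)).1 hq
      convert this using 1
      abel
  have hS' : ∀ q ∈ Q'.1, ‖q‖ < R + 1 → q - w ∈ {q : EucSp n | ‖q‖ < R₁ ∧ ∃ v ∈ P, q + v ∈ P} := by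
    intro q hq hqn
    refine ⟨?_, w + y', hwP, ?_⟩
    · have := norm_sub_le q w
      linarith
    · have : q + y' ∈ P := (patch_eq_iff.1 hy' q (by linarith)).1 hq
      convert this using 1
      abel
  have ht : ‖w - (v - y)‖ < 2 * ε := by rwa [← dist_eq_norm, dist_comm]
  refine ⟨w - (v - y), by linarith, patch_eq_iff.2 fun q hq => ⟨fun hqQ => ?_, fun hqQ => ?_⟩⟩
  · obtain ⟨q', hq', hqd⟩ := exists_dist_lt_of_patternDist_lt hQ hqQ (by linarith)
    have hq'n : ‖q'‖ < R + 1 := by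
      have := norm_add_le q (q' - q)
      rw [dist_comm, dist_eq_norm] at hqd
      rw [add_sub_cancel] at this
      linarith
    have := hsep _ (hS q hqQ (by linarith)) _ (hS' q' hq' hq'n) (by
      rw [dist_eq_norm] at hqd ⊢
      have := norm_add_le (q - q') (w - (v - y))
      rw [show q - (v - y) - (q' - w) = q - q' + (w - (v - y)) by abel]
      linarith)
    rw [mem_shiftSet]
    convert hq' using 1
    rw [sub_eq_sub_iff_add_eq_add] at this
    rw [← sub_eq_zero, ← sub_eq_zero.2 this]
    abel
  · rw [mem_shiftSet] at hqQ
    have hqn : ‖q + (w - (v - y))‖ < R + 1 := by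
      have := norm_add_le q (w - (v - y))
      linarith
    obtain ⟨q', hq', hqd⟩ := exists_dist_lt_of_patternDist_lt hQ' hqQ (by linarith)
    rw [dist_eq_norm] at hqd
    have hq'n : ‖q'‖ < R + 1 := by
      have h1 := norm_sub_le q (q - q')
      have h2 := norm_sub_le (q + (w - (v - y)) - q') (w - (v - y))
      rw [sub_sub_cancel] at h1
      rw [show q + (w - (v - y)) - q' - (w - (v - y)) = q - q' by abel] at h2
      linarith
    have := hsep _ (hS q' hq' hq'n) _ (hS' _ hqQ hqn) (by
      rw [dist_eq_norm]
      have h2 := norm_sub_le (w - (v - y)) (q + (w - (v - y)) - q')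
      rw [show q' - (v - y) - (q + (w - (v - y)) - w)
        = (w - (v - y)) - (q + (w - (v - y)) - q') by abel]
      linarith)
    have h3 : q' = q := by
      rw [← sub_eq_zero, ← sub_eq_zero.2 this]
      abel
    rwa [← h3]

include hP in
theorem isOpen_hullNhd (Q : Hull P) (R δ : ℝ) : IsOpen (hullNhd Q R δ) := by
  rintro ζ ⟨t, ht, h⟩
  obtain ⟨ε, hε, h'⟩ := hP.exists_patch_eq_of_patternDist_lt (R := R + ‖t‖) (sub_pos.2 ht)
  refine ⟨ENNReal.ofReal ε, ENNReal.ofReal_pos.2 hε, fun ζ' hζ' => ?_⟩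
  obtain ⟨t', ht', hp⟩ := h' ζ ζ' hζ'
  refine ⟨t' + t, (norm_add_le _ _).trans_lt (by linarith), ?_⟩
  rw [h, ← shiftSet_shiftSet]
  exact patch_shiftSet hp le_rfl

/-- Translates of `P` are dense in the hull. -/
theorem exists_orb_mem {U : Set (Hull P)} (hU : IsOpen U) (hne : U.Nonempty) :
    ∃ y, hP.orb y ∈ U := by
  obtain ⟨Q, hQ⟩ := hne
  obtain ⟨ε, hε, h⟩ := hU Q hQ
  obtain ⟨y, hy⟩ := Q.2.2 ε hε
  exact ⟨y, h (hP.orb y) hy⟩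

/-- A Lebesgue number lemma for covers of the hull: the member of the cover that contains `P - y`
together with its small translates can be chosen according to a patch of `P` around `y`. -/
theorem exists_lebesgue (hn : 0 < n) {U : Hull P → Set (Hull P)} (hU : IsPointedCover U)
    (ρ : Hull P → ℝ) : ∃ (R δ : ℝ) (X : EucSp n → Hull P), 0 < δ ∧
      (∀ y y', patch R (shiftSet P y) = patch R (shiftSet P y') → X y = X y') ∧
      ∀ y, ρ (X y) ≤ R ∧ ∀ y', dist y y' < δ → hP.orb y' ∈ U (X y) := by
  -- it suffices to choose the member of the cover for each patch separately
  suffices h : ∃ R δ : ℝ, 0 < δ ∧ ∀ y, ∃ x : Hull P, ρ x ≤ R ∧ ∀ y' t : EucSp n, ‖t‖ < δ →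
      patch R (shiftSet P y) = patch R (shiftSet P (y' + t)) → hP.orb y' ∈ U x by
    obtain ⟨R, δ, hδ, h⟩ := h
    choose x hx1 hx2 using h
    have hc : ∀ y, ∃ z, patch R (shiftSet P z) = patch R (shiftSet P y) := fun y => ⟨y, rfl⟩
    let rep : Set (EucSp n) → EucSp n := fun p =>
      Classical.epsilon fun z => patch R (shiftSet P z) = p
    have hrep : ∀ y, patch R (shiftSet P (rep (patch R (shiftSet P y)))) = patch R (shiftSet P y) :=
      fun y => Classical.epsilon_spec (hc y)
    refine ⟨R, δ, fun y => x (rep (patch R (shiftSet P y))), hδ, fun y y' hy => ?_, fun y => ?_⟩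
    · simp only [hy]
    · refine ⟨hx1 _, fun y' hy' => hx2 _ y' (y - y') (by rwa [← dist_eq_norm]) ?_⟩
      rw [hrep, add_sub_cancel]
  by_contra! hcon
  choose y hy using fun N : ℕ => hcon N (1 / (N + 1)) (by positivity)
  obtain ⟨Q, hQc, hQ⟩ := hP.exists_limit y (hyperfilter ℕ)
  have hQH : ∀ ε : ENNReal, 0 < ε → ∃ x : EucSp n, patternDist Q (shiftSet P x) < ε := by
    intro ε hε
    obtain ⟨R, δ, hδ, h'⟩ := exists_patternDist_lt hn hε
    obtain ⟨N, t, ht, h⟩ := (hQ R δ hδ).exists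
    exact ⟨y N, h' _ _ t ht (by rwa [shiftSet_shiftSet])⟩
  let ζ : Hull P := ⟨Q, hQc, hQH⟩
  obtain ⟨R, δ, hδ, hN⟩ := exists_hullNhd_subset hn (hU ζ).1 (hU ζ).2
  have h1 : ∀ᶠ N : ℕ in (hyperfilter ℕ : Filter ℕ), max (ρ ζ) (R + δ) < (N : ℝ) :=
    Nat.hyperfilter_le_atTop (tendsto_natCast_atTop_atTop.eventually_gt_atTop _)
  have h2 : ∀ᶠ N : ℕ in (hyperfilter ℕ : Filter ℕ), (1 / ((N : ℝ) + 1)) < δ / 2 :=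
    Nat.hyperfilter_le_atTop
      (tendsto_one_div_add_atTop_nhds_zero_nat.eventually_lt_const (by positivity))
  obtain ⟨N, ⟨hN1, hN2⟩, t, ht, hpt⟩ := ((h1.and h2).and (hQ R (δ / 2) (by positivity))).exists
  obtain ⟨y', t', ht', hpt', hnot⟩ := hy N ζ ((le_max_left _ _).trans hN1.le)
  refine hnot (hN ⟨t' + t, (norm_add_le _ _).trans_lt (by linarith), ?_⟩)
  have h3 : R + ‖t‖ ≤ N := by
    have := (le_max_right _ _).trans hN1.le
    linarith
  rw [show ζ.1 = Q from rfl, hpt, orb_val, shiftSet_shiftSet, ← add_assoc]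
  exact patch_shiftSet_add hpt' h3

end DeloneFLC

end HullTopology

/-! ### Functions with pattern equivariant increments -/

section Increments

open Metric Filter Topology

variable {n : ℕ} {P : Set (EucSp n)}

/-- Equal differentials along two parallel segments give equal increments. -/
theorem sub_eq_sub_of_fderiv_eq {φ : EucSp n → EucSp n} (hφ : Differentiable ℝ φ)
    {y y' s : EucSp n}
    (h : ∀ τ ∈ Set.Ico (0 : ℝ) 1, fderiv ℝ φ (y + τ • s) = fderiv ℝ φ (y' + τ • s)) :
    φ (y + s) - φ y = φ (y' + s) - φ y' := by
  let f : ℝ → EucSp n := fun τ => φ (y + τ • s) - φ (y' + τ • s)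
  have hd : ∀ z : EucSp n, ∀ τ : ℝ, HasDerivAt (fun τ : ℝ => φ (z + τ • s))
      (fderiv ℝ φ (z + τ • s) s) τ := by
    intro z τ
    have h1 : HasDerivAt (fun τ : ℝ => z + τ • s) s τ := by
      simpa using ((hasDerivAt_id τ).smul_const s).const_add z
    exact (hφ (z + τ • s)).hasFDerivAt.comp_hasDerivAt τ h1
  have hf : ∀ τ, HasDerivAt f
      (fderiv ℝ φ (y + τ • s) s - fderiv ℝ φ (y' + τ • s) s) τ := fun τ => (hd y τ).sub (hd y' τ)
  have hconst := constant_of_has_deriv_right_zero (f := f) (a := 0) (b := 1)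
    (fun τ _ => (hf τ).continuousAt.continuousWithinAt) (fun τ hτ => by
      have := (hf τ).hasDerivWithinAt (s := Set.Ici τ)
      rwa [h τ hτ, sub_self] at this) 1 (by simp)
  simp only [f, one_smul, zero_smul, add_zero] at hconst
  rw [sub_eq_sub_iff_add_eq_add]
  rw [sub_eq_sub_iff_add_eq_add] at hconst
  rw [hconst, add_comm]

/-- The increment `F (y + s) - F y` only depends on the patch of `P` of radius `R + ‖s‖` around
`y`. These are the potentials, of any regularity, of equivariant differentials; modulo strongly
equivariant functions they represent the first cohomology. -/
def IncrementRange (P : Set (EucSp n)) (R : ℝ) (F : EucSp n → EucSp n) : Prop :=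
  ∀ y y' s, patch (R + ‖s‖) (shiftSet P y) = patch (R + ‖s‖) (shiftSet P y') →
    F (y + s) - F y = F (y' + s) - F y'

namespace IncrementRange

theorem mono {R R' : ℝ} (h : R ≤ R') {F : EucSp n → EucSp n} (hF : IncrementRange P R F) :
    IncrementRange P R' F :=
  fun y y' s hy => hF y y' s (patch_mono (by linarith) hy)

theorem of_equivariant {R : ℝ} {F : EucSp n → EucSp n} (hF : EquivariantRange P R F) :
    IncrementRange P R F := fun y y' s hy => by
  rw [hF y y' (patch_mono (by linarith [norm_nonneg s]) hy),
    hF (y + s) (y' + s) (patch_shiftSet_add hy le_rfl)]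

theorem sub {R R' : ℝ} {F F' : EucSp n → EucSp n} (hF : IncrementRange P R F)
    (hF' : IncrementRange P R' F') :
    IncrementRange P (max R R') (F - F') := fun y y' s hy => by
  have h1 := hF.mono (le_max_left R R') y y' s hy
  have h2 := hF'.mono (le_max_right R R') y y' s hy
  simp only [Pi.sub_apply]
  rw [sub_sub_sub_comm, h1, h2, sub_sub_sub_comm]

/-- Potentials of equivariant forms have equivariant increments. -/
theorem of_fderiv {R : ℝ} {φ : EucSp n → EucSp n} (hφ : Differentiable ℝ φ)
    (h : EquivariantRange P R (fderiv ℝ φ)) : IncrementRange P R φ := by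
  refine fun y y' s hy => sub_eq_sub_of_fderiv_eq hφ fun τ hτ => ?_
  refine h _ _ (patch_shiftSet_add hy ?_)
  rw [norm_smul, Real.norm_of_nonneg hτ.1]
  nlinarith [norm_nonneg s, hτ.2]

/-- Functions whose short increments are equivariant have equivariant increments. -/
theorem of_short {R δ : ℝ} (hδ : 0 < δ) {F : EucSp n → EucSp n}
    (h : ∀ y y' s, ‖s‖ < δ → patch (R + ‖s‖) (shiftSet P y) = patch (R + ‖s‖) (shiftSet P y') →
      F (y + s) - F y = F (y' + s) - F y') : IncrementRange P R F := by
  have key : ∀ k : ℕ, ∀ y y' s, ‖s‖ < 2 ^ k * δ →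
      patch (R + ‖s‖) (shiftSet P y) = patch (R + ‖s‖) (shiftSet P y') →
      F (y + s) - F y = F (y' + s) - F y' := by
    intro k
    induction k with
    | zero => simpa using h
    | succ k ih =>
      intro y y' s hs hy
      have hs2 : ‖(2⁻¹ : ℝ) • s‖ = ‖s‖ / 2 := by
        rw [norm_smul]; norm_num; ring
      have hlt : ‖(2⁻¹ : ℝ) • s‖ < 2 ^ k * δ := by
        rw [hs2]; rw [pow_succ] at hs; linarith
      have h1 := ih y y' _ hlt (patch_mono (by rw [hs2]; linarith [norm_nonneg s]) hy)
      have h2 := ih (y + (2⁻¹ : ℝ) • s) (y' + (2⁻¹ : ℝ) • s) _ hlt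
        (patch_shiftSet_add hy (by rw [hs2]; linarith))
      have hss : (2⁻¹ : ℝ) • s + (2⁻¹ : ℝ) • s = s := by
        rw [← add_smul]; norm_num
      rw [add_assoc, add_assoc, hss] at h2
      have := congrArg₂ (· + ·) h2 h1
      simpa using this
  intro y y' s hy
  obtain ⟨k, hk⟩ := pow_unbounded_of_one_lt (‖s‖ / δ) (one_lt_two : (1 : ℝ) < 2)
  exact key k y y' s ((div_lt_iff₀ hδ).1 hk) hy

end IncrementRange

theorem EquivariantRange.iteratedFDeriv {V : Type} [NormedAddCommGroup V] [NormedSpace ℝ V]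
    {R : ℝ} {f : EucSp n → V} (hf : EquivariantRange P R f) (j : ℕ) :
    EquivariantRange P (R + 1) (iteratedFDeriv ℝ j f) := by
  intro y y' hy
  have h : (fun z => f (y + z)) =ᶠ[𝓝 0] fun z => f (y' + z) := by
    filter_upwards [ball_mem_nhds (0 : EucSp n) one_pos] with z hz
    rw [mem_ball_zero_iff] at hz
    exact hf _ _ (patch_shiftSet_add hy (by linarith))
  have := (h.iteratedFDeriv ℝ j).self_of_nhds
  rwa [iteratedFDeriv_comp_add_left, iteratedFDeriv_comp_add_left, add_zero, add_zero] at this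

theorem IncrementRange.fderiv {R : ℝ} {φ : EucSp n → EucSp n} (h : IncrementRange P R φ) :
    EquivariantRange P (R + 1) (fderiv ℝ φ) := by
  intro y y' hy
  have h : (fun z => φ (y + z)) =ᶠ[𝓝 0] fun z => φ (y' + z) + (φ y - φ y') := by
    filter_upwards [ball_mem_nhds (0 : EucSp n) one_pos] with z hz
    rw [mem_ball_zero_iff] at hz
    have := h y y' z (patch_mono (by linarith) hy)
    rw [sub_eq_iff_eq_add] at this
    rw [this]
    abel
  have := h.fderiv_eq (𝕜 := ℝ)
  rwa [fderiv_comp_add_left, fderiv_add_const, fderiv_comp_add_left, add_zero, add_zero] at this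

/-- Smooth potentials with equivariant increments are the potentials of the closed strongly
equivariant forms. -/
theorem fderiv_mem_closedStrong_iff {φ : EucSp n → EucSp n} (hφ : ContDiff ℝ ∞ φ) :
    fderiv ℝ φ ∈ closedStrong P ↔ ∃ R, IncrementRange P R φ := by
  constructor
  · rintro ⟨-, ⟨R, hR⟩, -⟩
    exact ⟨R, IncrementRange.of_fderiv (hφ.differentiable (by simp)) hR⟩
  · rintro ⟨R, hR⟩
    refine ⟨(contDiff_infty_iff_fderiv.1 hφ).2, ⟨R + 1, hR.fderiv⟩, fun x v w => ?_⟩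
    have h2 : minSmoothness ℝ 2 ≤ ∞ := by
      rw [minSmoothness_of_isRCLikeNormedField]
      exact WithTop.coe_le_coe.2 (le_top : (2 : ℕ∞) ≤ ⊤)
    exact (hφ.contDiffAt.isSymmSndFDerivAt h2 v w)

theorem exists_potential {α : OneForm n} (hα : α ∈ closedStrong P) :
    ∃ φ : EucSp n → EucSp n, ContDiff ℝ ∞ φ ∧ ∀ x, fderiv ℝ φ x = α x := by
  obtain ⟨f, hf⟩ := convex_univ.exists_forall_hasFDerivAt_of_fderiv_symmetric isOpen_univ
    (hα.1.differentiable (by simp)).differentiableOn (fun a _ => hα.2.2 a)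
  have h : fderiv ℝ f = α := funext fun x => (hf x trivial).fderiv
  refine ⟨f, contDiff_infty_iff_fderiv.2 ⟨fun x => (hf x trivial).differentiableAt, ?_⟩,
    fun x => by rw [h]⟩
  rw [h]
  exact hα.1

theorem eq_add_const_of_fderiv_eq {φ ψ : EucSp n → EucSp n} (hφ : ContDiff ℝ ∞ φ)
    (hψ : ContDiff ℝ ∞ ψ) (h : ∀ x, fderiv ℝ φ x = fderiv ℝ ψ x) :
    ∃ c, ∀ x, φ x = ψ x + c := by
  have hφ' := hφ.differentiable (by simp)
  have hψ' := hψ.differentiable (by simp)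
  refine ⟨φ 0 - ψ 0, fun x => ?_⟩
  have := is_const_of_fderiv_eq_zero (𝕜 := ℝ) (hφ'.sub hψ') (fun x => by
    rw [fderiv_sub (hφ' x) (hψ' x), h, sub_self]) x 0
  simp only [Pi.sub_apply] at this
  rw [← this]
  abel

theorem mem_exactStrong_iff {α : OneForm n} {φ : EucSp n → EucSp n} (hφ : ContDiff ℝ ∞ φ)
    (h : ∀ x, fderiv ℝ φ x = α x) : α ∈ exactStrong P ↔ StronglyEquivariant P φ := by
  constructor
  · rintro ⟨ψ, hψ, ⟨R, hR⟩, hψα⟩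
    obtain ⟨c, hc⟩ := eq_add_const_of_fderiv_eq hφ hψ fun x => by rw [h, hψα]
    exact ⟨R, fun x y hxy => by rw [hc, hc, hR x y hxy]⟩
  · exact fun hs => ⟨φ, hφ, hs, h⟩

/-- By finite local complexity, continuous strongly equivariant functions are bounded. -/
theorem DeloneFLC.exists_bound (hP : DeloneFLC P) {V : Type} [NormedAddCommGroup V] {R : ℝ}
    {f : EucSp n → V} (hf : EquivariantRange P R f) (hc : Continuous f) :
    ∃ C, ∀ x, ‖f x‖ ≤ C := by
  obtain ⟨ρ, hρ, hd⟩ := hP.dense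
  have key : ∀ p ∈ {p | ∃ v ∈ P, p = patch (R + ρ) (shiftSet P v)}, ∀ᶠ C : ℝ in atTop,
      ∀ v, patch (R + ρ) (shiftSet P v) = p → ∀ s, ‖s‖ < ρ → ‖f (v + s)‖ ≤ C := by
    rintro p ⟨w, hw, rfl⟩
    obtain ⟨C, hC⟩ := (isCompact_closedBall w ρ).exists_bound_of_continuousOn hc.continuousOn
    filter_upwards [eventually_ge_atTop C] with C' hC' v hv s hs
    rw [hf (v + s) (w + s) (patch_shiftSet_add hv (by linarith))]
    exact (hC _ (by simpa using hs.le)).trans hC'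
  obtain ⟨C, hC⟩ := ((eventually_all_finite (hP.finite_patches (R + ρ))).2 key).exists
  refine ⟨C, fun x => ?_⟩
  obtain ⟨v, hv, hvx⟩ := hd x
  have := hC _ ⟨v, hv, rfl⟩ v rfl (x - v) (by rwa [← dist_eq_norm, dist_comm])
  rwa [add_sub_cancel] at this

/-- A function of pairs of points that satisfies the cocycle identity for small triangles of a
normed space agrees, for close points, with the increments of a function. -/
theorem exists_primitive {E A : Type*} [NormedAddCommGroup E] [NormedSpace ℝ E] [AddCommGroup A]
    {δ : ℝ} (hδ : 0 < δ) {c : E → E → A}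
    (hc : ∀ x y z, dist x y < δ → dist y z < δ → dist x z < δ → c x y + c y z = c x z) :
    ∃ F : E → A, ∀ x y, dist x y < δ → F y - F x = c x y := by
  -- passing through midpoints extends a cocycle from scale `r` to scale `2 r`
  let dbl : (E → E → A) → E → E → A := fun c x y => c x (midpoint ℝ x y) + c (midpoint ℝ x y) y
  have hmid : ∀ x y : E, dist x (midpoint ℝ x y) = dist x y / 2 := fun x y => by
    rw [dist_left_midpoint]; norm_num; ring
  have hmid' : ∀ x y : E, dist (midpoint ℝ x y) y = dist x y / 2 := fun x y => by
    rw [dist_midpoint_right]; norm_num; ring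
  have hmm : ∀ x y z : E, dist (midpoint ℝ x y) (midpoint ℝ y z) = dist x z / 2 := fun x y z => by
    rw [midpoint_comm (R := ℝ) x y, dist_eq_norm, dist_eq_norm, ← vsub_eq_sub, midpoint_vsub_midpoint]
    simp only [vsub_eq_sub, sub_self, midpoint_eq_smul_add, zero_add, norm_smul]
    norm_num
    ring
  let e : ℕ → E → E → A := fun k => dbl^[k] c
  have he : ∀ k, e (k + 1) = dbl (e k) := fun k => Function.iterate_succ_apply' _ _ _
  have hcoc : ∀ k : ℕ, ∀ x y z, dist x y < 2 ^ k * δ → dist y z < 2 ^ k * δ →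
      dist x z < 2 ^ k * δ → e k x y + e k y z = e k x z := by
    intro k
    induction k with
    | zero => simpa [e] using hc
    | succ k ih =>
      intro x y z hxy hyz hxz
      rw [pow_succ] at hxy hyz hxz
      rw [he]
      set a := midpoint ℝ x y with ha
      set b := midpoint ℝ y z with hb
      set d := midpoint ℝ x z with hd
      have d1 : dist x a = dist x y / 2 := hmid x y
      have d2 : dist a y = dist x y / 2 := hmid' x y
      have d3 : dist y b = dist y z / 2 := hmid y z
      have d4 : dist b z = dist y z / 2 := hmid' y z
      have d5 : dist x d = dist x z / 2 := hmid x z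
      have d6 : dist d z = dist x z / 2 := hmid' x z
      have d7 : dist a b = dist x z / 2 := hmm x y z
      have d8 : dist d b = dist x y / 2 := by
        rw [hd, hb, midpoint_comm (R := ℝ) y z]
        exact hmm x z y
      have d9 : dist a d = dist y z / 2 := by
        rw [ha, hd, midpoint_comm (R := ℝ) x y]
        exact hmm y x z
      have t1 := ih x a d (by linarith) (by linarith) (by linarith)
      have t2 := ih a y b (by linarith) (by linarith) (by linarith)
      have t3 := ih a d b (by linarith) (by linarith) (by linarith)
      have t4 := ih d b z (by linarith) (by linarith) (by linarith)
      change e k x a + e k a y + (e k y b + e k b z) = e k x d + e k d z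
      rw [← t4, ← t1, ← add_assoc (e k x a + e k a d), add_assoc (e k x a) (e k a d), t3, ← t2]
      abel
  have hself : ∀ k x, e k x x = 0 := fun k x => by
    have := hcoc k x x x (by simp [hδ]) (by simp [hδ]) (by simp [hδ])
    simpa using this
  have hext : ∀ k x y, dist x y < 2 ^ k * δ → e (k + 1) x y = e k x y := by
    intro k x y hxy
    rw [he]
    have h0 := dist_nonneg (x := x) (y := y)
    exact hcoc k x _ y (by rw [hmid]; linarith) (by rw [hmid']; linarith) hxy
  have hmono : ∀ k m x y, dist x y < 2 ^ k * δ → e (k + m) x y = e k x y := by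
    intro k m x y hxy
    induction m with
    | zero => rfl
    | succ m ih =>
      rw [← add_assoc, hext _ _ _ (hxy.trans_le ?_), ih]
      gcongr
      · exact one_le_two
      · omega
  have hbig : ∀ x y : E, ∃ k : ℕ, dist x y < 2 ^ k * δ := fun x y => by
    obtain ⟨k, hk⟩ := pow_unbounded_of_one_lt (dist x y / δ) (one_lt_two : (1 : ℝ) < 2)
    exact ⟨k, (div_lt_iff₀ hδ).1 hk⟩
  choose K hK using hbig
  have hle : ∀ {k m : ℕ}, k ≤ m → (2 : ℝ) ^ k * δ ≤ 2 ^ m * δ := fun h => by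
    gcongr
    exact one_le_two
  refine ⟨fun y => e (K 0 y) 0 y, fun x y hxy => ?_⟩
  set m := max (K 0 x) (K 0 y) with hm
  have e1 : e m 0 x = e (K 0 x) 0 x := by
    obtain ⟨i, hi⟩ := Nat.exists_eq_add_of_le (le_max_left (K 0 x) (K 0 y))
    rw [hm, hi]
    exact hmono _ _ _ _ (hK 0 x)
  have e2 : e m 0 y = e (K 0 y) 0 y := by
    obtain ⟨i, hi⟩ := Nat.exists_eq_add_of_le (le_max_right (K 0 x) (K 0 y))
    rw [hm, hi]
    exact hmono _ _ _ _ (hK 0 y)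
  have e3 : e m x y = c x y := by
    have := hmono 0 m x y (by simpa using hxy)
    rwa [zero_add] at this
  have hxy' : dist x y < 2 ^ m * δ := by
    have := hle (Nat.zero_le m)
    rw [pow_zero, one_mul] at this
    linarith
  have := hcoc m 0 x y ((hK 0 x).trans_le (hle (le_max_left _ _))) hxy'
    ((hK 0 y).trans_le (hle (le_max_right _ _)))
  rw [e1, e2, e3] at this
  change e (K 0 y) 0 y - e (K 0 x) 0 x = c x y
  rw [← this]
  abel

end Increments

/-! ### Smoothing of functions on a Delone set -/

section Smoothing

open Metric Filter Topology

variable {n : ℕ} {P : Set (EucSp n)} {V : Type} [NormedAddCommGroup V] [NormedSpace ℝ V]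

/-- The sum over `v ∈ P` of the values `G v` weighted by the translates `χ (· - v)` of `χ`. -/
noncomputable def bumpSum (P : Set (EucSp n)) (χ : EucSp n → ℝ) (G : EucSp n → V) (y : EucSp n) : V :=
  ∑ᶠ v ∈ P, χ (y - v) • G v

/-- A smooth function equal to `1` on the ball of radius `ρ` and to `0` outside the ball of radius
`r`. -/
structure IsBump (χ : EucSp n → ℝ) (ρ r : ℝ) : Prop where
  smooth : ContDiff ℝ ∞ χ
  nonneg : ∀ x, 0 ≤ χ x
  one : ∀ x, ‖x‖ < ρ → χ x = 1
  zero : ∀ x, r ≤ ‖x‖ → χ x = 0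
  compact : HasCompactSupport χ

theorem exists_isBump (n : ℕ) {ρ : ℝ} (hρ : 0 < ρ) :
    ∃ χ : EucSp n → ℝ, IsBump χ ρ (ρ + 1) := by
  let f : ContDiffBump (0 : EucSp n) := ⟨ρ, ρ + 1, hρ, by linarith⟩
  refine ⟨f, f.contDiff, fun x => f.nonneg, fun x hx => f.one_of_mem_closedBall ?_,
    fun x hx => f.zero_of_le_dist ?_, f.hasCompactSupport⟩
  · simpa using hx.le
  · simpa using hx

/-- A finite part of `P` that contains the points at distance less than `r` from any point near
`y`. -/
theorem DeloneFLC.exists_finset (hP : DeloneFLC P) (r : ℝ) (y : EucSp n) (d : ℝ) :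
    ∃ S : Finset (EucSp n), (∀ v ∈ S, v ∈ P) ∧ ∀ y' ∈ ball y d, ∀ v ∈ P, dist v y' < r → v ∈ S := by
  refine ⟨(hP.finite_inter_ball y (r + d)).toFinset, fun v hv => ?_, fun y' hy' v hv h => ?_⟩
  · exact ((Set.Finite.mem_toFinset _).1 hv).1
  · refine (Set.Finite.mem_toFinset _).2 ⟨hv, ?_⟩
    rw [mem_ball] at hy'
    have := dist_triangle v y' y
    linarith

namespace IsBump

variable {χ : EucSp n → ℝ} {ρ r : ℝ} (hχ : IsBump χ ρ r)
include hχ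

theorem bumpSum_eq {y : EucSp n} {S : Finset (EucSp n)} (hS : ∀ v ∈ S, v ∈ P)
    (hS' : ∀ v ∈ P, dist v y < r → v ∈ S) (G : EucSp n → V) :
    bumpSum P χ G y = ∑ v ∈ S, χ (y - v) • G v := by
  refine finsum_mem_eq_sum_of_inter_support_eq _ (Set.ext fun v => ?_)
  simp only [Set.mem_inter_iff, Function.mem_support, Finset.mem_coe]
  constructor
  · rintro ⟨hv, h⟩
    refine ⟨hS' v hv ?_, h⟩
    by_contra! hd
    rw [dist_comm, dist_eq_norm] at hd
    exact h (by rw [hχ.zero _ hd, zero_smul])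
  · rintro ⟨hv, h⟩
    exact ⟨hS v hv, h⟩

variable (hP : DeloneFLC P)
include hP

theorem bumpSum_sub (F G : EucSp n → V) (y : EucSp n) :
    bumpSum P χ (fun v => F v - G v) y = bumpSum P χ F y - bumpSum P χ G y := by
  obtain ⟨S, hS, hS'⟩ := hP.exists_finset r y 1
  have hS'' := hS' y (mem_ball_self one_pos)
  simp only [hχ.bumpSum_eq hS hS'', ← Finset.sum_sub_distrib, smul_sub]

theorem bumpSum_const (c : V) (y : EucSp n) :
    bumpSum P χ (fun _ => c) y = bumpSum P χ (fun _ => (1 : ℝ)) y • c := by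
  obtain ⟨S, hS, hS'⟩ := hP.exists_finset r y 1
  have hS'' := hS' y (mem_ball_self one_pos)
  simp only [hχ.bumpSum_eq hS hS'', Finset.sum_smul, smul_eq_mul, mul_one]

theorem one_le_bumpSum (hd : ∀ y, ∃ v ∈ P, dist v y < ρ) (y : EucSp n) :
    1 ≤ bumpSum P χ (fun _ => (1 : ℝ)) y := by
  obtain ⟨S, hS, hS'⟩ := hP.exists_finset r y 1
  have hS'' := hS' y (mem_ball_self one_pos)
  rw [hχ.bumpSum_eq hS hS'']
  obtain ⟨v, hv, hvy⟩ := hd y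
  have h1 : χ (y - v) = 1 := hχ.one _ (by rwa [← dist_eq_norm, dist_comm])
  have hvS : v ∈ S := by
    refine hS'' v hv ?_
    by_contra! hd
    rw [dist_comm, dist_eq_norm] at hd
    exact one_ne_zero (h1.symm.trans (hχ.zero _ hd))
  have := Finset.single_le_sum (f := fun v => χ (y - v) • (1 : ℝ))
    (fun w _ => by simpa using hχ.nonneg _) hvS
  simpa [h1] using this

/-- The weighted sums are local: they only depend on the patch and on the values at its points. -/
theorem bumpSum_congr {y y' : EucSp n} (hy : patch r (shiftSet P y) = patch r (shiftSet P y'))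
    {G G' : EucSp n → V} (h : ∀ q, ‖q‖ < r → y + q ∈ P → G (y + q) = G' (y' + q)) :
    bumpSum P χ G y = bumpSum P χ G' y' := by
  set S := (hP.finite_inter_ball y r).toFinset with hS
  have hmem : ∀ v, v ∈ S ↔ v ∈ P ∧ dist v y < r := fun v => Set.Finite.mem_toFinset _
  have hmem' : ∀ v ∈ P, dist v y < r → v - y + y' ∈ P := by
    intro v hv hd
    rw [add_comm]
    exact mem_of_patch_eq hy (by rwa [← dist_eq_norm]) (by rwa [add_sub_cancel])
  rw [hχ.bumpSum_eq (S := S) (fun v hv => ((hmem v).1 hv).1) (fun v hv hd => (hmem v).2 ⟨hv, hd⟩),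
    hχ.bumpSum_eq (S := S.image fun v => v - y + y')]
  · rw [Finset.sum_image fun v _ w _ h => by simpa using h]
    refine Finset.sum_congr rfl fun v hv => ?_
    obtain ⟨hv, hd⟩ := (hmem v).1 hv
    have := h (v - y) (by rwa [← dist_eq_norm]) (by rwa [add_sub_cancel])
    rw [add_sub_cancel, add_comm] at this
    rw [this, show y' - (v - y + y') = y - v by abel]
  · intro v hv
    obtain ⟨w, hw, rfl⟩ := Finset.mem_image.1 hv
    obtain ⟨hw, hd⟩ := (hmem w).1 hw
    exact hmem' w hw hd
  · intro v hv hd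
    rw [dist_eq_norm] at hd
    refine Finset.mem_image.2 ⟨v - y' + y, (hmem _).2 ⟨?_, ?_⟩, by abel⟩
    · rw [add_comm]
      exact mem_of_patch_eq hy.symm hd (by rwa [add_sub_cancel])
    · rwa [dist_eq_norm, add_sub_cancel_right]

theorem contDiff_bumpSum (G : EucSp n → V) : ContDiff ℝ ∞ (bumpSum P χ G) := by
  rw [contDiff_iff_contDiffAt]
  intro y
  obtain ⟨S, hS, hS'⟩ := hP.exists_finset r y 1
  have : ContDiff ℝ ∞ fun y => ∑ v ∈ S, χ (y - v) • G v :=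
    ContDiff.sum fun v _ => (hχ.smooth.comp (contDiff_id.sub contDiff_const)).smul contDiff_const
  refine this.contDiffAt.congr_of_eventuallyEq ?_
  filter_upwards [ball_mem_nhds y one_pos] with y' hy'
  exact hχ.bumpSum_eq hS (hS' y' hy') G

/-- The derivatives of the weighted sums of bounded functions are bounded. -/
theorem exists_bound_bumpSum (hd : ∀ y, ∃ v ∈ P, dist v y < ρ) (j : ℕ) :
    ∃ C : ℝ, 0 ≤ C ∧ ∀ (G : EucSp n → V) (ε : ℝ), (∀ v ∈ P, ‖G v‖ ≤ ε) →
      ∀ x, ‖iteratedFDeriv ℝ j (bumpSum P χ G) x‖ ≤ C * ε := by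
  have hj : (j : WithTop ℕ∞) ≤ ∞ := by exact_mod_cast le_top
  obtain ⟨B, hB⟩ := (hχ.compact.iteratedFDeriv (𝕜 := ℝ) j).exists_bound_of_continuous
    (hχ.smooth.continuous_iteratedFDeriv hj)
  have hB0 : 0 ≤ B := (norm_nonneg _).trans (hB 0)
  set D := (hP.diffs (r + 1 + ρ)).toFinset with hD
  refine ⟨D.card * B, by positivity, fun G ε hG x => ?_⟩
  have hε : 0 ≤ ε := by
    obtain ⟨v, hv, -⟩ := hd x
    exact (norm_nonneg _).trans (hG v hv)
  -- near `x`, at most `D.card` points of `P` contribute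
  set S := (hP.finite_inter_ball x (r + 1)).toFinset with hS
  have hmem : ∀ v, v ∈ S ↔ v ∈ P ∧ dist v x < r + 1 := fun v => Set.Finite.mem_toFinset _
  have hcard : S.card ≤ D.card := by
    obtain ⟨w, hw, hwx⟩ := hd x
    refine Finset.card_le_card_of_injOn (fun v => v - w) (fun v hv => ?_)
      fun v _ v' _ h => by simpa using h
    obtain ⟨hv, hvx⟩ := (hmem v).1 hv
    refine (Set.Finite.mem_toFinset _).2 ⟨?_, w, hw, by simpa using hv⟩
    rw [← dist_eq_norm]
    have := dist_triangle_right v w x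
    linarith
  have hloc : bumpSum P χ G =ᶠ[𝓝 x] fun y => ∑ v ∈ S, χ (y - v) • G v := by
    filter_upwards [ball_mem_nhds x one_pos] with y hy
    refine hχ.bumpSum_eq (fun v hv => ((hmem v).1 hv).1) (fun v hv h => (hmem v).2 ⟨hv, ?_⟩) G
    have := dist_triangle v y x
    rw [mem_ball] at hy
    linarith
  have hsm : ∀ v, ContDiff ℝ j fun y => χ (y - v) := fun v =>
    ((hχ.smooth.comp (contDiff_id.sub contDiff_const)).of_le hj)
  rw [(hloc.iteratedFDeriv ℝ j).self_of_nhds,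
    iteratedFDeriv_sum (f := fun v y => χ (y - v) • G v)
      fun v _ => (hsm v).smul contDiff_const, Finset.sum_apply]
  calc ‖∑ v ∈ S, iteratedFDeriv ℝ j (fun y => χ (y - v) • G v) x‖
      ≤ ∑ v ∈ S, ‖iteratedFDeriv ℝ j (fun y => χ (y - v) • G v) x‖ := norm_sum_le _ _
    _ ≤ ∑ v ∈ S, B * ε := by
        refine Finset.sum_le_sum fun v hv => ?_
        rw [iteratedFDeriv_smul_const_apply (hsm v).contDiffAt]
        refine (ContinuousLinearMap.norm_compContinuousMultilinearMap_le _ _).trans ?_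
        rw [iteratedFDeriv_comp_sub, mul_comm]
        refine mul_le_mul (hB _) ?_ (norm_nonneg _) hB0
        refine (ContinuousLinearMap.opNorm_le_bound _ (norm_nonneg (G v)) fun c => ?_).trans
          (hG v ((hmem v).1 hv).1)
        simp [norm_smul, mul_comm]
    _ = S.card * B * ε := by rw [Finset.sum_const, nsmul_eq_mul, mul_assoc]
    _ ≤ D.card * B * ε := by gcongr

end IsBump

/-- An averaging operator for functions on `P`: it is affine, local, has smooth values, and is
continuous for the uniform norms of all derivatives. -/
theorem DeloneFLC.exists_smoothing (hP : DeloneFLC P) :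
    ∃ (r : ℝ) (𝒮 : (EucSp n → EucSp n) → EucSp n → EucSp n), 0 < r ∧
      (∀ y, ∃ v ∈ P, dist v y < r) ∧
      (∀ F, ContDiff ℝ ∞ (𝒮 F)) ∧
      (∀ F F' y, 𝒮 F y - 𝒮 F' y = 𝒮 (fun v => F v - F' v) y) ∧
      (∀ F F' y y' c c', patch r (shiftSet P y) = patch r (shiftSet P y') →
        (∀ q, ‖q‖ < r → y + q ∈ P → F (y + q) - c = F' (y' + q) - c') →
          𝒮 F y - c = 𝒮 F' y' - c') ∧
      ∀ l : ℕ, ∃ C : ℝ, 0 ≤ C ∧ ∀ (G : EucSp n → EucSp n) (ε : ℝ), (∀ v ∈ P, ‖G v‖ ≤ ε) →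
        ∀ j ≤ l, ∀ x, ‖iteratedFDeriv ℝ j (𝒮 G) x‖ ≤ C * ε := by
  obtain ⟨ρ, hρ, hd⟩ := hP.dense
  obtain ⟨χ, hχ⟩ := exists_isBump n hρ
  -- dividing by the total weight `W` makes constants invariant
  set W := bumpSum P χ (fun _ => (1 : ℝ)) with hW
  have hWsm : ContDiff ℝ ∞ W := hχ.contDiff_bumpSum hP _
  have hW1 : ∀ y, 1 ≤ W y := hχ.one_le_bumpSum hP hd
  have hW0 : ∀ y, W y ≠ 0 := fun y => by linarith [hW1 y]
  have hWeq : EquivariantRange P (ρ + 1) W := fun y y' h =>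
    hχ.bumpSum_congr hP h fun _ _ _ => rfl
  have hVsm : ContDiff ℝ ∞ fun y => (W y)⁻¹ := hWsm.inv hW0
  have hsub : ∀ (F : EucSp n → EucSp n) c y,
      (W y)⁻¹ • bumpSum P χ F y - c = (W y)⁻¹ • bumpSum P χ (fun v => F v - c) y := by
    intro F c y
    rw [hχ.bumpSum_sub hP, hχ.bumpSum_const hP, smul_sub, inv_smul_smul₀ (hW0 y)]
  refine ⟨ρ + 1, fun F y => (W y)⁻¹ • bumpSum P χ F y, by linarith, fun y => ?_,
    fun F => hVsm.smul (hχ.contDiff_bumpSum hP F), fun F F' y => ?_,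
    fun F F' y y' c c' hy h => ?_, fun l => ?_⟩
  · obtain ⟨v, hv, h⟩ := hd y
    exact ⟨v, hv, by linarith⟩
  · beta_reduce
    rw [hχ.bumpSum_sub hP, smul_sub]
  · beta_reduce
    rw [hsub, hsub, hWeq y y' hy]
    congr 1
    exact hχ.bumpSum_congr hP hy h
  · have hb : ∀ i : ℕ, ∃ C, ∀ x, ‖iteratedFDeriv ℝ i (fun y => (W y)⁻¹) x‖ ≤ C := fun i => by
      refine hP.exists_bound (R := ρ + 1 + 1) (EquivariantRange.iteratedFDeriv ?_ i)
        (hVsm.continuous_iteratedFDeriv (by exact_mod_cast le_top))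
      intro y y' h
      simp only [hWeq y y' h]
    choose B hB using hb
    have hB0 : ∀ i, 0 ≤ B i := fun i => (norm_nonneg _).trans (hB i 0)
    choose C hC0 hC using hχ.exists_bound_bumpSum (V := EucSp n) hP hd
    let K : ℕ → ℝ := fun j => ∑ i ∈ Finset.range (j + 1), (j.choose i) * B i * C (j - i)
    have hK0 : ∀ j, 0 ≤ K j := fun j => Finset.sum_nonneg fun i _ =>
      mul_nonneg (mul_nonneg (Nat.cast_nonneg _) (hB0 i)) (hC0 _)
    refine ⟨∑ j ∈ Finset.range (l + 1), K j, Finset.sum_nonneg fun j _ => hK0 j,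
      fun G ε hG j hj x => ?_⟩
    have hε : 0 ≤ ε := by
      obtain ⟨v, hv, -⟩ := hd x
      exact (norm_nonneg _).trans (hG v hv)
    calc _ ≤ _ := norm_iteratedFDeriv_smul_le hVsm (hχ.contDiff_bumpSum hP G) x
            (n := j) (by exact_mod_cast le_top)
      _ ≤ ∑ i ∈ Finset.range (j + 1), (j.choose i) * B i * (C (j - i) * ε) := by
          refine Finset.sum_le_sum fun i _ => ?_
          exact mul_le_mul (mul_le_mul_of_nonneg_left (hB i x) (Nat.cast_nonneg _))
            (hC (j - i) G ε hG x) (norm_nonneg _) (mul_nonneg (Nat.cast_nonneg _) (hB0 i))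
      _ = K j * ε := by
          rw [Finset.sum_mul]
          exact Finset.sum_congr rfl fun i _ => by ring
      _ ≤ _ := by
          refine mul_le_mul_of_nonneg_right ?_ hε
          exact Finset.single_le_sum (f := K) (fun j _ => hK0 j) (Finset.mem_range.2 (by omega))

/-- The increments `F (v + s) - F v` between points of `P` only depend on the patch of radius
`R + ‖s‖` around `v`. -/
def VertexIncrementRange (P : Set (EucSp n)) (R : ℝ) (F : EucSp n → EucSp n) : Prop :=
  ∀ v ∈ P, ∀ v' ∈ P, ∀ s, v + s ∈ P →
    patch (R + ‖s‖) (shiftSet P v) = patch (R + ‖s‖) (shiftSet P v') →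
      F (v + s) - F v = F (v' + s) - F v'

theorem IncrementRange.vertex {R : ℝ} {F : EucSp n → EucSp n} (hF : IncrementRange P R F) :
    VertexIncrementRange P R F := fun v _ v' _ s _ h => hF v v' s h

theorem VertexIncrementRange.mono {R R' : ℝ} (h : R ≤ R') {F : EucSp n → EucSp n}
    (hF : VertexIncrementRange P R F) : VertexIncrementRange P R' F :=
  fun v hv v' hv' s hs hp => hF v hv v' hv' s hs (patch_mono (by linarith) hp)

/-- A function on `P` with equivariant increments can be smoothed within its class, and the
smoothing is weakly equivariant as soon as the function is a uniform limit of strongly equivariant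
ones. -/
theorem VertexIncrementRange.exists_smooth (hP : DeloneFLC P) {R : ℝ} {F : EucSp n → EucSp n}
    (hF : VertexIncrementRange P R F) :
    ∃ (φ : EucSp n → EucSp n) (R' : ℝ), ContDiff ℝ ∞ φ ∧ IncrementRange P R' φ ∧
      (∀ v ∈ P, ∀ v' ∈ P, patch R' (shiftSet P v) = patch R' (shiftSet P v') →
        φ v - F v = φ v' - F v') ∧
      ((∀ ε : ℝ, 0 < ε → ∃ F' : EucSp n → EucSp n, StronglyEquivariant P F' ∧
        ∀ v ∈ P, ‖F v - F' v‖ ≤ ε) → WeaklyEquivariant P φ) := by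
  wlog hR : 0 ≤ R generalizing R
  · exact this (hF.mono (not_le.1 hR).le) le_rfl
  obtain ⟨r, 𝒮, hr, hd, hsm, hsub, hloc, hbd⟩ := hP.exists_smoothing
  -- the averages near `y`, normalised at a vertex near `y`, are equivariant
  have key : ∀ y y' s s₀, ‖s₀‖ < r → y + s₀ ∈ P →
      patch (R + 3 * r + ‖s‖) (shiftSet P y) = patch (R + 3 * r + ‖s‖) (shiftSet P y') →
      𝒮 F (y + s) - F (y + s₀) = 𝒮 F (y' + s) - F (y' + s₀) := by
    intro y y' s s₀ hs₀ hv hy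
    have hns := norm_nonneg s
    refine hloc F F _ _ _ _ (patch_shiftSet_add hy (by linarith)) fun q hq hqP => ?_
    have hn : ‖s + q - s₀‖ ≤ ‖s‖ + ‖q‖ + ‖s₀‖ :=
      (norm_sub_le _ _).trans (by linarith [norm_add_le s q])
    have := hF (y + s₀) hv (y' + s₀) (mem_of_patch_eq hy (by linarith) hv) (s + q - s₀)
      (by rwa [add_assoc, add_sub_cancel, ← add_assoc])
      (patch_shiftSet_add hy (by linarith))
    rwa [add_assoc, add_assoc, add_sub_cancel, ← add_assoc, ← add_assoc] at this
  refine ⟨𝒮 F, R + 3 * r, hsm F, fun y y' s hy => ?_, fun v hv v' _ h => ?_, fun happ => ?_⟩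
  · obtain ⟨v, hv, hvy⟩ := hd y
    rw [dist_eq_norm] at hvy
    have hv : y + (v - y) ∈ P := by rwa [add_sub_cancel]
    have h1 := key y y' s (v - y) hvy hv hy
    have h2 := key y y' 0 (v - y) hvy hv (patch_mono (by simp) hy)
    rw [add_zero, add_zero] at h2
    have := congrArg₂ (· - ·) h1 h2
    simpa using this
  · have := key v v' 0 0 (by simpa using hr) (by simpa using hv) (by simpa using h)
    simpa using this
  · refine ⟨hsm F, fun l ε hε => ?_⟩
    obtain ⟨C, hC0, hC⟩ := hbd l
    obtain ⟨F', ⟨R', hR'⟩, hF'⟩ := happ (ε / (C + 1)) (by positivity)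
    refine ⟨𝒮 F', hsm F', ⟨max R' 0 + r, fun y y' hy => ?_⟩, fun j hj x => ?_⟩
    · have := hloc F' F' y y' 0 0 (patch_mono (by simp) hy) fun q hq _ => by
        rw [hR' _ _ (patch_shiftSet_add hy (by linarith [le_max_left R' 0]))]
      simpa using this
    · simp only [hsub]
      calc _ ≤ C * (ε / (C + 1)) := hC _ _ hF' j hj x
        _ < (C + 1) * (ε / (C + 1)) := by
          refine mul_lt_mul_of_pos_right (by linarith) (by positivity)
        _ = ε := by field_simp

end Smoothing

/-! ### Čech classes of functions with equivariant increments -/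

section CechClasses

open Metric Filter Topology

variable {n : ℕ} {P : Set (EucSp n)}

/-- A linear relation between two modules that is total on both sides and matches two submodules
induces an isomorphism of the quotients: both are the quotient of the relation by the same kernel. -/
theorem Submodule.exists_quotient_equiv {M C : Type*} [AddCommGroup M] [AddCommGroup C]
    [Module ℝ M] [Module ℝ C] (E : Submodule ℝ M) (B : Submodule ℝ C) (G : Submodule ℝ (M × C))
    (h₁ : ∀ a, ∃ c, (a, c) ∈ G) (h₂ : ∀ c, ∃ a, (a, c) ∈ G)
    (h : ∀ a c, (a, c) ∈ G → (a ∈ E ↔ c ∈ B)) :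
    ∃ Θ : (M ⧸ E) ≃ₗ[ℝ] (C ⧸ B), ∀ a c, (a, c) ∈ G →
      Θ (Submodule.Quotient.mk a) = Submodule.Quotient.mk c := by
  let f₁ : G →ₗ[ℝ] M ⧸ E := E.mkQ ∘ₗ LinearMap.fst ℝ M C ∘ₗ G.subtype
  let f₂ : G →ₗ[ℝ] C ⧸ B := B.mkQ ∘ₗ LinearMap.snd ℝ M C ∘ₗ G.subtype
  have hs₁ : Function.Surjective f₁ := fun a => by
    obtain ⟨a, rfl⟩ := Submodule.Quotient.mk_surjective _ a
    obtain ⟨c, hc⟩ := h₁ a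
    exact ⟨⟨(a, c), hc⟩, rfl⟩
  have hs₂ : Function.Surjective f₂ := fun c => by
    obtain ⟨c, rfl⟩ := Submodule.Quotient.mk_surjective _ c
    obtain ⟨a, ha⟩ := h₂ c
    exact ⟨⟨(a, c), ha⟩, rfl⟩
  have hker : LinearMap.ker f₁ = LinearMap.ker f₂ := by
    ext p
    have e₁ : p ∈ LinearMap.ker f₁ ↔ p.1.1 ∈ E := Submodule.Quotient.mk_eq_zero _
    have e₂ : p ∈ LinearMap.ker f₂ ↔ p.1.2 ∈ B := Submodule.Quotient.mk_eq_zero _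
    rw [e₁, e₂]
    exact h _ _ p.2
  refine ⟨(f₁.quotKerEquivOfSurjective hs₁).symm ≪≫ₗ Submodule.quotEquivOfEq _ _ hker ≪≫ₗ
    f₂.quotKerEquivOfSurjective hs₂, fun a c hac => ?_⟩
  have : (f₁.quotKerEquivOfSurjective hs₁).symm (Submodule.Quotient.mk a)
      = Submodule.Quotient.mk ⟨(a, c), hac⟩ :=
    LinearMap.quotKerEquivOfSurjective_symm_apply f₁ hs₁ ⟨(a, c), hac⟩
  simp only [LinearEquiv.trans_apply, this]
  rfl

namespace DeloneFLC

variable (hP : DeloneFLC P)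

/-- The Čech cochain `g` is a cocycle of the class of `F`: on each member `U x` of a cover of the
hull, `F` is the sum of a function that depends on a patch of fixed radius and of a locally constant
function `s x`, and `g` records the differences of the `s x`. -/
def CechRel (F : EucSp n → EucSp n) (g : Hull P → Hull P → EucSp n) : Prop :=
  ∃ (U : Hull P → Set (Hull P)) (s : Hull P → EucSp n → EucSp n) (ρ δ : Hull P → ℝ),
    IsPointedCover U ∧ (∀ x, 0 < δ x) ∧
    (∀ x y y', hP.orb y ∈ U x → hP.orb y' ∈ U x →
      patch (ρ x) (shiftSet P y) = patch (ρ x) (shiftSet P y') → F y - s x y = F y' - s x y') ∧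
    (∀ x y y', hP.orb y ∈ U x → hP.orb y' ∈ U x → dist y y' < δ x → s x y = s x y') ∧
    ∀ x x' y, hP.orb y ∈ U x → hP.orb y ∈ U x' → g x x' = s x' y - s x y

/-- The same with markers: `g x x'` is the increment of `F` between points of `P` that correspond
to the markers of `x` and `x'`. -/
def MarkerRel (F : EucSp n → EucSp n) (g : Hull P → Hull P → EucSp n) : Prop :=
  ∃ (U : Hull P → Set (Hull P)) (m : Hull P → EucSp n) (δ : Hull P → ℝ),
    IsPointedCover U ∧ (∀ x, m x ∈ x.1 ∧ 0 < δ x) ∧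
    ∀ (x x' : Hull P) (y v v' : EucSp n), hP.orb y ∈ U x → hP.orb y ∈ U x' → v ∈ P → v' ∈ P →
      dist (v - y) (m x) < δ x → dist (v' - y) (m x') < δ x' → g x x' = F v' - F v

variable {hP}

theorem CechRel.add {F F' : EucSp n → EucSp n} {g g' : Hull P → Hull P → EucSp n}
    (h : hP.CechRel F g) (h' : hP.CechRel F' g') : hP.CechRel (F + F') (g + g') := by
  obtain ⟨U, s, ρ, δ, hU, hδ, h1, h2, h3⟩ := h
  obtain ⟨U', s', ρ', δ', hU', hδ', h1', h2', h3'⟩ := h'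
  refine ⟨_, s + s', fun x => max (ρ x) (ρ' x), fun x => min (δ x) (δ' x), hU.inter hU',
    fun x => lt_min (hδ x) (hδ' x), fun x y y' hy hy' hp => ?_, fun x y y' hy hy' hd => ?_,
    fun x x' y hy hy' => ?_⟩
  · have e := h1 x y y' hy.1 hy'.1 (patch_mono (le_max_left _ _) hp)
    have e' := h1' x y y' hy.2 hy'.2 (patch_mono (le_max_right _ _) hp)
    simp only [Pi.add_apply]
    rw [add_sub_add_comm, e, e', add_sub_add_comm]
  · simp only [Pi.add_apply]
    rw [h2 x y y' hy.1 hy'.1 (hd.trans_le (min_le_left _ _)),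
      h2' x y y' hy.2 hy'.2 (hd.trans_le (min_le_right _ _))]
  · simp only [Pi.add_apply]
    rw [h3 x x' y hy.1 hy'.1, h3' x x' y hy.2 hy'.2, add_sub_add_comm]

theorem CechRel.smul {F : EucSp n → EucSp n} {g : Hull P → Hull P → EucSp n}
    (h : hP.CechRel F g) (c : ℝ) : hP.CechRel (c • F) (c • g) := by
  obtain ⟨U, s, ρ, δ, hU, hδ, h1, h2, h3⟩ := h
  refine ⟨U, c • s, ρ, δ, hU, hδ, fun x y y' hy hy' hp => ?_, fun x y y' hy hy' hd => ?_,
    fun x x' y hy hy' => ?_⟩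
  · simp only [Pi.smul_apply]
    rw [← smul_sub, h1 x y y' hy hy' hp, smul_sub]
  · simp only [Pi.smul_apply]
    rw [h2 x y y' hy hy' hd]
  · simp only [Pi.smul_apply]
    rw [h3 x x' y hy hy', smul_sub]

theorem cechRel_zero {F : EucSp n → EucSp n} (hF : StronglyEquivariant P F) :
    hP.CechRel F 0 := by
  obtain ⟨R, hR⟩ := hF
  exact ⟨fun _ => Set.univ, 0, fun _ => R, fun _ => 1, fun _ => ⟨isOpen_univ, trivial⟩,
    fun _ => one_pos, fun x y y' _ _ h => by simp [hR y y' h], fun _ _ _ _ _ _ => rfl,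
    fun _ _ _ _ _ => by simp⟩

/-- Cocycles of the class of a strongly equivariant function are coboundaries. -/
theorem CechRel.mem_coboundaries (hn : 0 < n) {F : EucSp n → EucSp n}
    {g : Hull P → Hull P → EucSp n} (h : hP.CechRel F g) (hF : StronglyEquivariant P F) :
    g ∈ cechCoboundaries (Hull P) (EucSp n) := by
  obtain ⟨U, s, ρ, δ, hU, hδ, h1, h2, h3⟩ := h
  obtain ⟨RF, hRF⟩ := hF
  choose R d hd hRd using fun x => exists_hullNhd_subset hn (hU x).1 (hU x).2
  set R' : Hull P → ℝ := fun x => max (R x) (max (ρ x) RF) with hR'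
  set U' : Hull P → Set (Hull P) := fun x => hullNhd x (R' x) (min (d x) (δ x)) with hU'
  have hU'c : IsPointedCover U' := fun x =>
    ⟨hP.isOpen_hullNhd _ _ _, mem_hullNhd_self x _ (lt_min (hd x) (hδ x))⟩
  have hsub : ∀ x, U' x ⊆ U x := fun x =>
    (hullNhd_mono x (le_max_left _ _) (min_le_left _ _)).trans (hRd x)
  choose Y hY using fun x => hP.exists_orb_mem (hU'c x).1 ⟨x, (hU'c x).2⟩
  -- on the small neighbourhood `U' x` the locally constant function `s x` is constant
  have hconst : ∀ x y y', hP.orb y ∈ U' x → hP.orb y' ∈ U' x → s x y = s x y' := by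
    intro x y y' hy hy'
    obtain ⟨t, ht, hp⟩ := hy
    obtain ⟨t', ht', hp'⟩ := hy'
    rw [orb_val, shiftSet_shiftSet] at hp hp'
    have hpp := hp.symm.trans hp'
    have hmem : ∀ z, patch (R' x) x.1 = patch (R' x) (shiftSet P z) → hP.orb z ∈ U x := fun z hz =>
      hRd x ⟨0, by simpa using hd x, by
        rw [shiftSet_zero]; exact patch_mono (le_max_left _ _) hz⟩
    have e1 := h1 x _ _ (hmem _ hp) (hmem _ hp')
      (patch_mono ((le_max_left _ _).trans (le_max_right _ _)) hpp)
    rw [hRF _ _ (patch_mono ((le_max_right _ _).trans (le_max_right _ _)) hpp)] at e1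
    have e2 := h2 x y (y + t) (hsub x ⟨t, ht, by rwa [orb_val, shiftSet_shiftSet]⟩) (hmem _ hp)
      (by simpa using ht.trans_le (min_le_right _ _))
    have e3 := h2 x y' (y' + t') (hsub x ⟨t', ht', by rwa [orb_val, shiftSet_shiftSet]⟩)
      (hmem _ hp') (by simpa using ht'.trans_le (min_le_right _ _))
    rw [e2, e3]
    exact sub_right_injective e1
  refine ⟨U', hU'c, fun x => s x (Y x), fun x x' hne => ?_⟩
  obtain ⟨y, hy, hy'⟩ := hP.exists_orb_mem ((hU'c x).1.inter (hU'c x').1) hne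
  rw [h3 x x' y (hsub x hy) (hsub x' hy'), hconst x y _ hy (hY x), hconst x' y _ hy' (hY x')]

/-- A function whose Čech class is trivial is strongly equivariant. -/
theorem CechRel.stronglyEquivariant (hn : 0 < n) {F : EucSp n → EucSp n}
    {g : Hull P → Hull P → EucSp n} (h : hP.CechRel F g)
    (hg : g ∈ cechCoboundaries (Hull P) (EucSp n)) : StronglyEquivariant P F := by
  obtain ⟨U, s, ρ, δ, hU, hδ, h1, h2, h3⟩ := h
  obtain ⟨V, hV, b, hb⟩ := hg
  obtain ⟨R, d, X, hd, hX, hXU⟩ := hP.exists_lebesgue hn (hU.inter hV) ρ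
  have hself : ∀ y, hP.orb y ∈ U (X y) ∩ V (X y) := fun y => (hXU y).2 y (by simpa using hd)
  -- the functions `s x - b x` fit together to a global locally constant function
  have hloc : IsLocallyConstant fun y => s (X y) y - b (X y) := by
    rw [IsLocallyConstant.iff_exists_open]
    intro y
    refine ⟨ball y (min d (δ (X y))), isOpen_ball, mem_ball_self (lt_min hd (hδ _)),
      fun y' hy' => ?_⟩
    rw [mem_ball, dist_comm] at hy'
    have hy1 := (hXU y).2 y' (hy'.trans_le (min_le_left _ _))
    have e1 := h2 (X y) y y' (hself y).1 hy1.1 (hy'.trans_le (min_le_right _ _))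
    have e2 := h3 (X y) (X y') y' hy1.1 (hself y').1
    rw [hb _ _ ⟨_, hy1.2, (hself y').2⟩] at e2
    rw [e1, sub_eq_sub_iff_sub_eq_sub]
    exact e2.symm
  refine ⟨R, fun y y' hy => ?_⟩
  have e1 := h1 (X y) y y' (hself y).1 (by rw [hX y y' hy]; exact (hself y').1)
    (patch_mono (hXU y).1 hy)
  have e2 := hloc.apply_eq_of_preconnectedSpace y y'
  simp only [← hX y y' hy, sub_left_inj] at e2
  rw [e2] at e1
  exact sub_left_injective e1

/-- In terms of markers, the Čech class of a function with equivariant increments is the pull-back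
of a cellular class. -/
theorem MarkerRel.cechRel {R : ℝ} {F : EucSp n → EucSp n} {g : Hull P → Hull P → EucSp n}
    (h : hP.MarkerRel F g) (hF : IncrementRange P R F) : hP.CechRel F g := by
  obtain ⟨U, m, δ, hU, hm, h⟩ := h
  obtain ⟨σ, hσ, hsep⟩ := hP.exists_separation
  -- at distances below `σ / 4`, at most one point of `P` corresponds to a marker
  set d : Hull P → ℝ := fun x => min (δ x) (σ / 4) with hd
  have hd0 : ∀ x, 0 < d x := fun x => lt_min (hm x).2 (by positivity)
  set U' : Hull P → Set (Hull P) := fun x => U x ∩ hullNhd x (‖m x‖ + 1) (d x) with hU'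
  have hU'c : IsPointedCover U' := hU.inter fun x =>
    ⟨hP.isOpen_hullNhd _ _ _, mem_hullNhd_self x _ (hd0 x)⟩
  have hex : ∀ x y, ∃ v, hP.orb y ∈ U' x → v ∈ P ∧ dist (v - y) (m x) < d x := by
    intro x y
    by_cases hy : hP.orb y ∈ U' x
    · obtain ⟨-, t, ht, hp⟩ := hy
      rw [orb_val, shiftSet_shiftSet] at hp
      refine ⟨m x + (y + t), fun _ => ⟨(patch_eq_iff.1 hp (m x) (by linarith)).1 (hm x).1, ?_⟩⟩
      rwa [dist_eq_norm, show m x + (y + t) - y - m x = t by abel]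
    · exact ⟨0, fun h => absurd h hy⟩
  choose v hv using hex
  have huniq : ∀ x y w, hP.orb y ∈ U' x → w ∈ P → dist (w - y) (m x) < 3 * (σ / 4) → w = v x y := by
    intro x y w hy hw hwd
    obtain ⟨h1, h2⟩ := hv x y hy
    refine hsep w hw _ h1 ?_
    have := dist_triangle_right (w - y) (v x y - y) (m x)
    rw [dist_sub_right] at this
    have := h2.trans_le (min_le_right _ _)
    linarith
  refine ⟨U', fun x y => F (v x y), fun x => max R 0 + ‖m x‖ + σ, fun x => σ / 4, hU'c,
    fun x => by positivity, fun x y y' hy hy' hp => ?_, fun x y y' hy hy' hyy => ?_,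
    fun x x' y hy hy' => ?_⟩
  · obtain ⟨h1, h2⟩ := hv x y hy
    have hn1 : ‖v x y - y‖ < ‖m x‖ + σ / 4 := by
      have h3 := norm_add_le (v x y - y - m x) (m x)
      have h4 := h2.trans_le (min_le_right _ _)
      rw [sub_add_cancel] at h3
      rw [dist_eq_norm] at h4
      linarith
    have hR := le_max_left R 0
    have hR0 := le_max_right R 0
    have hv' : y' + (v x y - y) = v x y' := by
      refine huniq x y' _ hy' (mem_of_patch_eq hp (by linarith) ?_) ?_
      · rw [add_sub_cancel]; exact h1
      · rw [add_sub_cancel_left]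
        have := h2.trans_le (min_le_right _ _)
        linarith
    have := hF y y' (v x y - y) (patch_mono (by linarith) hp)
    rw [hv', add_sub_cancel, ← neg_sub, ← neg_sub (F y')] at this
    exact neg_injective this
  · obtain ⟨h1, h2⟩ := hv x y hy
    refine congrArg F (huniq x y' _ hy' h1 ?_)
    have := dist_triangle (v x y - y') (v x y - y) (m x)
    rw [dist_sub_left, dist_comm y' y] at this
    have := h2.trans_le (min_le_right _ _)
    linarith
  · obtain ⟨h1, h2⟩ := hv x y hy
    obtain ⟨h1', h2'⟩ := hv x' y hy'
    exact h x x' y _ _ hy.1 hy'.1 h1 h1' (h2.trans_le (min_le_left _ _))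
      (h2'.trans_le (min_le_left _ _))

/-- Every function with equivariant increments has a Čech class. -/
theorem exists_markerRel (hP : DeloneFLC P) {R : ℝ} {F : EucSp n → EucSp n}
    (hF : IncrementRange P R F) :
    ∃ g ∈ cechCocycles (Hull P) (EucSp n), hP.MarkerRel F g := by
  obtain ⟨σ, hσ, hsep⟩ := hP.exists_separation
  obtain ⟨ρ, hρ, hd⟩ := hP.dense
  have hm : ∀ x : Hull P, ∃ m ∈ x.1, ‖m‖ < ρ := fun x => by
    obtain ⟨y, hy⟩ := hP.exists_patch_eq x ρ
    obtain ⟨v, hv, hvy⟩ := hd y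
    rw [dist_eq_norm] at hvy
    exact ⟨v - y, (patch_eq_iff.1 hy _ hvy).2 (by rwa [mem_shiftSet, sub_add_cancel]), hvy⟩
  choose m hm hmρ using hm
  set d := σ / 4 with hd'
  have hd0 : 0 < d := by positivity
  set R₁ := max R 0 + 3 * ρ + 2 * d with hR₁
  have hR := le_max_left R 0
  have hR0 := le_max_right R 0
  set U : Hull P → Set (Hull P) := fun x => hullNhd x R₁ d with hU
  have hUc : IsPointedCover U := fun x =>
    ⟨hP.isOpen_hullNhd _ _ _, mem_hullNhd_self x _ hd0⟩
  have hpos : ∀ x y, hP.orb y ∈ U x → ∃ t, ‖t‖ < d ∧ y + t + m x ∈ P ∧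
      patch R₁ x.1 = patch R₁ (shiftSet P (y + t)) ∧
      ∀ v ∈ P, dist (v - y) (m x) < d → v = y + t + m x := by
    rintro x y ⟨t, ht, hp⟩
    rw [orb_val, shiftSet_shiftSet] at hp
    have h1 : y + t + m x ∈ P := by
      have := (patch_eq_iff.1 hp (m x) (by linarith [hmρ x])).1 (hm x)
      rwa [mem_shiftSet, add_comm] at this
    refine ⟨t, ht, h1, hp, fun v hv hvd => hsep v hv _ h1 ?_⟩
    rw [dist_eq_norm] at hvd ⊢
    rw [show v - (y + t + m x) = v - y - m x - t by abel]
    have := norm_sub_le (v - y - m x) t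
    linarith
  -- the values that the cocycle has to take at a pair of indices; there is at most one
  let Val : Hull P → Hull P → EucSp n → Prop := fun x x' c => ∃ y v v', hP.orb y ∈ U x ∧
    hP.orb y ∈ U x' ∧ v ∈ P ∧ v' ∈ P ∧ dist (v - y) (m x) < d ∧ dist (v' - y) (m x') < d ∧
    c = F v' - F v
  have huniq : ∀ x x' c c', Val x x' c → Val x x' c' → c = c' := by
    rintro x x' _ _ ⟨y₁, v₁, w₁, hx₁, hx₁', hv₁, hw₁, hd₁, hd₁', rfl⟩
      ⟨y₂, v₂, w₂, hx₂, hx₂', hv₂, hw₂, hd₂, hd₂', rfl⟩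
    obtain ⟨t₁, ht₁, -, hp₁, h₁⟩ := hpos x y₁ hx₁
    obtain ⟨t₂, ht₂, -, hp₂, h₂⟩ := hpos x y₂ hx₂
    obtain ⟨t₁', ht₁', -, -, h₁'⟩ := hpos x' y₁ hx₁'
    obtain ⟨t₂', ht₂', -, -, h₂'⟩ := hpos x' y₂ hx₂'
    have hpp := hp₁.symm.trans hp₂
    have e₁ := h₁ v₁ hv₁ hd₁
    have e₂ := h₂ v₂ hv₂ hd₂
    have e₁' := h₁' w₁ hw₁ hd₁'
    have e₂' := h₂' w₂ hw₂ hd₂'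
    have hmx := hmρ x
    have hmx' := hmρ x'
    have hs : ‖w₁ - v₁‖ < 2 * ρ + 2 * d := by
      rw [e₁, e₁', show y₁ + t₁' + m x' - (y₁ + t₁ + m x) = (t₁' - t₁) + (m x' - m x) by abel]
      have i1 := norm_add_le (t₁' - t₁) (m x' - m x)
      have i2 := norm_sub_le t₁' t₁
      have i3 := norm_sub_le (m x') (m x)
      linarith
    have hms : ‖m x + (w₁ - v₁)‖ < R₁ := by
      have := norm_add_le (m x) (w₁ - v₁)
      linarith
    have hmem : v₂ + (w₁ - v₁) ∈ P := by
      rw [e₂, add_assoc]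
      refine mem_of_patch_eq hpp hms ?_
      rwa [← add_assoc, ← e₁, add_sub_cancel]
    have hw : v₂ + (w₁ - v₁) = w₂ := by
      refine hsep _ hmem _ hw₂ ?_
      rw [dist_eq_norm, e₂, e₁', e₁, e₂',
        show y₂ + t₂ + m x + (y₁ + t₁' + m x' - (y₁ + t₁ + m x)) - (y₂ + t₂' + m x')
          = (t₂ - t₁) + (t₁' - t₂') by abel]
      have i1 := norm_add_le (t₂ - t₁) (t₁' - t₂')
      have i2 := norm_sub_le t₂ t₁
      have i3 := norm_sub_le t₁' t₂'
      linarith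
    have := hF v₁ v₂ (w₁ - v₁) (by
      rw [e₂]
      nth_rw 2 [e₁]
      exact patch_shiftSet_add hpp (by linarith))
    rwa [hw, add_sub_cancel] at this
  let g : Hull P → Hull P → EucSp n := fun x x' => Classical.epsilon (Val x x')
  have hg : ∀ x x' c, Val x x' c → g x x' = c := fun x x' c hc =>
    huniq x x' _ _ (Classical.epsilon_spec ⟨c, hc⟩) hc
  refine ⟨g, ⟨U, hUc, fun x y z hne => ?_⟩, U, m, fun _ => d, hUc, fun x => ⟨hm x, hd0⟩,
    fun x x' y v v' hx hx' hv hv' hvd hvd' => hg _ _ _ ⟨y, v, v', hx, hx', hv, hv', hvd, hvd', rfl⟩⟩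
  obtain ⟨q, ⟨hx, hy⟩, hz⟩ :=
    hP.exists_orb_mem (((hUc x).1.inter (hUc y).1).inter (hUc z).1) hne
  have hmark : ∀ x, hP.orb q ∈ U x → ∃ v ∈ P, dist (v - q) (m x) < d := fun x hx => by
    obtain ⟨t, ht, h1, -, -⟩ := hpos x q hx
    exact ⟨_, h1, by rwa [dist_eq_norm, show q + t + m x - q - m x = t by abel]⟩
  obtain ⟨u, hu, hud⟩ := hmark x hx
  obtain ⟨v, hv, hvd⟩ := hmark y hy
  obtain ⟨w, hw, hwd⟩ := hmark z hz
  rw [hg x y _ ⟨q, u, v, hx, hy, hu, hv, hud, hvd, rfl⟩,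
    hg y z _ ⟨q, v, w, hy, hz, hv, hw, hvd, hwd, rfl⟩,
    hg x z _ ⟨q, u, w, hx, hz, hu, hw, hud, hwd, rfl⟩]
  abel

/-- Every Čech class is the class of a function with equivariant increments. -/
theorem exists_cechRel (hP : DeloneFLC P) (hn : 0 < n) {g : Hull P → Hull P → EucSp n}
    (hg : g ∈ cechCocycles (Hull P) (EucSp n)) :
    ∃ (F : EucSp n → EucSp n) (R : ℝ), IncrementRange P R F ∧ hP.CechRel F g := by
  obtain ⟨U, hU, hg⟩ := hg
  -- `g (X y) (X z)` is a cocycle for close points `y`, `z`, with equivariant values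
  obtain ⟨R, d, X, hd, hX, hXU⟩ := hP.exists_lebesgue hn hU 0
  have hself : ∀ y, hP.orb y ∈ U (X y) := fun y => (hXU y).2 y (by simpa using hd)
  obtain ⟨F, hF⟩ := exists_primitive hd (c := fun y z => g (X y) (X z)) fun x y z hxy hyz hxz =>
    hg _ _ _ ⟨hP.orb y, ⟨(hXU x).2 y hxy, hself y⟩, (hXU z).2 y (by
      rwa [dist_comm])⟩
  refine ⟨F, R, IncrementRange.of_short hd fun y y' s hs hy => ?_, U,
    fun x y => F y + g (X y) x, fun _ => R, fun _ => d, hU, fun _ => hd,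
    fun x y y' _ _ hy => ?_, fun x y y' hy hy' hyd => ?_, fun x x' y hy hy' => ?_⟩
  · rw [hF y (y + s) (by simpa using hs), hF y' (y' + s) (by simpa using hs),
      hX y y' (patch_mono (by linarith [norm_nonneg s]) hy),
      hX (y + s) (y' + s) (patch_shiftSet_add hy le_rfl)]
  · simp only [sub_add_cancel_left, hX y y' hy]
  · have e1 := hF y y' hyd
    have e2 := hg (X y) (X y') x ⟨hP.orb y', ⟨(hXU y).2 y' hyd, hself y'⟩, hy'⟩
    beta_reduce
    rw [← e2, ← e1]
    abel
  · have e2 := hg (X y) x x' ⟨hP.orb y, ⟨hself y, hy⟩, hy'⟩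
    beta_reduce
    rw [← e2]
    abel

variable (P) in
/-- The pairs of a closed strongly equivariant form and a Čech cocycle that have the same class. -/
def comparison (hP : DeloneFLC P) :
    Submodule ℝ (closedStrong P × cechCocycles (Hull P) (EucSp n)) where
  carrier := {p | ∃ φ : EucSp n → EucSp n, ContDiff ℝ ∞ φ ∧ (∀ x, fderiv ℝ φ x = p.1.1 x) ∧
    hP.CechRel φ p.2.1}
  zero_mem' := ⟨0, contDiff_const, fun x => by simp, cechRel_zero ⟨0, fun _ _ _ => rfl⟩⟩
  add_mem' := by
    rintro p q ⟨φ, h1, h2, h3⟩ ⟨ψ, k1, k2, k3⟩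
    refine ⟨φ + ψ, h1.add k1, fun x => ?_, h3.add k3⟩
    rw [fderiv_add (h1.differentiable (by simp)).differentiableAt
      (k1.differentiable (by simp)).differentiableAt, h2, k2]
    rfl
  smul_mem' := by
    rintro c p ⟨φ, h1, h2, h3⟩
    refine ⟨c • φ, h1.const_smul c, fun x => ?_, h3.smul c⟩
    rw [fderiv_const_smul (h1.differentiable (by simp)).differentiableAt, h2]
    rfl

/-- Strongly equivariant and Čech cohomology are isomorphic. -/
theorem exists_equiv (hP : DeloneFLC P) (hn : 0 < n) :
    ∃ Θ : StrongH1 P ≃ₗ[ℝ] CechH1 (Hull P) (EucSp n),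
      ∀ (α : closedStrong P) (φ : EucSp n → EucSp n) (g : cechCocycles (Hull P) (EucSp n)),
        ContDiff ℝ ∞ φ → (∀ x, fderiv ℝ φ x = α.1 x) → hP.CechRel φ g.1 →
          Θ (Submodule.Quotient.mk α) = Submodule.Quotient.mk g := by
  suffices h : (∀ α, ∃ g, (α, g) ∈ comparison P hP) ∧ (∀ g, ∃ α, (α, g) ∈ comparison P hP) ∧
      ∀ α g, (α, g) ∈ comparison P hP →
        (α ∈ (exactStrong P).submoduleOf (closedStrong P) ↔
          g ∈ (cechCoboundaries (Hull P) (EucSp n)).submoduleOf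
            (cechCocycles (Hull P) (EucSp n))) by
    obtain ⟨Θ, hΘ⟩ := Submodule.exists_quotient_equiv _ _ _ h.1 h.2.1 h.2.2
    exact ⟨Θ, fun α φ g hφ hα hg => hΘ α g ⟨φ, hφ, hα, hg⟩⟩
  refine ⟨fun α => ?_, fun g => ?_, ?_⟩
  · obtain ⟨φ, hφ, hφα⟩ := exists_potential α.2
    obtain ⟨R, hR⟩ := (fderiv_mem_closedStrong_iff hφ).1 (by rw [funext hφα]; exact α.2)
    obtain ⟨g, hg, hm⟩ := exists_markerRel hP hR
    exact ⟨⟨g, hg⟩, φ, hφ, hφα, hm.cechRel hR⟩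
  · obtain ⟨F, R, hR, hFg⟩ := exists_cechRel hP hn g.2
    obtain ⟨φ, R', hφ, hR', hv, -⟩ := hR.vertex.exists_smooth hP
    obtain ⟨ρ, hρ, hd⟩ := hP.dense
    have hs : StronglyEquivariant P (φ - F) := by
      refine ⟨max (max R' R) 0 + ρ, fun y y' hy => ?_⟩
      obtain ⟨v, hv', hvy⟩ := hd y
      rw [dist_eq_norm] at hvy
      have hv' : y + (v - y) ∈ P := by rwa [add_sub_cancel]
      have hR0 := le_max_left (max R' R) 0
      have hR1 := le_max_right (max R' R) 0
      have hR2 := le_max_left R' R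
      have e1 := hv _ hv' _ (mem_of_patch_eq hy (by linarith) hv')
        (patch_shiftSet_add hy (by linarith))
      have e2 := hR'.sub hR y y' (v - y) (patch_mono (by linarith) hy)
      simp only [Pi.sub_apply] at e2 ⊢
      rw [e1] at e2
      exact sub_right_injective e2
    refine ⟨⟨fderiv ℝ φ, (fderiv_mem_closedStrong_iff hφ).2 ⟨R', hR'⟩⟩, φ, hφ, fun _ => rfl, ?_⟩
    have := hFg.add (cechRel_zero (hP := hP) hs)
    rwa [add_sub_cancel, add_zero] at this
  · rintro α g ⟨φ, hφ, hφα, hrel⟩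
    change α.1 ∈ exactStrong P ↔ g.1 ∈ cechCoboundaries (Hull P) (EucSp n)
    rw [mem_exactStrong_iff hφ hφα]
    exact ⟨hrel.mem_coboundaries hn, hrel.stronglyEquivariant hn⟩

end DeloneFLC

end CechClasses

/-! ### Polyhedral cells -/

section Cells

open Metric Filter Topology

variable {n : ℕ}

namespace IsPolyhedralCell

variable {d : ℕ} {c : Set (EucSp n)} (hc : IsPolyhedralCell d c)
include hc

theorem isCompact : IsCompact c := by
  obtain ⟨F, rfl⟩ := hc.polyhedral
  exact F.finite_toSet.isCompact_biUnion fun s _ => s.finite_toSet.isCompact_convexHull ℝ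

theorem isClosed : IsClosed c := hc.isCompact.isClosed

theorem interior_eq : intrinsicInterior ℝ c = c \ intrinsicFrontier ℝ c := by
  rw [← intrinsicClosure_sdiff_intrinsicFrontier,
    IsClosed.intrinsicClosure (hc.isClosed.preimage continuous_subtype_val)]

theorem mem_interior_or_frontier {p : EucSp n} (hp : p ∈ c) :
    p ∈ intrinsicInterior ℝ c ∨ p ∈ intrinsicFrontier ℝ c := by
  rw [hc.interior_eq]
  by_cases h : p ∈ intrinsicFrontier ℝ c
  · exact Or.inr h
  · exact Or.inl ⟨hp, h⟩

theorem frontier_subset : intrinsicFrontier ℝ c ⊆ c := intrinsicFrontier_subset hc.isClosed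

/-- A parametrisation of the cell by the closed unit ball, under which the relative interior and
the relative boundary correspond to the open ball and the sphere. -/
theorem exists_parametrisation : ∃ f : closedBall (0 : EucSp d) 1 → EucSp n, Continuous f ∧
    f '' Set.univ = c ∧ f '' (Subtype.val ⁻¹' Metric.ball 0 1) = intrinsicInterior ℝ c ∧
    f '' (Subtype.val ⁻¹' sphere 0 1) = intrinsicFrontier ℝ c := by
  obtain ⟨h, hh⟩ := hc.ball
  refine ⟨fun z => h.symm z, continuous_subtype_val.comp h.symm.continuous, ?_, ?_, ?_⟩
  · ext p
    constructor
    · rintro ⟨z, -, rfl⟩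
      exact (h.symm z).2
    · exact fun hp => ⟨h ⟨p, hp⟩, trivial, by simp⟩
  · rw [hc.interior_eq]
    ext p
    constructor
    · rintro ⟨z, hz, rfl⟩
      refine ⟨(h.symm z).2, fun hf => ?_⟩
      rw [hh, h.apply_symm_apply] at hf
      rw [Set.mem_preimage, mem_ball] at hz
      rw [mem_sphere] at hf
      linarith
    · rintro ⟨hp, hf⟩
      refine ⟨h ⟨p, hp⟩, ?_, by simp⟩
      rw [hh ⟨p, hp⟩] at hf
      exact lt_of_le_of_ne (h ⟨p, hp⟩).2 hf
  · ext p
    constructor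
    · rintro ⟨z, hz, rfl⟩
      rw [hh, h.apply_symm_apply]
      exact hz
    · intro hf
      have hp := hc.frontier_subset hf
      exact ⟨h ⟨p, hp⟩, (hh ⟨p, hp⟩).1 hf, by simp⟩

theorem isPreconnected_interior : IsPreconnected (intrinsicInterior ℝ c) := by
  obtain ⟨f, hf, -, h, -⟩ := hc.exists_parametrisation
  rw [← h]
  refine IsPreconnected.image ?_ f hf.continuousOn
  rw [← IsInducing.subtypeVal.isPreconnected_image, Subtype.image_preimage_coe,
    Set.inter_eq_self_of_subset_right ball_subset_closedBall]
  exact (convex_ball _ _).isPreconnected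

theorem isPreconnected_frontier (hd : 2 ≤ d) : IsPreconnected (intrinsicFrontier ℝ c) := by
  obtain ⟨f, hf, -, -, h⟩ := hc.exists_parametrisation
  rw [← h]
  refine IsPreconnected.image ?_ f hf.continuousOn
  rw [← IsInducing.subtypeVal.isPreconnected_image, Subtype.image_preimage_coe,
    Set.inter_eq_self_of_subset_right sphere_subset_closedBall]
  refine isPreconnected_sphere ?_ _ _
  rw [← Module.finrank_eq_rank]
  simp only [finrank_euclideanSpace, Fintype.card_fin]
  exact_mod_cast hd

theorem subset_closure_interior : c ⊆ closure (intrinsicInterior ℝ c) := by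
  obtain ⟨f, hf, h, h', -⟩ := hc.exists_parametrisation
  rw [← h']
  nth_rw 1 [← h]
  refine Set.Subset.trans (Set.image_mono ?_) (image_closure_subset_closure_image hf)
  rw [IsInducing.subtypeVal.closure_eq_preimage_closure_image, Subtype.image_preimage_coe,
    Set.inter_eq_self_of_subset_right ball_subset_closedBall, closure_ball _ one_ne_zero]
  exact fun z _ => z.2

theorem closure_interior : closure (intrinsicInterior ℝ c) = c :=
  Set.Subset.antisymm (closure_minimal intrinsicInterior_subset hc.isClosed)
    hc.subset_closure_interior

theorem interior_nonempty : (intrinsicInterior ℝ c).Nonempty := by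
  obtain ⟨f, hf, -, h, -⟩ := hc.exists_parametrisation
  rw [← h]
  exact ⟨_, ⟨0, by simp⟩, by simp, rfl⟩

theorem nonempty : c.Nonempty := hc.interior_nonempty.mono intrinsicInterior_subset

theorem frontier_nonempty (hd : 0 < d) : (intrinsicFrontier ℝ c).Nonempty := by
  obtain ⟨f, hf, -, -, h⟩ := hc.exists_parametrisation
  have : Nonempty (Fin d) := ⟨⟨0, hd⟩⟩
  obtain ⟨z, hz⟩ := (NormedSpace.sphere_nonempty (x := (0 : EucSp d)) (r := 1)).2 zero_le_one
  rw [← h]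
  exact ⟨_, ⟨z, sphere_subset_closedBall hz⟩, hz, rfl⟩

end IsPolyhedralCell

theorem IsPolyhedralCell.eq_singleton {c : Set (EucSp n)} (hc : IsPolyhedralCell 0 c)
    {p : EucSp n} (hp : p ∈ c) : c = {p} := by
  obtain ⟨h, -⟩ := hc.ball
  refine Set.Subset.antisymm (fun q hq => ?_) (Set.singleton_subset_iff.2 hp)
  have : h ⟨q, hq⟩ = h ⟨p, hp⟩ := Subsingleton.elim _ _
  exact congrArg Subtype.val (h.injective this)

theorem IsPolyhedralCell.frontier_eq_empty {c : Set (EucSp n)} (hc : IsPolyhedralCell 0 c) :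
    intrinsicFrontier ℝ c = ∅ := by
  obtain ⟨p, hp⟩ := hc.nonempty
  rw [hc.eq_singleton hp, intrinsicFrontier_singleton]

/-- An affine coordinate on the line through two points. -/
theorem exists_lineCoord {a b : EucSp n} (hab : a ≠ b) :
    ∃ f : EucSp n → ℝ, Continuous f ∧ ∀ τ : ℝ, f (a + τ • (b - a)) = τ := by
  have hne : ‖b - a‖ ^ 2 ≠ 0 := by
    have := norm_pos_iff.2 (sub_ne_zero.2 hab.symm)
    positivity
  refine ⟨fun p => inner ℝ (p - a) (b - a) / ‖b - a‖ ^ 2, by fun_prop, fun τ => ?_⟩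
  beta_reduce
  rw [add_sub_cancel_left, inner_smul_left, real_inner_self_eq_norm_sq, mul_div_assoc,
    div_self hne]
  simp

/-- No point of a one-dimensional cell lies, as seen from a point `a` of the cell, behind a
boundary point `b`: such a `b` would be a relative interior point. -/
theorem IsPolyhedralCell.le_one_of_mem {c : Set (EucSp n)} (hc : IsPolyhedralCell 1 c)
    {a b : EucSp n} (hb : b ∈ intrinsicFrontier ℝ c) (hab : a ≠ b)
    (hline : ∀ p ∈ affineSpan ℝ c, ∃ τ : ℝ, p = a + τ • (b - a)) (hsub : ∀ τ τ' : ℝ,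
      a + τ • (b - a) ∈ c → τ' ∈ Set.Icc 0 τ → a + τ' • (b - a) ∈ c)
    {τ : ℝ} (hτ : a + τ • (b - a) ∈ c) : τ ≤ 1 := by
  by_contra! h1
  have hbc := hc.frontier_subset hb
  have hb' : b ∈ intrinsicInterior ℝ c := by
    obtain ⟨f, hfc, hf⟩ := exists_lineCoord hab
    have hfb : f b = 1 := by
      have := hf 1
      rwa [one_smul, add_sub_cancel] at this
    rw [mem_intrinsicInterior]
    refine ⟨⟨b, subset_affineSpan ℝ c hbc⟩, mem_interior.2
      ⟨(fun p : affineSpan ℝ c => f p) ⁻¹' Set.Ioo 0 τ, fun p hp => ?_,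
        isOpen_Ioo.preimage (hfc.comp continuous_subtype_val), ?_⟩, rfl⟩
    · obtain ⟨σ, hσ⟩ := hline p p.2
      rw [Set.mem_preimage, hσ, hf] at hp
      rw [Set.mem_preimage, hσ]
      exact hsub τ σ hτ (Set.Ioo_subset_Icc_self hp)
    · simp only [Set.mem_preimage, hfb]
      exact ⟨one_pos, h1⟩
  rw [hc.interior_eq] at hb'
  exact hb'.2 hb

/-- A one-dimensional cell is the segment between any two distinct points of its boundary. -/
theorem IsPolyhedralCell.eq_segment {c : Set (EucSp n)} (hc : IsPolyhedralCell 1 c)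
    {a b : EucSp n} (ha : a ∈ intrinsicFrontier ℝ c) (hb : b ∈ intrinsicFrontier ℝ c)
    (hab : a ≠ b) : segment ℝ a b = c := by
  have hac := hc.frontier_subset ha
  have hbc := hc.frontier_subset hb
  have hba : b - a ≠ 0 := sub_ne_zero.2 hab.symm
  have hdir : b - a ∈ (affineSpan ℝ c).direction :=
    AffineSubspace.vsub_mem_direction (subset_affineSpan ℝ c hbc) (subset_affineSpan ℝ c hac)
  have hspan := (finrank_eq_one_iff_of_nonzero' (⟨b - a, hdir⟩ : (affineSpan ℝ c).direction)
    (by simpa [Subtype.ext_iff] using hba)).1 hc.dim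
  have hline : ∀ p ∈ affineSpan ℝ c, ∃ τ : ℝ, p = a + τ • (b - a) := by
    intro p hp
    obtain ⟨τ, hτ⟩ := hspan ⟨p - a, AffineSubspace.vsub_mem_direction hp
      (subset_affineSpan ℝ c hac)⟩
    refine ⟨τ, ?_⟩
    have := congrArg Subtype.val hτ
    simp only [Submodule.coe_smul] at this
    rw [this, add_sub_cancel]
  -- the cell is connected, hence corresponds to an interval of the line
  have hpre : IsPreconnected c := by
    have := hc.isPreconnected_interior.closure
    rwa [hc.closure_interior] at this
  obtain ⟨f, hfc, hf⟩ := exists_lineCoord hab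
  have hord : (f '' c).OrdConnected := (hpre.image f hfc.continuousOn).ordConnected
  have hinv : ∀ p ∈ c, p = a + f p • (b - a) := fun p hp => by
    obtain ⟨τ, hτ⟩ := hline p (subset_affineSpan ℝ c hp)
    nth_rw 2 [hτ]
    rw [hf, ← hτ]
  have hmem : ∀ τ τ' τ'' : ℝ, a + τ • (b - a) ∈ c → a + τ'' • (b - a) ∈ c → τ' ∈ Set.Icc τ τ'' →
      a + τ' • (b - a) ∈ c := by
    intro τ τ' τ'' h h' hτ'
    obtain ⟨p, hp, hpf⟩ := hord.out ⟨_, h, hf τ⟩ ⟨_, h', hf τ''⟩ hτ'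
    rw [← hpf, ← hinv p hp]
    exact hp
  have h0 : a + (0 : ℝ) • (b - a) ∈ c := by simpa using hac
  have h1 : a + (1 : ℝ) • (b - a) ∈ c := by simpa using hbc
  have hswap : ∀ τ : ℝ, b + τ • (a - b) = a + (1 - τ) • (b - a) := fun τ => by
    rw [sub_smul, one_smul, ← neg_sub b a, smul_neg]
    abel
  rw [segment_eq_image']
  ext p
  constructor
  · rintro ⟨τ, hτ, rfl⟩
    exact hmem 0 τ 1 h0 h1 hτ
  · intro hp
    have hp' := hp
    rw [hinv p hp] at hp'
    refine ⟨f p, ⟨?_, ?_⟩, (hinv p hp).symm⟩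
    · have := hc.le_one_of_mem ha hab.symm (fun q hq => by
        obtain ⟨τ, hτ⟩ := hline q hq
        exact ⟨1 - τ, by rw [hswap, hτ, sub_sub_cancel]⟩) (fun τ τ' h h' => by
          rw [hswap] at h ⊢
          exact hmem _ _ _ h h1 ⟨by linarith [h'.2], by linarith [h'.1]⟩) (τ := 1 - f p)
          (by rwa [hswap, sub_sub_cancel])
      linarith
    · exact hc.le_one_of_mem hb hab hline (fun τ τ' h h' => hmem _ _ _ h0 h h') hp'

end Cells

/-! ### The faces of a polyhedral tiling -/

namespace PolyhedralTiling

open Metric Filter Topology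

variable {n : ℕ} (T : PolyhedralTiling n)

theorem mem_skeleton {d : ℕ} {p : EucSp n} :
    p ∈ T.skeleton d ↔ ∃ j ≤ d, ∃ c ∈ T.cell j, p ∈ c := by
  simp [skeleton]

theorem mem_vertexSet {p : EucSp n} : p ∈ T.vertexSet ↔ {p} ∈ T.cell 0 := by
  rw [vertexSet, mem_skeleton]
  constructor
  · rintro ⟨j, hj, c, hc, hp⟩
    obtain rfl := Nat.le_zero.1 hj
    rwa [← (T.isCell 0 c hc).eq_singleton hp]
  · exact fun h => ⟨0, le_rfl, _, h, rfl⟩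

variable {T}

theorem subset_of_subset_frontier {d : ℕ} {b c : Set (EucSp n)} (hc : c ∈ T.cell d)
    (h : b ⊆ intrinsicFrontier ℝ c) : b ⊆ c :=
  h.trans (T.isCell d c hc).frontier_subset

/-- A cell is the union of the relative interiors of itself and of faces of lower dimension. -/
theorem exists_face {d : ℕ} {c : Set (EucSp n)} (hc : c ∈ T.cell d) {p : EucSp n} (hp : p ∈ c) :
    p ∈ intrinsicInterior ℝ c ∨
      ∃ j < d, ∃ b ∈ T.cell j, b ⊆ c ∧ p ∈ intrinsicInterior ℝ b := by
  induction d generalizing c with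
  | zero =>
    rcases (T.isCell 0 c hc).mem_interior_or_frontier hp with h | h
    · exact Or.inl h
    · rw [(T.isCell 0 c hc).frontier_eq_empty] at h
      exact absurd h (Set.notMem_empty p)
  | succ d ih =>
    rcases (T.isCell _ c hc).mem_interior_or_frontier hp with h | h
    · exact Or.inl h
    · rw [T.boundary d c hc] at h
      obtain ⟨b, ⟨hb, hbc⟩, hpb⟩ := h
      have hbc := subset_of_subset_frontier hc hbc
      rcases ih hb hpb with h | ⟨j, hj, b', hb', hbb', h⟩
      · exact Or.inr ⟨d, d.lt_succ_self, b, hb, hbc, h⟩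
      · exact Or.inr ⟨j, hj.trans d.lt_succ_self, b', hb', hbb'.trans hbc, h⟩

theorem cell_dim {d d' : ℕ} {c : Set (EucSp n)} (hc : c ∈ T.cell d) (hc' : c ∈ T.cell d') :
    d = d' := (T.isCell d c hc).dim.symm.trans (T.isCell d' c hc').dim

/-- A cell whose relative interior meets another cell is a face of it. -/
theorem face_of_mem {j d : ℕ} {b c : Set (EucSp n)} (hb : b ∈ T.cell j) (hc : c ∈ T.cell d)
    {p : EucSp n} (hpb : p ∈ intrinsicInterior ℝ b) (hpc : p ∈ c) : b ⊆ c ∧ (b = c ∨ j < d) := by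
  rcases exists_face hc hpc with h | ⟨i, hi, b', hb', hbc', h⟩
  · have := T.faceToFace _ _ b hb c hc ⟨p, hpb, h⟩
    exact ⟨this.subset, Or.inl this⟩
  · obtain rfl := T.faceToFace _ _ b hb b' hb' ⟨p, hpb, h⟩
    exact ⟨hbc', Or.inr (cell_dim hb hb' ▸ hi)⟩

/-- The relative interiors of the `d`-dimensional cells fill the points of the `d`-skeleton outside
the skeleta of lower dimension. -/
theorem exists_mem_interior_iff {d : ℕ} {p : EucSp n} :
    (∃ c ∈ T.cell d, p ∈ intrinsicInterior ℝ c) ↔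
      p ∈ T.skeleton d ∧ ∀ j < d, p ∉ T.skeleton j := by
  simp only [mem_skeleton]
  constructor
  · rintro ⟨c, hc, hp⟩
    refine ⟨⟨d, le_rfl, c, hc, intrinsicInterior_subset hp⟩, ?_⟩
    rintro j hj ⟨i, hi, c', hc', hp'⟩
    rcases (face_of_mem hc hc' hp hp').2 with rfl | h
    · have := cell_dim hc hc'
      omega
    · omega
  · rintro ⟨⟨j, hj, c, hc, hp⟩, h⟩
    rcases exists_face hc hp with hp | ⟨i, hi, b, hb, -, hp⟩
    · rcases hj.lt_or_eq with hj | rfl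
      · exact absurd ⟨j, le_rfl, c, hc, intrinsicInterior_subset hp⟩ (h j hj)
      · exact ⟨c, hc, hp⟩
    · exact absurd ⟨i, le_rfl, b, hb, intrinsicInterior_subset hp⟩ (h i (hi.trans_le hj))

variable (T) in
theorem locallyFinite_cell (d : ℕ) (q : Set (EucSp n) → Prop) :
    LocallyFinite fun c : {c // c ∈ T.cell d ∧ q c} => c.1 := by
  intro p
  refine ⟨ball 0 (‖p‖ + 1), isOpen_ball.mem_nhds (by simp), ?_⟩
  refine Set.Finite.of_finite_image (f := Subtype.val) ((T.locallyFinite (‖p‖ + 1)).subset ?_)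
    Subtype.val_injective.injOn
  rintro _ ⟨c, hc, rfl⟩
  exact ⟨d, c.2.1, hc⟩

variable (T) in
theorem isClosed_sUnion_cell (d : ℕ) (q : Set (EucSp n) → Prop) :
    IsClosed (⋃₀ {c | c ∈ T.cell d ∧ q c}) := by
  rw [Set.sUnion_eq_iUnion]
  exact (T.locallyFinite_cell d q).isClosed_iUnion fun c => (T.isCell d _ c.2.1).isClosed

variable (T) in
theorem finite_cell_inter {K : Set (EucSp n)} (hK : Bornology.IsBounded K) (d : ℕ) :
    {c | c ∈ T.cell d ∧ (c ∩ K).Nonempty}.Finite := by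
  obtain ⟨r, hr⟩ := hK.subset_ball 0
  refine (T.locallyFinite r).subset ?_
  rintro c ⟨hc, h⟩
  exact ⟨d, hc, h.mono (Set.inter_subset_inter_right _ hr)⟩

/-- The relative interiors of the `d`-dimensional cells are the connected components of the points
of the `d`-skeleton outside the lower skeleta. -/
theorem subset_interior_of_isPreconnected {d : ℕ} {A c : Set (EucSp n)} (hA : IsPreconnected A)
    (hAd : ∀ p ∈ A, ∃ b ∈ T.cell d, p ∈ intrinsicInterior ℝ b) (hc : c ∈ T.cell d)
    (hAc : (A ∩ intrinsicInterior ℝ c).Nonempty) : A ⊆ intrinsicInterior ℝ c := by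
  have heq : ∀ p ∈ A, ∀ b ∈ T.cell d, p ∈ b → p ∈ intrinsicInterior ℝ b := by
    intro p hp b hb hpb
    obtain ⟨b', hb', hpb'⟩ := hAd p hp
    rcases (face_of_mem hb' hb hpb' hpb).2 with rfl | h
    · exact hpb'
    · exact absurd h (lt_irrefl _)
  intro p hp
  refine heq p hp c hc ?_
  by_contra hpc
  obtain ⟨q, hqA, hqc⟩ := hAc
  obtain ⟨z, hzA, hzc, b, ⟨hb, hbc⟩, hzb⟩ := isPreconnected_closed_iff.1 hA c
    (⋃₀ {b | b ∈ T.cell d ∧ b ≠ c}) (T.isCell d c hc).isClosed (T.isClosed_sUnion_cell d (· ≠ c))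
    (fun z hz => by
      obtain ⟨b, hb, hzb⟩ := hAd z hz
      by_cases hbc : b = c
      · exact Or.inl (hbc ▸ intrinsicInterior_subset hzb)
      · exact Or.inr ⟨b, ⟨hb, hbc⟩, intrinsicInterior_subset hzb⟩)
    ⟨q, hqA, intrinsicInterior_subset hqc⟩ (by
      obtain ⟨b, hb, hpb⟩ := hAd p hp
      have hpb := intrinsicInterior_subset hpb
      exact ⟨p, hp, b, ⟨hb, fun h => hpc (h ▸ hpb)⟩, hpb⟩)
  exact hbc (T.faceToFace _ _ b hb c hc ⟨z, heq z hzA b hb hzb, heq z hzA c hc hzc⟩)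

variable (T) in
theorem exists_tile_mem (p : EucSp n) : ∃ t ∈ T.cell n, p ∈ t := by
  have : p ∈ ⋃₀ T.cell n := by rw [T.covers]; trivial
  exact this

theorem exists_tile {d : ℕ} {c : Set (EucSp n)} (hc : c ∈ T.cell d) : ∃ t ∈ T.cell n, c ⊆ t := by
  obtain ⟨p, hp⟩ := (T.isCell d c hc).interior_nonempty
  obtain ⟨t, ht, hpt⟩ := T.exists_tile_mem p
  exact ⟨t, ht, (face_of_mem hc ht hp hpt).1⟩

theorem exists_vertex_mem {d : ℕ} {c : Set (EucSp n)} (hc : c ∈ T.cell d) :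
    ∃ v ∈ T.vertexSet, v ∈ c := by
  induction d generalizing c with
  | zero =>
    obtain ⟨v, hv⟩ := (T.isCell 0 c hc).nonempty
    refine ⟨v, T.mem_vertexSet.2 ?_, hv⟩
    rwa [← (T.isCell 0 c hc).eq_singleton hv]
  | succ d ih =>
    obtain ⟨p, hp⟩ := (T.isCell _ c hc).frontier_nonempty d.succ_pos
    rw [T.boundary d c hc] at hp
    obtain ⟨b, ⟨hb, hbc⟩, -⟩ := hp
    obtain ⟨v, hv, hvb⟩ := ih hb
    exact ⟨v, hv, subset_of_subset_frontier hc hbc hvb⟩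

/-- Cells that meet have a common vertex. -/
theorem exists_common_vertex {d d' : ℕ} {c c' : Set (EucSp n)} (hc : c ∈ T.cell d)
    (hc' : c' ∈ T.cell d') (h : (c ∩ c').Nonempty) : ∃ v ∈ T.vertexSet, v ∈ c ∧ v ∈ c' := by
  obtain ⟨p, hp, hp'⟩ := h
  have key : ∃ j, ∃ b ∈ T.cell j, b ⊆ c ∧ p ∈ intrinsicInterior ℝ b := by
    rcases exists_face hc hp with h | ⟨j, -, b, hb, hbc, h⟩
    · exact ⟨d, c, hc, Set.Subset.rfl, h⟩
    · exact ⟨j, b, hb, hbc, h⟩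
  obtain ⟨j, b, hb, hbc, hpb⟩ := key
  obtain ⟨v, hv, hvb⟩ := exists_vertex_mem hb
  exact ⟨v, hv, hbc hvb, (face_of_mem hb hc' hpb hp').1 hvb⟩

/-- The vertices of a cell of positive dimension lie on its boundary. -/
theorem mem_frontier_of_vertex {d : ℕ} (hd : 0 < d) {c : Set (EucSp n)} (hc : c ∈ T.cell d)
    {v : EucSp n} (hv : v ∈ T.vertexSet) (hvc : v ∈ c) : v ∈ intrinsicFrontier ℝ c := by
  refine ((T.isCell d c hc).mem_interior_or_frontier hvc).resolve_left fun h => ?_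
  have hv := T.mem_vertexSet.1 hv
  have := T.faceToFace _ _ _ hv c hc ⟨v, by rw [intrinsicInterior_singleton]; rfl, h⟩
  have := cell_dim (this ▸ hv) hc
  omega

/-! ### Edge paths -/

/-- The vertices `a` and `b` are joined by an edge path each of whose edges lies in some member of
the family `S`. -/
def Joined (T : PolyhedralTiling n) (S : Set (Set (EucSp n))) (a b : EucSp n) : Prop :=
  ∃ p : T.graph.Walk a b, ∀ e ∈ p.darts, ∃ c ∈ S, segment ℝ e.fst e.snd ⊆ c

namespace Joined

variable {S S' : Set (Set (EucSp n))} {a b c : EucSp n}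

theorem refl (S : Set (Set (EucSp n))) (a : EucSp n) : T.Joined S a a := ⟨.nil, by simp⟩

theorem trans (h : T.Joined S a b) (h' : T.Joined S b c) : T.Joined S a c := by
  obtain ⟨p, hp⟩ := h
  obtain ⟨p', hp'⟩ := h'
  refine ⟨p.append p', fun e he => ?_⟩
  rw [SimpleGraph.Walk.darts_append, List.mem_append] at he
  exact he.elim (hp e) (hp' e)

theorem mono (hS : ∀ c ∈ S, ∃ c' ∈ S', c ⊆ c') (h : T.Joined S a b) : T.Joined S' a b := by
  obtain ⟨p, hp⟩ := h
  refine ⟨p, fun e he => ?_⟩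
  obtain ⟨c, hc, h⟩ := hp e he
  obtain ⟨c', hc', h'⟩ := hS c hc
  exact ⟨c', hc', h.trans h'⟩

end Joined

/-- If a connected set is covered by finitely many closed sets meeting it, then a property that is
inherited by neighbouring members of the cover holds for all of them as soon as it holds for one. -/
theorem _root_.IsPreconnected.chain_induction {E : Type*} [TopologicalSpace E] {K : Set E}
    (hK : IsPreconnected K) {𝓕 : Set (Set E)} (hfin : 𝓕.Finite) (hcl : ∀ c ∈ 𝓕, IsClosed c)
    (hmeet : ∀ c ∈ 𝓕, (c ∩ K).Nonempty) (hcov : K ⊆ ⋃₀ 𝓕) {q : Set E → Prop}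
    (hq : ∀ c ∈ 𝓕, ∀ c' ∈ 𝓕, (c ∩ c').Nonempty → q c → q c') {c₀ : Set E} (hc₀ : c₀ ∈ 𝓕)
    (h₀ : q c₀) : ∀ c ∈ 𝓕, q c := by
  intro c hc
  by_contra hcq
  have hclosed : ∀ r : Set E → Prop, IsClosed (⋃₀ {c | c ∈ 𝓕 ∧ r c}) := fun r => by
    rw [Set.sUnion_eq_biUnion]
    exact (hfin.subset fun _ h => h.1).isClosed_biUnion fun c hc => hcl c hc.1
  obtain ⟨z, -, ⟨c₁, ⟨h₁, hq₁⟩, hz₁⟩, c₂, ⟨h₂, hq₂⟩, hz₂⟩ := isPreconnected_closed_iff.1 hK _ _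
    (hclosed q) (hclosed fun c => ¬ q c) (fun z hz => by
      obtain ⟨c, hc, hzc⟩ := hcov hz
      by_cases h : q c
      · exact Or.inl ⟨c, ⟨hc, h⟩, hzc⟩
      · exact Or.inr ⟨c, ⟨hc, h⟩, hzc⟩)
    (by
      obtain ⟨z, hz, hzK⟩ := hmeet c₀ hc₀
      exact ⟨z, hzK, c₀, ⟨hc₀, h₀⟩, hz⟩)
    (by
      obtain ⟨z, hz, hzK⟩ := hmeet c hc
      exact ⟨z, hzK, c, ⟨hc, hcq⟩, hz⟩)
  exact hq₂ (hq c₁ h₁ c₂ h₂ ⟨z, hz₁, hz₂⟩ hq₁)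

/-- Any two vertices of a cell are joined by an edge path in the cell. -/
theorem joined_of_mem_cell {d : ℕ} {c : Set (EucSp n)} (hc : c ∈ T.cell d) {a b : EucSp n}
    (ha : a ∈ T.vertexSet) (hb : b ∈ T.vertexSet) (hac : a ∈ c) (hbc : b ∈ c) :
    T.Joined {c} a b := by
  induction d generalizing c a b with
  | zero =>
    rw [(T.isCell 0 c hc).eq_singleton hac] at hbc
    obtain rfl : b = a := hbc
    exact Joined.refl _ _
  | succ d ih =>
    have haf := mem_frontier_of_vertex d.succ_pos hc ha hac
    have hbf := mem_frontier_of_vertex d.succ_pos hc hb hbc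
    rcases Nat.eq_zero_or_pos d with rfl | hd
    · by_cases hab : a = b
      · subst hab
        exact Joined.refl _ _
      · have hseg := (T.isCell 1 c hc).eq_segment haf hbf hab
        have hadj : T.graph.Adj a b := ⟨hab, by rw [hseg]; exact hc⟩
        refine ⟨.cons hadj .nil, fun e he => ⟨c, rfl, ?_⟩⟩
        simp only [SimpleGraph.Walk.darts_cons, SimpleGraph.Walk.darts_nil,
          List.mem_singleton] at he
        subst he
        exact hseg.subset
    · -- the boundary is connected and covered by the facets
      have hbd := T.boundary d c hc
      have hsub : ∀ f ∈ {f | f ∈ T.cell d ∧ f ⊆ intrinsicFrontier ℝ c}, T.Joined {f} ≤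
          T.Joined {c} := fun f hf a b h => h.mono (by
        rintro _ rfl
        exact ⟨c, rfl, subset_of_subset_frontier hc hf.2⟩)
      have haf' := haf
      have hbf' := hbf
      rw [hbd] at haf' hbf'
      obtain ⟨fa, hfa, hafa⟩ := haf'
      obtain ⟨fb, hfb, hbfb⟩ := hbf'
      refine IsPreconnected.chain_induction
        (q := fun f => ∀ w ∈ T.vertexSet, w ∈ f → T.Joined {c} a w)
        ((T.isCell _ c hc).isPreconnected_frontier (by omega))
        (𝓕 := {f | f ∈ T.cell d ∧ f ⊆ intrinsicFrontier ℝ c}) ?_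
        (fun f hf => (T.isCell d f hf.1).isClosed) (fun f hf => ?_) hbd.subset
        (fun f hf f' hf' hne hq w hw hwf' => ?_) hfa
        (fun w hw hwf => hsub fa hfa _ _ (ih hfa.1 ha hw hafa hwf)) fb hfb b hb hbfb
      · refine (T.finite_cell_inter (T.isCell _ c hc).isCompact.isBounded d).subset ?_
        rintro f ⟨hf, hfc⟩
        obtain ⟨p, hp⟩ := (T.isCell d f hf).nonempty
        exact ⟨hf, p, hp, subset_of_subset_frontier hc hfc hp⟩
      · obtain ⟨p, hp⟩ := (T.isCell d f hf.1).nonempty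
        exact ⟨p, hp, hf.2 hp⟩
      · obtain ⟨v, hv, hvf, hvf'⟩ := exists_common_vertex hf.1 hf'.1 hne
        exact (hq v hv hvf).trans (hsub f' hf' _ _ (ih hf'.1 hv hw hvf' hwf'))

/-- Two vertices are joined by an edge path along tiles that meet the segment between them. -/
theorem joined_along_segment {a b : EucSp n} (ha : a ∈ T.vertexSet) (hb : b ∈ T.vertexSet) :
    T.Joined {t | t ∈ T.cell n ∧ (t ∩ segment ℝ a b).Nonempty} a b := by
  have hbdd : Bornology.IsBounded (segment ℝ a b) := by
    rw [← convexHull_pair]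
    exact (isBounded_convexHull.2 (Set.toFinite _).isBounded)
  obtain ⟨ta, hta, hata⟩ := T.exists_tile_mem a
  obtain ⟨tb, htb, hbtb⟩ := T.exists_tile_mem b
  have hsub : ∀ t ∈ {t | t ∈ T.cell n ∧ (t ∩ segment ℝ a b).Nonempty}, ∀ v w, T.Joined {t} v w →
      T.Joined {t | t ∈ T.cell n ∧ (t ∩ segment ℝ a b).Nonempty} v w :=
    fun t ht v w h => h.mono (by
      rintro _ rfl
      exact ⟨_, ht, Set.Subset.rfl⟩)
  refine IsPreconnected.chain_induction
    (q := fun f => ∀ w ∈ T.vertexSet, w ∈ f →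
      T.Joined {t | t ∈ T.cell n ∧ (t ∩ segment ℝ a b).Nonempty} a w)
    (convex_segment a b).isPreconnected (T.finite_cell_inter hbdd n)
    (fun t ht => (T.isCell n t ht.1).isClosed) (fun t ht => ht.2) (fun p hp => ?_)
    (fun t ht t' ht' hne hq w hw hwt' => ?_)
    ⟨hta, a, hata, left_mem_segment ℝ a b⟩
    (fun w hw hwt => hsub ta ⟨hta, a, hata, left_mem_segment ℝ a b⟩ _ _
      (joined_of_mem_cell hta ha hw hata hwt))
    tb ⟨htb, b, hbtb, right_mem_segment ℝ a b⟩ b hb hbtb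
  · obtain ⟨t, ht, hpt⟩ := T.exists_tile_mem p
    exact ⟨t, ⟨ht, p, hpt, hp⟩, hpt⟩
  · obtain ⟨v, hv, hvt, hvt'⟩ := exists_common_vertex ht.1 ht'.1 hne
    exact (hq v hv hvt).trans (hsub t' ht' _ _ (joined_of_mem_cell ht'.1 hv hw hvt' hwt'))

end PolyhedralTiling

/-! ### Transport of cells between equal patches -/

namespace PolyhedralTiling

open Metric Filter Topology

variable {n : ℕ} {T : PolyhedralTiling n}

theorem exists_dist_le (hT : T.FiniteLocalComplexity) :
    ∃ D : ℝ, 0 ≤ D ∧ ∀ d, ∀ c ∈ T.cell d, ∀ p ∈ c, ∀ q ∈ c, dist p q ≤ D := by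
  obtain ⟨D, hD⟩ := hT.1
  refine ⟨max D 0, le_max_right _ _, fun d c hc p hp q hq => ?_⟩
  obtain ⟨t, ht, hct⟩ := exists_tile hc
  exact ((dist_le_diam_of_mem (T.isCell n t ht).isCompact.isBounded (hct hp) (hct hq)).trans
    (hD t ht)).trans (le_max_left _ _)

theorem deloneFLC (hT : T.FiniteLocalComplexity) : DeloneFLC T.vertexSet := by
  refine ⟨?_, fun R => ?_⟩
  · obtain ⟨D, hD0, hD⟩ := exists_dist_le hT
    refine ⟨D + 1, by linarith, fun y => ?_⟩
    obtain ⟨t, ht, hyt⟩ := T.exists_tile_mem y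
    obtain ⟨v, hv, hvt⟩ := exists_vertex_mem ht
    exact ⟨v, hv, by linarith [hD n t ht v hvt y hyt]⟩
  · -- the vertices in a ball form a finite set, and so do the vertex patches
    have hball : ∀ x : EucSp n, (patch R (shiftSet T.vertexSet x)).Finite := fun x => by
      have h := T.finite_cell_inter (isBounded_ball (x := x) (r := R)) 0
      refine Set.Finite.of_finite_image (f := fun q => ({q + x} : Set (EucSp n))) (h.subset ?_)
        (fun q _ q' _ h => add_right_cancel (Set.singleton_injective h))
      rintro _ ⟨q, ⟨hq, hqx⟩, rfl⟩
      refine ⟨T.mem_vertexSet.1 hqx, q + x, rfl, ?_⟩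
      rw [mem_ball_zero_iff] at hq
      simpa using hq
    have hfin := (hT.2 R).biUnion (t := fun p => p 0) (by
      rintro _ ⟨x, -, rfl⟩
      exact hball x)
    refine hfin.subset ?_
    rintro q ⟨hq, v, hv, hqv⟩
    exact Set.mem_biUnion ⟨v, hv, rfl⟩ ⟨by simpa using hq, hqv⟩

theorem patch_vertexSet_of_tilingPatch {r : ℝ} {x y : EucSp n}
    (h : T.tilingPatch r x = T.tilingPatch r y) :
    patch r (shiftSet T.vertexSet x) = patch r (shiftSet T.vertexSet y) := congrFun h 0

theorem skeleton_eq_univ {d : ℕ} (hd : n ≤ d) : T.skeleton d = Set.univ := by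
  refine Set.eq_univ_of_forall fun p => T.mem_skeleton.2 ?_
  obtain ⟨t, ht, hp⟩ := T.exists_tile_mem p
  exact ⟨n, hd, t, ht, hp⟩

/-- Local derivability from the vertices, with a radius that serves all skeleta. -/
theorem exists_tilingPatch_eq (hder : T.DerivableFromVertices) :
    ∃ R₁ : ℝ, 0 ≤ R₁ ∧ ∀ r x y, patch (r + R₁) (shiftSet T.vertexSet x)
      = patch (r + R₁) (shiftSet T.vertexSet y) → T.tilingPatch r x = T.tilingPatch r y := by
  choose R hR0 hR using hder
  refine ⟨∑ d ∈ Finset.range n, R d, Finset.sum_nonneg fun d _ => (hR0 d).le,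
    fun r x y h => funext fun d => ?_⟩
  rw [tilingPatch, tilingPatch, patch_eq_iff]
  intro q hq
  by_cases hd : n ≤ d
  · simp [mem_shiftSet, skeleton_eq_univ hd]
  · have hle : R d ≤ ∑ d ∈ Finset.range n, R d :=
      Finset.single_le_sum (fun d _ => (hR0 d).le) (Finset.mem_range.2 (not_le.1 hd))
    rw [mem_shiftSet, mem_shiftSet, add_comm q x, add_comm q y]
    exact hR d _ _ (patch_shiftSet_add h (by linarith))

/-- `E` is a radius of locality for the cells of `T`: if the vertex patches of radius `r + E` around
`x` and `y` agree, then the translation by `y - x` maps the cells that meet the ball of radius `r`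
around `x` to cells. The cells have diameter at most `D`. -/
structure LocalityRadius (T : PolyhedralTiling n) (D E : ℝ) : Prop where
  nonneg : 0 ≤ D
  nonneg' : 0 ≤ E
  dist_le : ∀ d, ∀ c ∈ T.cell d, ∀ p ∈ c, ∀ q ∈ c, dist p q ≤ D
  tiling : ∀ r x y, patch (r + E) (shiftSet T.vertexSet x) = patch (r + E) (shiftSet T.vertexSet y) →
    T.tilingPatch r x = T.tilingPatch r y
  translate : ∀ r x y,
    patch (r + E) (shiftSet T.vertexSet x) = patch (r + E) (shiftSet T.vertexSet y) →
    ∀ d, ∀ c ∈ T.cell d, (c ∩ ball x r).Nonempty → (fun p => p + (y - x)) '' c ∈ T.cell d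

theorem exists_localityRadius (hT : T.FiniteLocalComplexity) (hder : T.DerivableFromVertices) :
    ∃ D E, T.LocalityRadius D E := by
  obtain ⟨D, hD0, hD⟩ := exists_dist_le hT
  obtain ⟨R₁, hR₁, hR⟩ := exists_tilingPatch_eq hder
  refine ⟨D, 2 * D + R₁, hD0, by linarith, hD, fun r x y h => hR r x y
    (patch_mono (by linarith) h), fun r x y h d c hc hcx => ?_⟩
  have hskel : ∀ (p : EucSp n) j, dist p x < r + 2 * D →
      (p ∈ T.skeleton j ↔ p + (y - x) ∈ T.skeleton j) := by
    intro p j hp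
    have h := congrFun (hR (r + 2 * D) x y (patch_mono (by linarith) h)) j
    have := patch_eq_iff.1 h (p - x) (by rwa [← dist_eq_norm])
    rwa [mem_shiftSet, mem_shiftSet, sub_add_cancel, sub_add, ← neg_sub y x, sub_neg_eq_add] at this
  have hstratum : ∀ p : EucSp n, dist p x < r + 2 * D →
      ((∃ b ∈ T.cell d, p ∈ intrinsicInterior ℝ b) ↔
        ∃ b ∈ T.cell d, p + (y - x) ∈ intrinsicInterior ℝ b) := by
    intro p hp
    rw [exists_mem_interior_iff, exists_mem_interior_iff, hskel p d hp]
    simp only [fun j => hskel p j hp]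
  -- the translate of the relative interior is a component, hence the interior of a cell `c'`
  obtain ⟨p₀, hp₀c, hp₀⟩ := hcx
  rw [mem_ball] at hp₀
  have hcell := T.isCell d c hc
  have hnear : ∀ p ∈ c, dist p x < r + D := fun p hp =>
    (dist_triangle p p₀ x).trans_lt (by linarith [hD d c hc p hp p₀ hp₀c])
  obtain ⟨p, hp⟩ := hcell.interior_nonempty
  have hpc := intrinsicInterior_subset hp
  obtain ⟨c', hc', hpc'⟩ := (hstratum p (by linarith [hnear p hpc])).1 ⟨c, hc, hp⟩
  have hcell' := T.isCell d c' hc'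
  have h1 : (fun p => p + (y - x)) '' intrinsicInterior ℝ c ⊆ intrinsicInterior ℝ c' := by
    refine subset_interior_of_isPreconnected
      (hcell.isPreconnected_interior.image _ (by fun_prop)) ?_ hc' ⟨_, ⟨p, hp, rfl⟩, hpc'⟩
    rintro _ ⟨q, hq, rfl⟩
    exact (hstratum q (by linarith [hnear q (intrinsicInterior_subset hq)])).1 ⟨c, hc, hq⟩
  have h2 : (fun p => p - (y - x)) '' intrinsicInterior ℝ c' ⊆ intrinsicInterior ℝ c := by
    refine subset_interior_of_isPreconnected
      (hcell'.isPreconnected_interior.image _ (by fun_prop)) ?_ hc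
      ⟨p, ⟨_, hpc', by simp⟩, hp⟩
    rintro _ ⟨q, hq, rfl⟩
    refine (hstratum _ ?_).2 ⟨c', hc', by rwa [sub_add_cancel]⟩
    have e1 := hD d c' hc' q (intrinsicInterior_subset hq) _ (intrinsicInterior_subset hpc')
    have e2 := dist_triangle (q - (y - x)) p x
    rw [show dist (q - (y - x)) p = dist q (p + (y - x)) by
      rw [dist_eq_norm, dist_eq_norm, sub_add_eq_sub_sub_swap]] at e2
    linarith [hnear p hpc]
  have h3 : (fun p => p + (y - x)) '' intrinsicInterior ℝ c = intrinsicInterior ℝ c' := by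
    refine h1.antisymm fun q hq => ⟨q - (y - x), h2 ⟨q, hq, rfl⟩, by simp⟩
  have h4 := (Homeomorph.addRight (y - x)).image_closure (intrinsicInterior ℝ c)
  simp only [Homeomorph.coe_addRight] at h4
  rw [h3, hcell'.closure_interior, hcell.closure_interior] at h4
  rwa [h4]

theorem mem_cell_of_mem_collar {t : Set (EucSp n)} (ht : t ∈ T.cell n) {k : ℕ}
    {s : Set (EucSp n)} (hs : s ∈ T.collar k t) : s ∈ T.cell n := by
  cases k with
  | zero =>
    obtain rfl : s = t := hs
    exact ht
  | succ k => exact hs.1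

theorem image_add_image (u : EucSp n) (s : Set (EucSp n)) :
    (fun x => x + -u) '' ((fun x => x + u) '' s) = s := by
  rw [Set.image_image]
  simp

namespace LocalityRadius

variable {D E : ℝ} (h : T.LocalityRadius D E)
include h

/-- The tiles of the `k`-th collar of a tile near `x` are near `x`, as each step adds at most `D`. -/
theorem collar_inter_ball {x : EucSp n} {r : ℝ} {t : Set (EucSp n)}
    (htx : (t ∩ ball x r).Nonempty) {k : ℕ} {s : Set (EucSp n)} (ht : t ∈ T.cell n)
    (hs : s ∈ T.collar k t) : (s ∩ ball x (r + k * D)).Nonempty := by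
  induction k generalizing s with
  | zero =>
    obtain rfl : s = t := hs
    simpa using htx
  | succ k ih =>
    obtain ⟨hs, s', hs', q, hq, hq'⟩ := hs
    obtain ⟨p, hp, hpx⟩ := ih hs'
    refine ⟨q, hq, ?_⟩
    rw [mem_ball] at hpx ⊢
    have := h.dist_le n s' (mem_cell_of_mem_collar ht hs') q hq' p hp
    have := dist_triangle q p x
    push_cast
    linarith

theorem collar_translate {x y : EucSp n} {r : ℝ} {t : Set (EucSp n)}
    (htx : (t ∩ ball x r).Nonempty) (ht : t ∈ T.cell n) {k : ℕ}
    (hxy : patch (r + k * D + E) (shiftSet T.vertexSet x)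
      = patch (r + k * D + E) (shiftSet T.vertexSet y)) {s : Set (EucSp n)}
    (hs : s ∈ T.collar k t) :
    (fun p => p + (y - x)) '' s ∈ T.collar k ((fun p => p + (y - x)) '' t) := by
  induction k generalizing s with
  | zero =>
    obtain rfl : s = t := hs
    rfl
  | succ k ih =>
    have hne := h.collar_inter_ball htx ht hs
    obtain ⟨hs, s', hs', hss⟩ := hs
    have hk : r + k * D + E ≤ r + (k + 1 : ℕ) * D + E := by
      push_cast
      linarith [h.nonneg]
    refine ⟨h.translate _ x y hxy n s hs hne, _, ih (patch_mono hk hxy) hs', ?_⟩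
    obtain ⟨q, hq, hq'⟩ := hss
    exact ⟨_, ⟨q, hq, rfl⟩, ⟨q, hq', rfl⟩⟩

theorem collarCells_translate {x y : EucSp n} {r : ℝ} {t : Set (EucSp n)}
    (htx : (t ∩ ball x r).Nonempty) (ht : t ∈ T.cell n) {k : ℕ}
    (hxy : patch (r + (k + 1) * D + E) (shiftSet T.vertexSet x)
      = patch (r + (k + 1) * D + E) (shiftSet T.vertexSet y)) {d : ℕ} {c : Set (EucSp n)}
    (hc : c ∈ T.collarCells k t d) :
    (fun p => p + (y - x)) '' c ∈ T.collarCells k ((fun p => p + (y - x)) '' t) d := by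
  obtain ⟨hc, s, hs, hcs⟩ := hc
  have hD := h.nonneg
  refine ⟨h.translate _ x y hxy d c hc ?_, _,
    h.collar_translate htx ht (patch_mono (by linarith) hxy) hs, Set.image_mono hcs⟩
  obtain ⟨p, hp, hpx⟩ := h.collar_inter_ball htx ht hs
  obtain ⟨q, hq⟩ := (T.isCell d c hc).nonempty
  refine ⟨q, hq, ?_⟩
  rw [mem_ball] at hpx ⊢
  have := h.dist_le n s (mem_cell_of_mem_collar ht hs) q (hcs hq) p hp
  have := dist_triangle q p x
  linarith

theorem collarCongruent {x y : EucSp n} {r : ℝ} {t : Set (EucSp n)}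
    (htx : (t ∩ ball x r).Nonempty) (ht : t ∈ T.cell n) {k : ℕ}
    (hxy : patch (r + (k + 1) * D + E) (shiftSet T.vertexSet x)
      = patch (r + (k + 1) * D + E) (shiftSet T.vertexSet y)) :
    T.CollarCongruent k (y - x) t ((fun p => p + (y - x)) '' t) := by
  have hD := h.nonneg
  have hkD : 0 ≤ (k + 1) * D := by positivity
  have ht' : (fun p => p + (y - x)) '' t ∈ T.cell n :=
    h.translate r x y (patch_mono (by linarith) hxy) n t ht htx
  have htx' : ((fun p => p + (y - x)) '' t ∩ ball y r).Nonempty := by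
    obtain ⟨p, hp, hpx⟩ := htx
    refine ⟨_, ⟨p, hp, rfl⟩, ?_⟩
    rw [mem_ball, dist_eq_norm] at hpx ⊢
    rwa [show p + (y - x) - y = p - x by abel]
  refine ⟨ht, ht', rfl, fun d => Set.Subset.antisymm ?_ fun c hc => ?_⟩
  · rintro _ ⟨c, hc, rfl⟩
    exact h.collarCells_translate htx ht hxy hc
  · have := h.collarCells_translate htx' ht' hxy.symm hc
    rw [← neg_sub y x, image_add_image] at this
    refine ⟨_, this, ?_⟩
    have := image_add_image (-(y - x)) c
    rwa [neg_neg] at this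

theorem adj_translate {x y : EucSp n} {r : ℝ} {a b : EucSp n} (hab : T.graph.Adj a b)
    (hx : (segment ℝ a b ∩ ball x r).Nonempty)
    (hxy : patch (r + E) (shiftSet T.vertexSet x) = patch (r + E) (shiftSet T.vertexSet y)) :
    T.graph.Adj (a + (y - x)) (b + (y - x)) := by
  refine ⟨fun h => hab.1 (add_right_cancel h), ?_⟩
  have := h.translate r x y hxy 1 _ hab.2 hx
  simp only [add_comm _ (y - x)] at this ⊢
  rwa [segment_translate_image] at this

/-- An edge path along tiles near `x` can be translated to an edge path near `y` with the same
values if the vertex patches around `x` and `y` agree. -/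
theorem exists_walk_translate {x y : EucSp n} {r : ℝ} {k : ℕ} (f : T.APGEdge k → EucSp n)
    (hxy : patch (r + (k + 1) * D + E) (shiftSet T.vertexSet x)
      = patch (r + (k + 1) * D + E) (shiftSet T.vertexSet y)) {S : Set (Set (EucSp n))}
    (hS : ∀ t ∈ S, t ∈ T.cell n ∧ (t ∩ ball x r).Nonempty) {a b : EucSp n} (p : T.graph.Walk a b)
    (hp : ∀ e ∈ p.darts, ∃ t ∈ S, segment ℝ e.fst e.snd ⊆ t) :
    ∃ p' : T.graph.Walk (a + (y - x)) (b + (y - x)), T.evalPath f p' = T.evalPath f p := by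
  have hD := h.nonneg
  have hkD : 0 ≤ k * D := mul_nonneg (Nat.cast_nonneg _) hD
  induction p with
  | nil => exact ⟨.nil, rfl⟩
  | @cons a b c hab p ih =>
    obtain ⟨p', hp'⟩ := ih fun e he => hp e (by simp [he])
    obtain ⟨t, ht, hseg⟩ := hp ⟨(a, b), hab⟩ (by simp)
    obtain ⟨htn, htx⟩ := hS t ht
    have hadj := h.adj_translate (r := r + D) hab (by
      obtain ⟨q, hq, hqx⟩ := htx
      refine ⟨a, left_mem_segment ℝ a b, ?_⟩
      rw [mem_ball] at hqx ⊢
      have := h.dist_le n t htn a (hseg (left_mem_segment ℝ a b)) q hq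
      have := dist_triangle a q x
      linarith) (patch_mono (by linarith) hxy)
    refine ⟨.cons hadj p', ?_⟩
    have hrel : T.toAPG k ⟨(a, b), hab⟩ = T.toAPG k ⟨(_, _), hadj⟩ :=
      Quot.sound ⟨y - x, t, _, h.collarCongruent htx htn hxy, hseg, rfl, rfl⟩
    simp only [evalPath, SimpleGraph.Walk.darts_cons, List.map_cons, List.sum_cons] at hp' ⊢
    rw [hp', hrel]

/-- Every neighbourhood of the tiles of bounded size is covered by the collars of some order. -/
theorem exists_largeComparedTo (hT : T.FiniteLocalComplexity) (r : ℝ) :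
    ∃ k, T.LargeComparedTo k r := by
  have hD := h.nonneg
  have hP := deloneFLC hT
  -- a uniform neighbourhood of the tiles is covered by the first collars
  obtain ⟨δ, hδ, hcov⟩ : ∃ δ : ℝ, 0 < δ ∧
      ∀ t ∈ T.cell n, thickening δ t ⊆ ⋃₀ T.collar 1 t := by
    have hone : ∀ t ∈ T.cell n, ∃ δ : ℝ, 0 < δ ∧ thickening δ t ⊆ ⋃₀ T.collar 1 t := by
      intro t ht
      obtain ⟨δ, hδ, h⟩ := (T.isCell n t ht).isCompact.exists_thickening_subset_open
        (T.isClosed_sUnion_cell n fun s => ¬ (s ∩ t).Nonempty).isOpen_compl (by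
          rintro p hp ⟨s, ⟨-, hs⟩, hps⟩
          exact hs ⟨p, hps, hp⟩)
      refine ⟨δ, hδ, fun p hp => ?_⟩
      obtain ⟨s, hs, hps⟩ := T.exists_tile_mem p
      by_contra hcon
      exact h hp ⟨s, ⟨hs, fun hst => hcon ⟨s, ⟨hs, t, rfl, hst⟩, hps⟩⟩, hps⟩
    let R : ℝ := 1 + (1 + 1) * D + E
    have hfin : ∀ p ∈ {p | ∃ v ∈ T.vertexSet, p = patch R (shiftSet T.vertexSet v)},
        ∀ᶠ δ : ℝ in 𝓝[>] 0, ∀ v, patch R (shiftSet T.vertexSet v) = p →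
          ∀ t ∈ T.cell n, v ∈ t → thickening δ t ⊆ ⋃₀ T.collar 1 t := by
      rintro _ ⟨w, hw, rfl⟩
      have hev : ∀ᶠ δ : ℝ in 𝓝[>] 0, ∀ t ∈ {t | t ∈ T.cell n ∧ (t ∩ {w}).Nonempty},
          thickening δ t ⊆ ⋃₀ T.collar 1 t := by
        refine (eventually_all_finite (T.finite_cell_inter
          (Set.finite_singleton w).isBounded n)).2 fun t ht => ?_
        obtain ⟨δ, hδ, h⟩ := hone t ht.1
        filter_upwards [Ioo_mem_nhdsGT hδ] with δ' hδ'
        exact (thickening_mono hδ'.2.le t).trans h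
      filter_upwards [hev] with δ hδ v hv t ht hvt p hp
      have htv : (t ∩ ball v 1).Nonempty := ⟨v, hvt, mem_ball_self one_pos⟩
      have htw : (fun p => p + (w - v)) '' t ∈ T.cell n :=
        h.translate 1 v w (patch_mono (by simp only [R]; linarith) hv) n t ht htv
      have hwt : w ∈ (fun p => p + (w - v)) '' t := ⟨v, hvt, by simp⟩
      obtain ⟨s, hs, hps⟩ := hδ _ ⟨htw, w, hwt, rfl⟩ (show p + (w - v) ∈ _ by
        rw [mem_thickening_iff] at hp ⊢
        obtain ⟨z, hz, hpz⟩ := hp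
        exact ⟨_, ⟨z, hz, rfl⟩, by simpa using hpz⟩)
      have := h.collar_translate (y := v) (k := 1) ⟨w, hwt, mem_ball_self one_pos⟩ htw
        (patch_mono (by simp only [R]; push_cast; linarith) hv.symm) hs
      rw [← neg_sub w v, image_add_image] at this
      exact ⟨_, this, _, hps, by beta_reduce; abel⟩
    obtain ⟨δ, hδ, h0⟩ :=
      (((eventually_all_finite (hP.finite_patches R)).2 hfin).and self_mem_nhdsWithin).exists
    refine ⟨δ, h0, fun t ht => ?_⟩
    obtain ⟨v, hv, hvt⟩ := exists_vertex_mem ht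
    exact hδ _ ⟨v, hv, rfl⟩ v rfl t ht hvt
  have key : ∀ m : ℕ, ∀ t ∈ T.cell n, thickening ((m + 1 : ℕ) * δ) t ⊆ ⋃₀ T.collar (m + 1) t := by
    intro m
    induction m with
    | zero => simpa using hcov
    | succ m ih =>
      intro t ht p hp
      have hpos : 0 < ((m + 1 : ℕ) : ℝ) * δ := by positivity
      rw [show ((m + 1 + 1 : ℕ) : ℝ) * δ = δ + (m + 1 : ℕ) * δ by push_cast; ring,
        ← thickening_thickening hδ hpos, mem_thickening_iff] at hp
      obtain ⟨z, hz, hpz⟩ := hp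
      obtain ⟨s, hs, hzs⟩ := ih t ht hz
      have hsn := mem_cell_of_mem_collar ht hs
      obtain ⟨s', ⟨hs'n, s'', hs'', hne⟩, hps'⟩ := hcov s hsn (mem_thickening_iff.2 ⟨z, hzs, hpz⟩)
      obtain rfl : s'' = s := hs''
      exact ⟨s', ⟨hs'n, s'', hs, hne⟩, hps'⟩
  obtain ⟨m, hm⟩ := exists_nat_gt (r / δ)
  refine ⟨m + 1, fun t ht => (thickening_mono ?_ t).trans (key m t ht)⟩
  rw [div_lt_iff₀ hδ] at hm
  push_cast
  nlinarith

end LocalityRadius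

end PolyhedralTiling

/-! ### Integration of forms along edge paths -/

namespace PolyhedralTiling

open Metric

variable {n : ℕ} {T : PolyhedralTiling n} {k : ℕ}

theorem evalPath_append (f : T.APGEdge k → EucSp n) {a b c : EucSp n} (p : T.graph.Walk a b)
    (q : T.graph.Walk b c) : T.evalPath f (p.append q) = T.evalPath f p + T.evalPath f q := by
  simp [evalPath, SimpleGraph.Walk.darts_append]

theorem IsCocycle.evalPath_reverse {f : T.APGEdge k → EucSp n} (hf : T.IsCocycle k f)
    {a b : EucSp n} (p : T.graph.Walk a b) : T.evalPath f p.reverse = -T.evalPath f p := by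
  induction p with
  | nil => simp [evalPath]
  | @cons a b c hab p ih =>
    have h1 := hf.1 ⟨(a, b), hab⟩
    have h2 : T.evalPath f (SimpleGraph.Walk.cons hab p)
        = f (T.toAPG k ⟨(a, b), hab⟩) + T.evalPath f p := by simp [evalPath]
    have h3 : T.evalPath f (SimpleGraph.Walk.cons hab.symm .nil)
        = f (T.toAPG k (SimpleGraph.Dart.symm ⟨(a, b), hab⟩)) := by simp [evalPath]
    rw [SimpleGraph.Walk.reverse_cons, evalPath_append, ih, h3, h1, h2, neg_add_rev]

theorem evalPath_eq_sub {f : T.APGEdge k → EucSp n} {φ : EucSp n → EucSp n}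
    (hf : ∀ e : T.graph.Dart, f (T.toAPG k e) = φ e.snd - φ e.fst) {a b : EucSp n}
    (p : T.graph.Walk a b) : T.evalPath f p = φ b - φ a := by
  induction p with
  | nil => simp [evalPath]
  | @cons a b c hab p ih =>
    have h2 : T.evalPath f (SimpleGraph.Walk.cons hab p)
        = f (T.toAPG k ⟨(a, b), hab⟩) + T.evalPath f p := by simp [evalPath]
    rw [h2, ih, hf]
    simp

/-- The `k`-collared prototile of a tile determines the patches of radius `r` around its points: their
vertices are cells of the collar. -/
theorem LargeComparedTo.patch_eq_of_collarCongruent {r : ℝ} (hk : T.LargeComparedTo k r)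
    {v : EucSp n} {t t' : Set (EucSp n)} (h : T.CollarCongruent k v t t') {p : EucSp n}
    (hp : p ∈ t) :
    patch r (shiftSet T.vertexSet p) = patch r (shiftSet T.vertexSet (p + v)) := by
  obtain ⟨ht, ht', rfl, hcells⟩ := h
  have hmem : ∀ t ∈ T.cell n, ∀ p ∈ t, ∀ q, ‖q‖ < r → q + p ∈ T.vertexSet →
      {q + p} ∈ T.collarCells k t 0 := by
    intro t ht p hp q hq hqp
    obtain ⟨s, hs, hqs⟩ := hk t ht (mem_thickening_iff.2 ⟨p, hp, by rwa [dist_eq_norm, add_sub_cancel_right]⟩)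
    exact ⟨T.mem_vertexSet.1 hqp, s, hs, Set.singleton_subset_iff.2 hqs⟩
  refine patch_eq_iff.2 fun q hq => ?_
  rw [mem_shiftSet, mem_shiftSet]
  constructor
  · intro hqp
    have := Set.mem_image_of_mem (Set.image fun x => x + v) (hmem t ht p hp q hq hqp)
    rw [hcells, Set.image_singleton, add_assoc] at this
    exact T.mem_vertexSet.2 this.1
  · intro hqp
    have := hmem _ ht' (p + v) ⟨p, hp, rfl⟩ q hq hqp
    rw [← hcells] at this
    obtain ⟨c, hc, hcq⟩ := this
    have : c = {q + p} := (Set.image_injective.2 (add_left_injective v)) (by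
      rw [hcq, Set.image_singleton, add_assoc])
    exact T.mem_vertexSet.2 (this ▸ hc.1)

/-- The integral of an equivariant form along edges is a cocycle of every complex whose collars
control the range of the form. -/
theorem LargeComparedTo.exists_isCocycle {r : ℝ} (hk : T.LargeComparedTo k r)
    {φ : EucSp n → EucSp n} (hφ : Differentiable ℝ φ)
    (hr : EquivariantRange T.vertexSet r (fderiv ℝ φ)) :
    ∃ f : T.APGEdge k → EucSp n, T.IsCocycle k f ∧
      ∀ e : T.graph.Dart, f (T.toAPG k e) = φ e.snd - φ e.fst := by
  let f : T.APGEdge k → EucSp n := Quot.lift (fun e : T.graph.Dart => φ e.snd - φ e.fst) (by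
    rintro e e' ⟨v, t, t', h, hseg, h1, h2⟩
    have := sub_eq_sub_of_fderiv_eq (y := e.fst) (y' := e'.fst) (s := e.snd - e.fst) hφ
      fun τ hτ => by
        rw [h1, add_right_comm]
        refine hr _ _ (hk.patch_eq_of_collarCongruent h (hseg ?_))
        rw [segment_eq_image']
        exact ⟨τ, Set.Ico_subset_Icc_self hτ, rfl⟩
    rwa [add_sub_cancel, h1, add_right_comm, add_sub_cancel, ← h1, ← h2] at this)
  have hf : ∀ e : T.graph.Dart, f (T.toAPG k e) = φ e.snd - φ e.fst := fun e => rfl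
  refine ⟨f, ⟨fun e => ?_, fun w _ a p _ => ?_⟩, hf⟩
  · rw [hf, hf]
    exact (neg_sub _ _).symm
  · rw [evalPath_eq_sub hf, sub_self]

theorem isCechImage_of_markerRel (hP : DeloneFLC T.vertexSet) {f : T.APGEdge k → EucSp n}
    {φ : EucSp n → EucSp n} (hf : ∀ e : T.graph.Dart, f (T.toAPG k e) = φ e.snd - φ e.fst)
    {g : cechCocycles (Hull T.vertexSet) (EucSp n)} (hg : hP.MarkerRel φ g.1) :
    T.IsCechImage k f (Submodule.Quotient.mk g) := by
  obtain ⟨U, m, δ, hU, hm, h⟩ := hg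
  refine ⟨g, rfl, U, m, δ, hU, hm, fun x x' ξ y v v' hξ hx hx' hv hv' hd hd' p => ?_⟩
  rw [hP.eq_orb hξ] at hx hx'
  rw [evalPath_eq_sub hf]
  exact h x x' y v v' hx hx' hv hv' hd hd'

/-! ### Potentials of cellular cocycles -/

/-- A cocycle of `Γ^k` that has a Čech image is the differential of a function on the vertices: it
vanishes on the closed edge paths at one vertex, hence on all of them. -/
theorem IsCechImage.exists_vertex_potential (hP : DeloneFLC T.vertexSet)
    {f : T.APGEdge k → EucSp n} (hf : T.IsCocycle k f)
    {η : CechH1 (Hull T.vertexSet) (EucSp n)} (h : T.IsCechImage k f η) :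
    ∃ F : EucSp n → EucSp n, ∀ v ∈ T.vertexSet, ∀ v' ∈ T.vertexSet, ∀ p : T.graph.Walk v v',
      T.evalPath f p = F v' - F v := by
  classical
  obtain ⟨g, -, U, m, δ, hU, hm, hg⟩ := h
  -- the marker of `P` itself serves as the base vertex
  set ξ := hP.orb 0 with hξ
  have h0 : ξ.1 = T.vertexSet := by rw [hξ, DeloneFLC.orb_val, shiftSet_zero]
  have hb : m ξ ∈ T.vertexSet := h0 ▸ (hm ξ).1
  have hclosed : ∀ p : T.graph.Walk (m ξ) (m ξ), T.evalPath f p = 0 := fun p => by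
    have hd : dist (m ξ - 0) (m ξ) < δ ξ := by simpa using (hm ξ).2
    rw [← hg ξ ξ ξ 0 (m ξ) (m ξ) rfl (hU ξ).2 (hU ξ).2 hb hb hd hd p]
    obtain ⟨V, hV, hc⟩ := g.2
    simpa using hc ξ ξ ξ ⟨ξ, ⟨(hV ξ).2, (hV ξ).2⟩, (hV ξ).2⟩
  have hwalk : ∀ v ∈ T.vertexSet, Nonempty (T.graph.Walk (m ξ) v) := fun v hv =>
    let ⟨p, _⟩ := T.joined_along_segment hb hv
    ⟨p⟩
  let q : ∀ v ∈ T.vertexSet, T.graph.Walk (m ξ) v := fun v hv => (hwalk v hv).some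
  refine ⟨fun v => if hv : v ∈ T.vertexSet then T.evalPath f (q v hv) else 0,
    fun v hv v' hv' p => ?_⟩
  have := hclosed (((q v hv).append p).append (q v' hv').reverse)
  rw [evalPath_append, evalPath_append, hf.evalPath_reverse, add_neg_eq_zero] at this
  simp only [dif_pos hv, dif_pos hv']
  rw [← this, add_sub_cancel_left]

/-- The potential of a cocycle of `Γ^k` has equivariant increments, because an edge path along the
segment between two vertices can be translated between equal patches. -/
theorem LocalityRadius.vertexIncrementRange {D E : ℝ} (hDE : T.LocalityRadius D E)
    {f : T.APGEdge k → EucSp n} {F : EucSp n → EucSp n}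
    (hF : ∀ v ∈ T.vertexSet, ∀ v' ∈ T.vertexSet, ∀ p : T.graph.Walk v v',
      T.evalPath f p = F v' - F v) :
    VertexIncrementRange T.vertexSet (1 + (k + 1) * D + E) F := by
  intro v hv v' hv' s hvs hpatch
  have hD := hDE.nonneg
  have hE := hDE.nonneg'
  have hkD : 0 ≤ (k + 1) * D := by positivity
  obtain ⟨p, hp⟩ := T.joined_along_segment hv hvs
  obtain ⟨p', hp'⟩ := hDE.exists_walk_translate (x := v) (y := v') (r := 1 + ‖s‖) f
    (by convert hpatch using 2 <;> ring) (fun t ht => ⟨ht.1, by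
      obtain ⟨q, hqt, hq⟩ := ht.2
      refine ⟨q, hqt, ?_⟩
      rw [segment_eq_image'] at hq
      obtain ⟨τ, hτ, rfl⟩ := hq
      rw [add_sub_cancel_left, mem_ball, dist_eq_norm, add_sub_cancel_left, norm_smul,
        Real.norm_of_nonneg hτ.1]
      nlinarith [norm_nonneg s, hτ.2]⟩) p hp
  have hvs' : v' + s ∈ T.vertexSet := mem_of_patch_eq hpatch (by linarith) hvs
  have e1 : v + (v' - v) = v' := by abel
  have e2 : v + s + (v' - v) = v' + s := by abel
  have h1 := hF v hv _ hvs p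
  have h2 := hF _ (by rwa [e1]) _ (by rwa [e2]) p'
  rw [hp', h1, e1, e2] at h2
  exact h2

/-- A potential of a negligible cocycle is a uniform limit of strongly equivariant functions on the
vertices: its value at a vertex is close to its value at any other vertex with the same patch. -/
theorem IsNegligibleCocycle.exists_approximation {D E : ℝ} (hDE : T.LocalityRadius D E)
    {f : T.APGEdge k → EucSp n} (hf : T.IsNegligibleCocycle k f) {F : EucSp n → EucSp n}
    (hF : ∀ v ∈ T.vertexSet, ∀ v' ∈ T.vertexSet, ∀ p : T.graph.Walk v v',
      T.evalPath f p = F v' - F v) {ε : ℝ} (hε : 0 < ε) :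
    ∃ F' : EucSp n → EucSp n, StronglyEquivariant T.vertexSet F' ∧
      ∀ v ∈ T.vertexSet, ‖F v - F' v‖ ≤ ε := by
  obtain ⟨r, hr⟩ := hf ε hε
  -- a vertex with the given patch, when there is one
  let w : Set (EucSp n) → EucSp n := fun p => Classical.epsilon fun w =>
    w ∈ T.vertexSet ∧ patch (r + 1 + E) (shiftSet T.vertexSet w) = p
  refine ⟨fun v => F (w (patch (r + 1 + E) (shiftSet T.vertexSet v))),
    ⟨r + 1 + E, fun x y h => by simp only [h]⟩, fun v hv => ?_⟩
  obtain ⟨hw, hwv⟩ : w (patch (r + 1 + E) (shiftSet T.vertexSet v)) ∈ T.vertexSet ∧ _ :=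
    Classical.epsilon_spec (p := fun w => w ∈ T.vertexSet ∧
      patch (r + 1 + E) (shiftSet T.vertexSet w) = patch (r + 1 + E) (shiftSet T.vertexSet v))
      ⟨v, hv, rfl⟩
  obtain ⟨p, -⟩ := T.joined_along_segment hw hv
  have := hr _ hw v hv ⟨r + 1, by linarith, hDE.tiling _ _ _ hwv⟩ p
  rw [hF _ hw v hv p] at this
  exact this.le

/-- A negligible class is the class of the differential of a weakly equivariant function. -/
theorem AsymptoticallyNegligible.exists_weaklyEquivariant (hP : DeloneFLC T.vertexSet) {D E : ℝ}
    (hDE : T.LocalityRadius D E) {η : CechH1 (Hull T.vertexSet) (EucSp n)}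
    (h : T.AsymptoticallyNegligible η) :
    ∃ (φ : EucSp n → EucSp n) (g : cechCocycles (Hull T.vertexSet) (EucSp n)),
      WeaklyEquivariant T.vertexSet φ ∧ fderiv ℝ φ ∈ closedStrong T.vertexSet ∧
      hP.CechRel φ g.1 ∧ Submodule.Quotient.mk g = η := by
  classical
  obtain ⟨k, f, hf, hneg, him⟩ := h
  obtain ⟨F, hF⟩ := him.exists_vertex_potential hP hf
  obtain ⟨φ, R, hφ, hR, hφF, hw⟩ := (hDE.vertexIncrementRange hF).exists_smooth hP
  obtain ⟨g, hgη, U, m, δ, hU, hm, hg⟩ := him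
  refine ⟨φ, g, hw fun ε hε => hneg.exists_approximation hDE hF hε,
    (fderiv_mem_closedStrong_iff hφ).2 ⟨R, hR⟩, ?_, hgη⟩
  -- off the vertices `F` is modified to agree with `φ`, so that it differs from `φ` by a strongly
  -- equivariant function everywhere
  let G : EucSp n → EucSp n := fun y => if y ∈ T.vertexSet then F y else φ y
  have hGF : ∀ v ∈ T.vertexSet, G v = F v := fun v hv => if_pos hv
  have hs : EquivariantRange T.vertexSet (max R 1) (φ - G) := by
    intro y y' hy
    have hiff : y ∈ T.vertexSet ↔ y' ∈ T.vertexSet := by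
      have := patch_eq_iff.1 hy 0 (by simp)
      simpa [mem_shiftSet] using this
    by_cases hyP : y ∈ T.vertexSet
    · have hyP' := hiff.1 hyP
      simp only [Pi.sub_apply, hGF y hyP, hGF y' hyP']
      exact hφF y hyP y' hyP' (patch_mono (le_max_left _ _) hy)
    · have hyP' := hiff.not.1 hyP
      simp [G, hyP, hyP']
  have hG : IncrementRange T.vertexSet (max R (max R 1)) G := by
    simpa using hR.sub (IncrementRange.of_equivariant hs)
  have hrel : hP.MarkerRel G g.1 := by
    refine ⟨U, m, δ, hU, hm, fun x x' y v v' hx hx' hv hv' hd hd' => ?_⟩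
    obtain ⟨p, -⟩ := T.joined_along_segment hv hv'
    rw [hGF v hv, hGF v' hv', ← hF v hv v' hv' p]
    exact hg x x' _ y v v' (hP.orb_val y) hx hx' hv hv' hd hd' p
  have := (hrel.cechRel hG).add (DeloneFLC.cechRel_zero (hP := hP) ⟨_, hs⟩)
  rwa [add_sub_cancel, add_zero] at this

/-- The integral along edge paths of the differential of a weakly equivariant function is
negligible. -/
theorem _root_.WeaklyEquivariant.isNegligibleCocycle {φ : EucSp n → EucSp n}
    (hφ : WeaklyEquivariant T.vertexSet φ) {f : T.APGEdge k → EucSp n}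
    (hf : ∀ e : T.graph.Dart, f (T.toAPG k e) = φ e.snd - φ e.fst) :
    T.IsNegligibleCocycle k f := by
  intro ε hε
  obtain ⟨ψ, -, ⟨R, hR⟩, hψ⟩ := hφ.2 0 (ε / 2) (half_pos hε)
  refine ⟨R, fun x _ y _ ⟨r, hr, hxy⟩ p => ?_⟩
  have hψxy := hR x y (patch_mono hr.le (patch_vertexSet_of_tilingPatch hxy))
  have hclose : ∀ x, ‖φ x - ψ x‖ < ε / 2 := fun x => by
    simpa [norm_iteratedFDeriv_zero] using hψ 0 le_rfl x
  rw [evalPath_eq_sub hf,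
    show φ y - φ x = (φ y - ψ y) - (φ x - ψ x) by rw [hψxy]; abel]
  exact (norm_sub_le _ _).trans_lt (by linarith [hclose x, hclose y])

end PolyhedralTiling

theorem mem_weaklyExactClasses_iff {n : ℕ} {P : Set (EucSp n)} {a : StrongH1 P} :
    a ∈ weaklyExactClasses P ↔ ∃ (φ : EucSp n → EucSp n) (h : fderiv ℝ φ ∈ closedStrong P),
      WeaklyEquivariant P φ ∧ a = Submodule.Quotient.mk ⟨fderiv ℝ φ, h⟩ := by
  constructor
  · rintro ⟨⟨α, hα⟩, ⟨φ, hφ, hφα⟩, rfl⟩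
    obtain rfl : fderiv ℝ φ = α := funext hφα
    exact ⟨φ, hα, hφ, rfl⟩
  · rintro ⟨φ, h, hφ, rfl⟩
    exact ⟨⟨fderiv ℝ φ, h⟩, ⟨φ, hφ, fun _ => rfl⟩, rfl⟩

theorem mainTheorem1 (n : ℕ) (hn : 0 < n) (T : PolyhedralTiling n)
    (hT : T.FiniteLocalComplexity) (hder : T.DerivableFromVertices) :
    ∃ Θ : StrongH1 T.vertexSet ≃ₗ[ℝ] CechH1 (Hull T.vertexSet) (EucSp n),
      T.IsTheta Θ ∧
      ∀ η : CechH1 (Hull T.vertexSet) (EucSp n),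
        (T.AsymptoticallyNegligible η ↔ Θ.symm η ∈ weaklyExactClasses T.vertexSet) ∧
        (T.AsymptoticallyNegligible η ↔
          ∃ (φ : EucSp n → EucSp n) (h : fderiv ℝ φ ∈ closedStrong T.vertexSet),
            WeaklyEquivariant T.vertexSet φ ∧
              Θ.symm η = Submodule.Quotient.mk ⟨fderiv ℝ φ, h⟩) := by
  have hP := PolyhedralTiling.deloneFLC hT
  obtain ⟨D, E, hDE⟩ := PolyhedralTiling.exists_localityRadius hT hder
  obtain ⟨Θ, hΘ⟩ := hP.exists_equiv hn
  have hTheta : T.IsTheta Θ := by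
    intro α φ hφ hφα r k hr hk
    have hα : fderiv ℝ φ = α.1 := funext hφα
    rw [← hα] at hr
    obtain ⟨f, hf, hfφ⟩ := hk.exists_isCocycle (hφ.differentiable (by simp)) hr
    have hinc := IncrementRange.of_fderiv (hφ.differentiable (by simp)) hr
    obtain ⟨g, hg, hgφ⟩ := DeloneFLC.exists_markerRel hP hinc
    refine ⟨f, hf, hfφ, ?_⟩
    rw [hΘ α φ ⟨g, hg⟩ hφ hφα (hgφ.cechRel hinc)]
    exact PolyhedralTiling.isCechImage_of_markerRel hP hfφ hgφ
  have key : ∀ η, T.AsymptoticallyNegligible η ↔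
      ∃ (φ : EucSp n → EucSp n) (h : fderiv ℝ φ ∈ closedStrong T.vertexSet),
        WeaklyEquivariant T.vertexSet φ ∧
          Θ.symm η = Submodule.Quotient.mk ⟨fderiv ℝ φ, h⟩ := by
    intro η
    constructor
    · intro hη
      obtain ⟨φ, g, hw, h, hrel, rfl⟩ := hη.exists_weaklyEquivariant hP hDE
      refine ⟨φ, h, hw, ?_⟩
      rw [LinearEquiv.symm_apply_eq]
      exact (hΘ ⟨fderiv ℝ φ, h⟩ φ g hw.1 (fun _ => rfl) hrel).symm
    · rintro ⟨φ, h, hw, hη⟩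
      rw [LinearEquiv.symm_apply_eq] at hη
      obtain ⟨r, hr⟩ := h.2.1
      obtain ⟨k, hk⟩ := hDE.exists_largeComparedTo hT r
      obtain ⟨f, hf, hfφ, him⟩ := hTheta ⟨fderiv ℝ φ, h⟩ φ hw.1 (fun _ => rfl) r k hr hk
      rw [← hη] at him
      exact ⟨k, f, hf, hw.isNegligibleCocycle hfφ, him⟩
  exact ⟨Θ, hTheta, fun η => ⟨(key η).trans mem_weaklyExactClasses_iff.symm, key η⟩⟩
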